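/- Conventions. For a ring $R$, $\mathrm{spli}(R)$ (resp. $\mathrm{sfli}(R)$) is the supremum of the projective (resp. flat) dimensions of the injective $R$-modules. An $R$-module is Gorenstein projective (resp. Gorenstein injective, Gorenstein flat) if it is a syzygy of an acyclic complex $C$ of projective (resp. injective, flat) modules such that $\mathrm{Hom}_R(C,Q)$ is acyclic for every projective $Q$ (resp. $\mathrm{Hom}_R(I,C)$ is acyclic for every injective $I$; the tensor product of $C$ over $R$ with every injective module of the opposite side is acyclic). $\mathrm{Gpd}_R(M)$ and $\mathrm{Gfd}_R(M)$ are the minimal lengths of resolutions of $M$ by Gorenstein projective, resp. Gorenstein flat, modules, and $\mathrm{Gid}_R(M)$ is the minimal length of a coresolution of $M$ by Gorenstein injective modules ($\infty$ if none of finite length exists); $\mathrm{pd}$ is the projective dimension. Let $A$ be a commutative ring. $\mathscr X_{\mathrm{Char}}$ is the class of groups $G$ for which there are an $AG$-module $M$ that is free over $A$ and has finite projective dimension over $AG$, and an $AG$-monomorphism $A\hookrightarrow M$ (with $G$ acting trivially on $A$) that splits over $A$. $\mathscr X_{\mathrm{WChar}}$ is the class of groups $G$ for which there are an $AG$-module $N$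 that is flat over $A$ and has finite flat dimension over $AG$, and an $AG$-monomorphism $A\hookrightarrow N$ that is pure over $A$. For a class of groups $\mathscr X$ and $\dim\in\{\mathrm{pd},\mathrm{Gpd},\mathrm{Gid},\mathrm{Gfd}\}$, a group $G$ is of type $\Phi(\dim,\mathscr X)$ over $A$ if for every $AG$-module $M$: $\dim_{AG}(M)<\infty$ if and only if $\dim_{AH}(M)<\infty$ for all subgroups $H\le G$ with $H\in\mathscr X$. Let $\mathscr F$ be the class of finite groups and $\mathscr F_{\phi,A}$ the class of groups of type $\Phi(\mathrm{pd},\mathscr F)$ over $A$. Corollary. (i) If $\mathrm{spli}(A)<\infty$, then for every class of groups $\mathscr X\subseteq\mathscr X_{\mathrm{Char}}$, $$\{\text{groups of type }\Phi(\mathrm{Gpd},\mathscr X)\text{ over }A\}=\{\text{groups of type }\Phi(\mathrm{Gid},\mathscr X)\text{ over }A\}=\mathscr X_{\mathrm{Char}}.$$ In particular, these equalities hold for each of $\mathscr X=\mathscr F,\ \mathscr F_{\phi,A},\ \mathscr X_{\mathrm{Char}}$. (ii) If $\mathrm{sfli}(A)<\infty$, then for every class of groups $\mathscr X\subseteq\mathscr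 X_{\mathrm{WChar}}$, $$\{\text{groups of type }\Phi(\mathrm{Gfd},\mathscr X)\text{ over }A\}=\mathscr X_{\mathrm{WChar}}.$$ In particular, this equality holds for each of $\mathscr X=\mathscr F,\ \mathscr F_{\phi,A},\ \mathscr X_{\mathrm{Char}},\ \mathscr X_{\mathrm{WChar}}$. -/

import Mathlib

open CategoryTheory

universe u

namespace TypePhi

noncomputable section

/-! ### Tensor products over a not necessarily commutative ring, and flat modules

Right `R`-modules are modules over `Rᵐᵒᵖ`. -/

section Tensor

variable (R : Type u) [Ring R]

/-- The relations `(n · r) ⊗ m = n ⊗ (r • m)`, for a right module `N` and a left module `M`. -/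
def balancedRel (N M : Type u) [AddCommGroup N] [Module Rᵐᵒᵖ N] [AddCommGroup M] [Module R M] :
    AddSubgroup (TensorProduct ℤ N M) :=
  AddSubgroup.closure {t | ∃ (n : N) (r : R) (m : M),
    t = TensorProduct.tmul ℤ (MulOpposite.op r • n) m - TensorProduct.tmul ℤ n (r • m)}

/-- The abelian group `N ⊗_R M`, for a right `R`-module `N` and a left `R`-module `M`. -/
abbrev BalTensor (N M : Type u) [AddCommGroup N] [Module Rᵐᵒᵖ N] [AddCommGroup M] [Module R M] :
    Type u :=
  TensorProduct ℤ N M ⧸ balancedRel R N M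

variable {R}

/-- `N ⊗_R f : N ⊗_R M → N ⊗_R M'`. -/
def BalTensor.lTensor (N : Type u) [AddCommGroup N] [Module Rᵐᵒᵖ N]
    {M M' : Type u} [AddCommGroup M] [Module R M] [AddCommGroup M'] [Module R M']
    (f : M →ₗ[R] M') : BalTensor R N M →+ BalTensor R N M' :=
  QuotientAddGroup.map _ _
    (LinearMap.lTensor N f.toAddMonoidHom.toIntLinearMap).toAddMonoidHom (by
      rw [balancedRel, AddSubgroup.closure_le]
      rintro _ ⟨n, r, m, rfl⟩
      exact AddSubgroup.subset_closure ⟨n, r, f m, by simp [map_sub]⟩)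

/-- `f ⊗_R M : N ⊗_R M → N' ⊗_R M`. -/
def BalTensor.rTensor (M : Type u) [AddCommGroup M] [Module R M]
    {N N' : Type u} [AddCommGroup N] [Module Rᵐᵒᵖ N] [AddCommGroup N'] [Module Rᵐᵒᵖ N']
    (f : N →ₗ[Rᵐᵒᵖ] N') : BalTensor R N M →+ BalTensor R N' M :=
  QuotientAddGroup.map _ _
    (LinearMap.rTensor M f.toAddMonoidHom.toIntLinearMap).toAddMonoidHom (by
      rw [balancedRel, AddSubgroup.closure_le]
      rintro _ ⟨n, r, m, rfl⟩
      exact AddSubgroup.subset_closure ⟨f n, r, m, by simp [map_sub]⟩)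

/-- A left `R`-module is flat if `- ⊗_R M` preserves injections of right `R`-modules. -/
def IsFlat (M : ModuleCat.{u} R) : Prop :=
  ∀ (N N' : ModuleCat.{u} Rᵐᵒᵖ) (f : N ⟶ N'), Function.Injective f.hom →
    Function.Injective (BalTensor.rTensor (R := R) M f.hom)

end Tensor

/-! ### Dimensions relative to a class of modules -/

section Dimensions

variable {R : Type u} [Ring R]

/-- `M` has a resolution `0 → C_n → ⋯ → C_0 → M → 0` with all `C_i` in the class `𝒞`. -/
def HasResolution (𝒞 : ModuleCat.{u} R → Prop) : ℕ → ModuleCat.{u} R → Prop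
  | 0, M => 𝒞 M
  | n + 1, M => ∃ (K C : ModuleCat.{u} R) (i : K ⟶ C) (p : C ⟶ M), 𝒞 C ∧
      Function.Injective i.hom ∧ Function.Exact i.hom p.hom ∧ Function.Surjective p.hom ∧
      HasResolution 𝒞 n K

/-- `M` has a coresolution `0 → M → C_0 → ⋯ → C_n → 0` with all `C_i` in the class `𝒞`. -/
def HasCoresolution (𝒞 : ModuleCat.{u} R → Prop) : ℕ → ModuleCat.{u} R → Prop
  | 0, M => 𝒞 M
  | n + 1, M => ∃ (C K : ModuleCat.{u} R) (i : M ⟶ C) (p : C ⟶ K), 𝒞 C ∧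
      Function.Injective i.hom ∧ Function.Exact i.hom p.hom ∧ Function.Surjective p.hom ∧
      HasCoresolution 𝒞 n K

/-- The minimal length of a resolution of `M` by modules in `𝒞` (`⊤` if there is none). -/
def resolutionDim (𝒞 : ModuleCat.{u} R → Prop) (M : ModuleCat.{u} R) : WithBot ℕ∞ :=
  ⨅ (n : ℕ) (_ : HasResolution 𝒞 n M), (n : WithBot ℕ∞)

/-- The minimal length of a coresolution of `M` by modules in `𝒞` (`⊤` if there is none). -/
def coresolutionDim (𝒞 : ModuleCat.{u} R → Prop) (M : ModuleCat.{u} R) : WithBot ℕ∞ :=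
  ⨅ (n : ℕ) (_ : HasCoresolution 𝒞 n M), (n : WithBot ℕ∞)

/-- `M` is Gorenstein projective: a syzygy of an acyclic complex `P` of projective modules such
that `Hom_R(P, Q)` is acyclic for every projective module `Q`. -/
def IsGorensteinProjective (M : ModuleCat.{u} R) : Prop :=
  ∃ P : CochainComplex (ModuleCat.{u} R) ℤ,
    P.Acyclic ∧ (∀ n, Projective (P.X n)) ∧
    (∀ Q : ModuleCat.{u} R, Projective Q → ∀ n : ℤ,
      Function.Exact (fun f : P.X (n + 1) ⟶ Q => P.d n (n + 1) ≫ f)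
        (fun f : P.X n ⟶ Q => P.d (n - 1) n ≫ f)) ∧
    Nonempty (M ≅ P.cycles 0)

/-- `M` is Gorenstein injective: a syzygy of an acyclic complex `E` of injective modules such
that `Hom_R(I, E)` is acyclic for every injective module `I`. -/
def IsGorensteinInjective (M : ModuleCat.{u} R) : Prop :=
  ∃ E : CochainComplex (ModuleCat.{u} R) ℤ,
    E.Acyclic ∧ (∀ n, Injective (E.X n)) ∧
    (∀ I : ModuleCat.{u} R, Injective I → ∀ n : ℤ,
      Function.Exact (fun f : I ⟶ E.X (n - 1) => f ≫ E.d (n - 1) n)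
        (fun f : I ⟶ E.X n => f ≫ E.d n (n + 1))) ∧
    Nonempty (M ≅ E.cycles 0)

/-- `M` is Gorenstein flat: a syzygy of an acyclic complex `F` of flat modules such that
`I ⊗_R F` is acyclic for every injective right module `I`. -/
def IsGorensteinFlat (M : ModuleCat.{u} R) : Prop :=
  ∃ F : CochainComplex (ModuleCat.{u} R) ℤ,
    F.Acyclic ∧ (∀ n, IsFlat (F.X n)) ∧
    (∀ I : ModuleCat.{u} Rᵐᵒᵖ, Injective I → ∀ n : ℤ,
      Function.Exact (BalTensor.lTensor (R := R) I (F.d (n - 1) n).hom)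
        (BalTensor.lTensor (R := R) I (F.d n (n + 1)).hom)) ∧
    Nonempty (M ≅ F.cycles 0)

variable (R)

/-- Projective dimension. -/
def pd (M : ModuleCat.{u} R) : WithBot ℕ∞ := projectiveDimension M

/-- Flat dimension. -/
def fd (M : ModuleCat.{u} R) : WithBot ℕ∞ := resolutionDim IsFlat M

/-- Gorenstein projective dimension. -/
def Gpd (M : ModuleCat.{u} R) : WithBot ℕ∞ := resolutionDim IsGorensteinProjective M

/-- Gorenstein injective dimension. -/
def Gid (M : ModuleCat.{u} R) : WithBot ℕ∞ := coresolutionDim IsGorensteinInjective M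

/-- Gorenstein flat dimension. -/
def Gfd (M : ModuleCat.{u} R) : WithBot ℕ∞ := resolutionDim IsGorensteinFlat M

/-- The supremum of the projective dimensions of the injective `R`-modules. -/
def spli : WithBot ℕ∞ := ⨆ (I : ModuleCat.{u} R) (_ : Injective I), pd R I

/-- The supremum of the flat dimensions of the injective `R`-modules. -/
def sfli : WithBot ℕ∞ := ⨆ (I : ModuleCat.{u} R) (_ : Injective I), fd R I

end Dimensions

/-! ### Modules over group algebras

Modules over `A[G]` are left modules; they correspond to right modules through `g ↦ g⁻¹`. -/

section Groups

variable (A : Type u) [CommRing A]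

/-- Restriction of modules from `A[G]` to `A[H]`, for a subgroup `H` of `G`. -/
def resSubgroup (G : Type u) [Group G] (H : Subgroup G) :
    ModuleCat.{u} (MonoidAlgebra A G) ⥤ ModuleCat.{u} (MonoidAlgebra A H) :=
  ModuleCat.restrictScalars (MonoidAlgebra.mapDomainRingHom A H.subtype)

/-- The underlying `A`-module of an `A[G]`-module. -/
def resBase (G : Type u) [Group G] : ModuleCat.{u} (MonoidAlgebra A G) ⥤ ModuleCat.{u} A :=
  ModuleCat.restrictScalars (algebraMap A (MonoidAlgebra A G))

/-- The `A[G]`-module `A` with trivial action of `G`, that is, with `A[G]` acting through the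
augmentation map. -/
def trivialModule (G : Type u) [Group G] : ModuleCat.{u} (MonoidAlgebra A G) :=
  (ModuleCat.restrictScalars (MonoidAlgebra.lift A A G 1 : MonoidAlgebra A G →+* A)).obj
    (ModuleCat.of A A)

/-- `M` is a characteristic module with respect to the map `ι : A → M`. -/
structure IsCharacteristicModule (G : Type u) [Group G] (M : ModuleCat.{u} (MonoidAlgebra A G))
    (ι : trivialModule A G ⟶ M) : Prop where
  free : Module.Free A ((resBase A G).obj M)
  pd_finite : pd _ M < ⊤
  mono : Function.Injective ι.hom
  split : IsSplitMono ((resBase A G).map ι)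

/-- `N` is a weak characteristic module with respect to the map `ι : A → N`; purity of `ι` over
`A` means that it stays injective after tensoring with any `A`-module. -/
structure IsWeakCharacteristicModule (G : Type u) [Group G]
    (N : ModuleCat.{u} (MonoidAlgebra A G)) (ι : trivialModule A G ⟶ N) : Prop where
  flat : Module.Flat A ((resBase A G).obj N)
  fd_finite : fd _ N < ⊤
  mono : Function.Injective ι.hom
  pure : ∀ X : ModuleCat.{u} A,
    Function.Injective (LinearMap.lTensor X ((resBase A G).map ι).hom)

/-- The class of groups admitting a characteristic module over `A`. -/
def XChar : Set GrpCat.{u} :=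
  {G | ∃ (M : ModuleCat.{u} (MonoidAlgebra A G)) (ι : trivialModule A G ⟶ M),
    IsCharacteristicModule A G M ι}

/-- The class of groups admitting a weak characteristic module over `A`. -/
def XWChar : Set GrpCat.{u} :=
  {G | ∃ (N : ModuleCat.{u} (MonoidAlgebra A G)) (ι : trivialModule A G ⟶ N),
    IsWeakCharacteristicModule A G N ι}

/-- The class of groups of type `Φ(dim, 𝒳)` over `A`: an `A[G]`-module has finite dimension if and
only if all its restrictions to subgroups in `𝒳` have finite dimension. -/
def typePhi (dim : (R : Type u) → [Ring R] → ModuleCat.{u} R → WithBot ℕ∞)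
    (𝒳 : Set GrpCat.{u}) : Set GrpCat.{u} :=
  {G | ∀ M : ModuleCat.{u} (MonoidAlgebra A G),
    dim (MonoidAlgebra A G) M < ⊤ ↔
      ∀ H : Subgroup G, GrpCat.of H ∈ 𝒳 → dim (MonoidAlgebra A H) ((resSubgroup A G H).obj M) < ⊤}

/-- The class of finite groups. -/
def finiteGroups : Set GrpCat.{u} := {G | Finite G}

/-- The class of groups that are classically of type `Φ` over `A`. -/
def classicalTypePhi : Set GrpCat.{u} := typePhi A pd finiteGroups

end Groups

end

end TypePhi

/-!
The three equalities have the same shape. A group `G` belongs to the class on the right if and only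
if all `A[G]`-modules have finite dimension, and the classes on the right contain `𝒳`; so the
condition on subgroups in the definition of `typePhi` is void on both sides (`typePhi_eq`).

The finiteness of all Gorenstein dimensions over `A[G]` is the finiteness of `spli` (or `sfli`) of
`A[G]`: if `spli R ≤ n`, then `n`-th syzygies and cosyzygies are Gorenstein projective and Gorenstein
injective (`SpliLE.hasResolution`, `SpliLE.hasCoresolution`), since splicing syzygies of
injective coresolutions with projective resolutions gives unbounded acyclic complexes, and similarly
for `sfli` and Gorenstein flat modules (`SfliLE.hasResolution`). The Gorenstein projective case
needs that such complexes stay acyclic under maps into projective modules. This holds as soon as they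
stay acyclic after tensoring with the modules of finite flat dimension
(`SfliLE.ext_one_of_unbounded`): by a sum over all degrees and an Eilenberg swindle, the complex may
be taken to be given by a single free module and a matrix of square zero, which is then exhausted by
subcomplexes with countable subquotients; a countable system of equations which is solvable in the
character modules of all modules of finite flat dimension can be treated by successive approximation
(`SfliLE.solvable_cokerEv`, `SfliLE.exists_solution`). Conversely, unbounded dimensions of
injective modules would give a module of infinite Gorenstein dimension by forming a product
(`exists_spliLE_of_resolution`, `exists_spliLE_of_coresolution`, `exists_sfliLE_of_resolution`).

It remains to relate `spli` and `sfli` of `A[G]` to (weak) characteristic modules. An injective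
`A[G]`-module is a summand of its diagonal tensor product with a characteristic module `M`, and the
dimension of this product is bounded by the sum of those of `M` and of an injective `A`-module
(`exists_spliLE_of_mem`, `exists_sfliLE_of_mem`). Conversely, if `spli` of `A[G]` is finite, the
trivial module embeds in a module of finite projective dimension with Gorenstein projective
quotient, which is projective over `A` because the dimensions over `A` of its cosyzygies are bounded
(`mem_xChar_of_spliLE`). If only `sfli` is finite, one uses an embedding in a module `N` of finite
flat dimension with quotient `W` orthogonal to all modules of finite flat dimension
(`SfliLE.exists_ses`); `W` is flat over `A`, since coinduction reduces this to orthogonality over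
`A[G]` (`mem_xWChar_of_sfliLE`). The embedding comes from the small object argument applied to those
submodules `V` of a free module of countable rank for which maps from `V` to modules of finite flat
dimension extend. That the resulting `N` has finite flat dimension is shown on its syzygies: every
finite system of linear equations for a syzygy takes place in a countably generated piece, for which
the lifting property of `N` provides solutions (`SfliLE.fdLE_zero`).

Finally, finite groups and groups classically of type `Φ` belong to `XChar`, because the bounded
functions on `G` are free over `A` and projective over all finite subgroups
(`finiteGroups_subset`, `classicalTypePhi_subset`).

Over a group algebra, left and right modules are identified by the involution inverting the elements
of the group; accordingly the general theory is developed for rings with involution, where the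
character module of a left module is again a left module. The flat dimension of a module is
expressed as the injective dimension of its character module (`FdLE`).
-/

namespace TypePhi

noncomputable section

/-! ### Short exact sequences of modules and vanishing of `Ext` -/

section ExtTools

open Abelian

variable {R : Type u} [Ring R]

/-- `0 → X → Y → Z → 0` is a short exact sequence of modules. -/
structure SES {X Y Z : ModuleCat.{u} R} (f : X ⟶ Y) (g : Y ⟶ Z) : Prop where
  inj : Function.Injective f.hom
  exact : Function.Exact f.hom g.hom
  surj : Function.Surjective g.hom

/-- `Ext^i(X, Y) = 0`. -/
def ExtVanish (X Y : ModuleCat.{u} R) (i : ℕ) : Prop := Subsingleton (Ext.{u} X Y i)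

section
variable {X Y Z : ModuleCat.{u} R} {f : X ⟶ Y} {g : Y ⟶ Z}

lemma SES.comp_zero (h : SES f g) : f ≫ g = 0 := by
  ext x
  exact h.exact.apply_apply_eq_zero x

lemma SES.shortExact (h : SES f g) : (ShortComplex.mk f g h.comp_zero).ShortExact where
  exact := by
    rw [ShortComplex.ShortExact.moduleCat_exact_iff_function_exact]
    exact h.exact
  mono_f := (ModuleCat.mono_iff_injective f).2 h.inj
  epi_g := (ModuleCat.epi_iff_surjective g).2 h.surj

lemma ses_ker (g : Y ⟶ Z) (hg : Function.Surjective g.hom) :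
    SES (ModuleCat.ofHom (LinearMap.ker g.hom).subtype) g where
  inj := Subtype.val_injective
  exact := by
    rw [LinearMap.exact_iff]
    simp
  surj := hg

lemma ses_coker (f : X ⟶ Y) (hf : Function.Injective f.hom) :
    SES f (ModuleCat.ofHom (LinearMap.range f.hom).mkQ) where
  inj := hf
  exact := by
    rw [LinearMap.exact_iff]
    simp
  surj := Submodule.mkQ_surjective _

/-- A map that kills the kernel of a surjection factors through it. -/
lemma SES.desc (h : SES f g) {N : ModuleCat.{u} R} (φ : Y ⟶ N) (hφ : f ≫ φ = 0) :
    ∃ ψ : Z ⟶ N, g ≫ ψ = φ :=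
  ⟨h.shortExact.gIsCokernel.desc (Limits.CokernelCofork.ofπ φ hφ),
    h.shortExact.gIsCokernel.fac (Limits.CokernelCofork.ofπ φ hφ) Limits.WalkingParallelPair.one⟩

lemma SES.lift (h : SES f g) {N : ModuleCat.{u} R} (φ : N ⟶ Y) (hφ : φ ≫ g = 0) :
    ∃ ψ : N ⟶ X, ψ ≫ f = φ :=
  ⟨h.shortExact.fIsKernel.lift (Limits.KernelFork.ofι φ hφ),
    h.shortExact.fIsKernel.fac (Limits.KernelFork.ofι φ hφ) Limits.WalkingParallelPair.zero⟩

end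

lemma extVanish_of_projective (P N : ModuleCat.{u} R) [Projective P] (i : ℕ) :
    ExtVanish P N (i + 1) := Ext.subsingleton_of_projective P N i

lemma extVanish_of_injective (N I : ModuleCat.{u} R) [Injective I] (i : ℕ) :
    ExtVanish N I (i + 1) := Ext.subsingleton_of_injective N I i

namespace SES
variable {X Y Z : ModuleCat.{u} R} {f : X ⟶ Y} {g : Y ⟶ Z} (h : SES f g) {N : ModuleCat.{u} R}
include h

lemma ext₂ {i : ℕ} (h₁ : ExtVanish X N i) (h₃ : ExtVanish Z N i) : ExtVanish Y N i := by
  refine subsingleton_of_forall_eq 0 fun e ↦ ?_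
  obtain ⟨x, rfl⟩ := Ext.contravariant_sequence_exact₂ h.shortExact N e
    (@Subsingleton.elim _ h₁ _ _)
  rw [@Subsingleton.elim _ h₃ x 0, Ext.comp_zero]

lemma ext₁ {i : ℕ} (h₂ : ExtVanish Y N i) (h₃ : ExtVanish Z N (i + 1)) : ExtVanish X N i := by
  refine subsingleton_of_forall_eq 0 fun e ↦ ?_
  obtain ⟨x, rfl⟩ := Ext.contravariant_sequence_exact₁ h.shortExact N e (add_comm 1 i)
    (@Subsingleton.elim _ h₃ _ _)
  rw [@Subsingleton.elim _ h₂ x 0, Ext.comp_zero]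

lemma ext₃ {i : ℕ} (h₁ : ExtVanish X N i) (h₂ : ExtVanish Y N (i + 1)) : ExtVanish Z N (i + 1) := by
  refine subsingleton_of_forall_eq 0 fun e ↦ ?_
  obtain ⟨x, rfl⟩ := Ext.contravariant_sequence_exact₃ h.shortExact N e
    (@Subsingleton.elim _ h₂ _ _) (add_comm 1 i)
  rw [@Subsingleton.elim _ h₁ x 0, Ext.comp_zero]

lemma coext₁ {i : ℕ} (h₃ : ExtVanish N Z i) (h₂ : ExtVanish N Y (i + 1)) :
    ExtVanish N X (i + 1) := by
  refine subsingleton_of_forall_eq 0 fun e ↦ ?_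
  obtain ⟨x, rfl⟩ := Ext.covariant_sequence_exact₁ N h.shortExact e
    (@Subsingleton.elim _ h₂ _ _) rfl
  rw [@Subsingleton.elim _ h₃ x 0, Ext.zero_comp]

lemma coext₃ {i : ℕ} (h₂ : ExtVanish N Y i) (h₁ : ExtVanish N X (i + 1)) : ExtVanish N Z i := by
  refine subsingleton_of_forall_eq 0 fun e ↦ ?_
  obtain ⟨x, rfl⟩ := Ext.covariant_sequence_exact₃ N h.shortExact e rfl
    (@Subsingleton.elim _ h₁ _ _)
  rw [@Subsingleton.elim _ h₂ x 0, Ext.zero_comp]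

/-- If `Ext¹(Z, N) = 0`, then maps `X → N` extend to `Y`. -/
lemma extend (h₃ : ExtVanish Z N 1) (φ : X ⟶ N) : ∃ ψ : Y ⟶ N, f ≫ ψ = φ := by
  obtain ⟨x, hx⟩ := Ext.contravariant_sequence_exact₁ h.shortExact N (Ext.mk₀ φ) (add_zero 1)
    (@Subsingleton.elim _ h₃ _ _)
  obtain ⟨ψ, rfl⟩ := Ext.homEquiv₀.symm.surjective x
  exact ⟨ψ, Ext.homEquiv₀.symm.injective (by simpa using hx)⟩

/-- If `Ext¹(N, X) = 0`, then maps `N → Z` lift to `Y`. -/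
lemma colift (h₁ : ExtVanish N X 1) (φ : N ⟶ Z) : ∃ ψ : N ⟶ Y, ψ ≫ g = φ := by
  obtain ⟨x, hx⟩ := Ext.covariant_sequence_exact₃ N h.shortExact (Ext.mk₀ φ) (zero_add 1)
    (@Subsingleton.elim _ h₁ _ _)
  obtain ⟨ψ, rfl⟩ := Ext.homEquiv₀.symm.surjective x
  exact ⟨ψ, Ext.homEquiv₀.symm.injective (by simpa using hx)⟩

lemma ext_one (h₂ : ExtVanish Y N 1) (H : ∀ φ : X ⟶ N, ∃ ψ : Y ⟶ N, f ≫ ψ = φ) :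
    ExtVanish Z N 1 := by
  refine subsingleton_of_forall_eq 0 fun e ↦ ?_
  obtain ⟨x, rfl⟩ := Ext.contravariant_sequence_exact₃ h.shortExact N e
    (@Subsingleton.elim _ h₂ _ _) (add_zero 1)
  obtain ⟨φ, rfl⟩ := Ext.homEquiv₀.symm.surjective x
  obtain ⟨ψ, rfl⟩ := H φ
  rw [Ext.homEquiv₀_symm_apply, ← Ext.mk₀_comp_mk₀, ← Ext.comp_assoc_of_second_deg_zero,
    h.shortExact.extClass_comp, Ext.zero_comp]

lemma coext_one (h₂ : ExtVanish N Y 1) (H : ∀ φ : N ⟶ Z, ∃ ψ : N ⟶ Y, ψ ≫ g = φ) :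
    ExtVanish N X 1 := by
  refine subsingleton_of_forall_eq 0 fun e ↦ ?_
  obtain ⟨x, rfl⟩ := Ext.covariant_sequence_exact₁ N h.shortExact e
    (@Subsingleton.elim _ h₂ _ _) (zero_add 1)
  obtain ⟨φ, rfl⟩ := Ext.homEquiv₀.symm.surjective x
  obtain ⟨ψ, rfl⟩ := H φ
  rw [Ext.homEquiv₀_symm_apply, ← Ext.mk₀_comp_mk₀, Ext.comp_assoc_of_second_deg_zero,
    h.shortExact.comp_extClass, Ext.comp_zero]

end SES

lemma ExtVanish.retract_left {X Y N : ModuleCat.{u} R} {i : ℕ} (h : ExtVanish Y N i)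
    (r : Retract X Y) : ExtVanish X N i := by
  refine subsingleton_of_forall_eq 0 fun e ↦ ?_
  rw [← e.mk₀_id_comp, ← r.retract, ← Ext.mk₀_comp_mk₀, Ext.comp_assoc_of_second_deg_zero,
    @Subsingleton.elim _ h ((Ext.mk₀ r.r).comp e (zero_add i)) 0, Ext.comp_zero]

lemma ExtVanish.retract_right {X Y N : ModuleCat.{u} R} {i : ℕ} (h : ExtVanish N Y i)
    (r : Retract X Y) : ExtVanish N X i := by
  refine subsingleton_of_forall_eq 0 fun e ↦ ?_
  rw [← e.comp_mk₀_id, ← r.retract, ← Ext.mk₀_comp_mk₀, ← Ext.comp_assoc_of_second_deg_zero,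
    @Subsingleton.elim _ h (e.comp (Ext.mk₀ r.i) (add_zero i)) 0, Ext.zero_comp]

/-! #### Free covers and injective hulls -/

/-- The canonical free module mapping onto `M`. -/
abbrev freeCover (M : ModuleCat.{u} R) : ModuleCat.{u} R := ModuleCat.of R (M →₀ R)

/-- The canonical surjection from a free module. -/
def freeCoverMap (M : ModuleCat.{u} R) : freeCover M ⟶ M :=
  ModuleCat.ofHom (Finsupp.linearCombination R id)

lemma freeCoverMap_surjective (M : ModuleCat.{u} R) :
    Function.Surjective (freeCoverMap M).hom :=
  Finsupp.linearCombination_id_surjective R M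

instance projective_finsupp (B : Type u) : Projective (ModuleCat.of R (B →₀ R)) :=
  ModuleCat.projective_of_free (M := ModuleCat.of R (B →₀ R)) Finsupp.basisSingleOne

/-- The canonical first syzygy of `M`. -/
abbrev syz (M : ModuleCat.{u} R) : ModuleCat.{u} R :=
  ModuleCat.of R (LinearMap.ker (freeCoverMap M).hom)

lemma ses_syz (M : ModuleCat.{u} R) :
    SES (ModuleCat.ofHom (LinearMap.ker (freeCoverMap M).hom).subtype) (freeCoverMap M) :=
  ses_ker _ (freeCoverMap_surjective M)

lemma injective_ι_injective (M : ModuleCat.{u} R) : Function.Injective (Injective.ι M).hom :=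
  (ModuleCat.mono_iff_injective _).1 inferInstance

/-- The canonical first cosyzygy of `M`. -/
abbrev cosyz (M : ModuleCat.{u} R) : ModuleCat.{u} R :=
  ModuleCat.of R (↑(Injective.under M) ⧸ LinearMap.range (Injective.ι M).hom)

lemma ses_cosyz (M : ModuleCat.{u} R) :
    SES (Injective.ι M) (ModuleCat.ofHom (LinearMap.range (Injective.ι M).hom).mkQ) :=
  ses_coker _ (injective_ι_injective M)

/-! #### Injective dimension -/

lemma idLE_iff {X : ModuleCat.{u} R} {n : ℕ} :
    HasInjectiveDimensionLE X n ↔ ∀ Z : ModuleCat.{u} R, ExtVanish Z X (n + 1) :=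
  ⟨fun _ Z ↦ HasInjectiveDimensionLT.subsingleton X (n + 1) (n + 1) le_rfl Z,
    fun h ↦ hasInjectiveDimensionLT_of_enoughProjectives X (n + 1) h⟩

lemma idLE_vanish {X : ModuleCat.{u} R} {n : ℕ} (h : HasInjectiveDimensionLE X n)
    (Z : ModuleCat.{u} R) {i : ℕ} (hi : n < i) : ExtVanish Z X i :=
  HasInjectiveDimensionLT.subsingleton X (n + 1) i hi Z

lemma idLE_zero_iff {X : ModuleCat.{u} R} : HasInjectiveDimensionLE X 0 ↔ Injective X :=
  injective_iff_hasInjectiveDimensionLT_one.symm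

lemma pdLE_vanish {X : ModuleCat.{u} R} {n : ℕ} (h : HasProjectiveDimensionLE X n)
    (Z : ModuleCat.{u} R) {i : ℕ} (hi : n < i) : ExtVanish X Z i :=
  HasProjectiveDimensionLT.subsingleton X (n + 1) i hi Z

lemma pdLE_zero_iff {X : ModuleCat.{u} R} : HasProjectiveDimensionLE X 0 ↔ Projective X :=
  (projective_iff_hasProjectiveDimensionLE_zero X).symm

lemma SES.idLE₃ {X Y Z : ModuleCat.{u} R} {f : X ⟶ Y} {g : Y ⟶ Z} (h : SES f g) {n : ℕ}
    (h₁ : HasInjectiveDimensionLE X n) (h₂ : HasInjectiveDimensionLE Y n) :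
    HasInjectiveDimensionLE Z n :=
  h.shortExact.hasInjectiveDimensionLT_X₃ (n + 1) h₂
    (hasInjectiveDimensionLT_of_ge X (n + 1) (n + 1 + 1) (Nat.le_succ _))

lemma SES.idLE₃' {X Y Z : ModuleCat.{u} R} {f : X ⟶ Y} {g : Y ⟶ Z} (h : SES f g) {n : ℕ}
    (h₁ : HasInjectiveDimensionLE X (n + 1)) (h₂ : HasInjectiveDimensionLE Y n) :
    HasInjectiveDimensionLE Z n :=
  h.shortExact.hasInjectiveDimensionLT_X₃ (n + 1) h₂ h₁

lemma SES.idLE₂ {X Y Z : ModuleCat.{u} R} {f : X ⟶ Y} {g : Y ⟶ Z} (h : SES f g) {n : ℕ}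
    (h₁ : HasInjectiveDimensionLE X n) (h₂ : HasInjectiveDimensionLE Z n) :
    HasInjectiveDimensionLE Y n :=
  h.shortExact.hasInjectiveDimensionLT_X₂ (n + 1) h₁ h₂

lemma SES.idLE₁ {X Y Z : ModuleCat.{u} R} {f : X ⟶ Y} {g : Y ⟶ Z} (h : SES f g) {n : ℕ}
    (h₃ : HasInjectiveDimensionLE Z n) (h₂ : HasInjectiveDimensionLE Y (n + 1)) :
    HasInjectiveDimensionLE X (n + 1) :=
  h.shortExact.hasInjectiveDimensionLT_X₁ (n + 1) h₃ h₂

lemma idLE_mono {X : ModuleCat.{u} R} {m n : ℕ} (hmn : m ≤ n) (h : HasInjectiveDimensionLE X m) :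
    HasInjectiveDimensionLE X n :=
  hasInjectiveDimensionLT_of_ge X (m + 1) (n + 1) (by lia)

lemma pdLE_mono {X : ModuleCat.{u} R} {m n : ℕ} (hmn : m ≤ n) (h : HasProjectiveDimensionLE X m) :
    HasProjectiveDimensionLE X n :=
  hasProjectiveDimensionLT_of_ge X (m + 1) (n + 1) (by lia)

lemma idLE_of_injective {X : ModuleCat.{u} R} (h : Injective X) (n : ℕ) :
    HasInjectiveDimensionLE X n :=
  idLE_mono (Nat.zero_le n) (idLE_zero_iff.2 h)

lemma idLE_retract {X Y : ModuleCat.{u} R} (r : Retract X Y) {n : ℕ}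
    (h : HasInjectiveDimensionLE Y n) : HasInjectiveDimensionLE X n :=
  r.hasInjectiveDimensionLT (n + 1)

/-! #### Products -/

/-- The product of a family of modules. -/
abbrev piMod {ι : Type u} (X : ι → ModuleCat.{u} R) : ModuleCat.{u} R := ModuleCat.of R (∀ i, X i)

/-- The product of a family of maps. -/
abbrev piMap {ι : Type u} {X Y : ι → ModuleCat.{u} R} (f : ∀ i, X i ⟶ Y i) :
    piMod X ⟶ piMod Y :=
  ModuleCat.ofHom (LinearMap.pi fun i ↦ (f i).hom ∘ₗ LinearMap.proj i)

lemma ses_pi {ι : Type u} {X Y Z : ι → ModuleCat.{u} R} {f : ∀ i, X i ⟶ Y i} {g : ∀ i, Y i ⟶ Z i}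
    (h : ∀ i, SES (f i) (g i)) : SES (piMap f) (piMap g) where
  inj x y hxy := funext fun i ↦ (h i).inj (congrFun hxy i)
  exact y := by
    constructor
    · intro hy
      choose x hx using fun i ↦ ((h i).exact (y i)).1 (congrFun hy i)
      exact ⟨x, funext hx⟩
    · rintro ⟨x, rfl⟩
      exact funext fun i ↦ (h i).exact.apply_apply_eq_zero (x i)
  surj z := by
    choose y hy using fun i ↦ (h i).surj (z i)
    exact ⟨y, funext hy⟩

open Classical in
/-- Each factor is a retract of the product. -/
def piRetract {ι : Type u} (X : ι → ModuleCat.{u} R) (i : ι) : Retract (X i) (piMod X) where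
  i := ModuleCat.ofHom (LinearMap.single R (fun i ↦ X i) i)
  r := ModuleCat.ofHom (LinearMap.proj (R := R) (φ := fun i ↦ X i) i)
  retract := by ext x; simp

open Classical in
lemma injective_pi {ι : Type u} (X : ι → ModuleCat.{u} R) (h : ∀ i, Injective (X i)) :
    Injective (piMod X) where
  factors {A B} g f hf := by
    choose φ hφ using fun i ↦
      (h i).factors (g ≫ ModuleCat.ofHom (LinearMap.proj (R := R) (φ := fun i ↦ X i) i)) f
    refine ⟨ModuleCat.ofHom (LinearMap.pi fun i ↦ (φ i).hom), ?_⟩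
    ext x i
    exact congr($(hφ i) x)

lemma idLE_pi {ι : Type u} (n : ℕ) (X : ι → ModuleCat.{u} R)
    (h : ∀ i, HasInjectiveDimensionLE (X i) n) : HasInjectiveDimensionLE (piMod X) n := by
  induction n generalizing X with
  | zero => exact idLE_zero_iff.2 (injective_pi X fun i ↦ idLE_zero_iff.1 (h i))
  | succ n ih =>
    have e := ses_pi fun i ↦ ses_cosyz (X i)
    refine e.idLE₁ (ih _ fun i ↦ ?_)
      (idLE_of_injective (injective_pi _ fun i ↦ inferInstance) _)
    exact (ses_cosyz (X i)).idLE₃' (h i) (idLE_of_injective inferInstance _)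

lemma Projective.of_retract {X Y : ModuleCat.{u} R} (r : Retract X Y) (h : Projective Y) :
    Projective X where
  factors f e he := by
    obtain ⟨φ, hφ⟩ := h.factors (r.r ≫ f) e
    exact ⟨r.i ≫ φ, by rw [Category.assoc, hφ, r.retract_assoc]⟩

lemma Injective.of_retract {X Y : ModuleCat.{u} R} (r : Retract X Y) (h : Injective Y) :
    Injective X where
  factors g f hf := by
    obtain ⟨φ, hφ⟩ := h.factors (g ≫ r.i) f
    exact ⟨φ ≫ r.r, by rw [← Category.assoc, hφ, Category.assoc, r.retract, Category.comp_id]⟩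

end ExtTools

/-! ### Purity in terms of systems of linear equations -/

section Purity

variable {R : Type u} [Ring R]

/-- A map `f : A → B` is pure if every finite system of linear equations with constants in `A`
which is solvable in `B` is solvable in `A`. The unknowns are indexed by `κ`, the equations by the
finite type `ι`, and an assignment of the unknowns is a linear map out of `κ →₀ R`. -/
def EqPure {A B : ModuleCat.{u} R} (f : A ⟶ B) : Prop :=
  ∀ (κ ι : Type u) [Finite ι] (ρ : ι → κ →₀ R) (a : ι → A) (t : (κ →₀ R) →ₗ[R] B),
    (∀ i, t (ρ i) = f.hom (a i)) → ∃ t' : (κ →₀ R) →ₗ[R] A, ∀ i, t' (ρ i) = a i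

lemma EqPure.pi {ι : Type u} {A B : ι → ModuleCat.{u} R} {f : ∀ i, A i ⟶ B i}
    (h : ∀ i, EqPure (f i)) : EqPure (piMap f) := by
  intro κ σ _ ρ a t ht
  choose t' ht' using fun i ↦ h i κ σ ρ (fun s ↦ a s i) (LinearMap.proj i ∘ₗ t)
    fun s ↦ congrFun (ht s) i
  exact ⟨LinearMap.pi t', fun s ↦ funext fun i ↦ ht' i s⟩

end Purity

/-! ### Character modules over a ring with involution -/

section Characters

/-- The character module `Hom_ℤ(M, ℚ/ℤ)`. Over a ring with involution it is again a left module,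
with `(r • c) m = c (r⋆ • m)`. -/
def Ch (M : Type u) [AddCommGroup M] : Type u := M →+ AddCircle (1 : ℚ)

namespace Ch
variable (M : Type u) [AddCommGroup M]

instance : AddCommGroup (Ch M) := inferInstanceAs (AddCommGroup (M →+ AddCircle (1 : ℚ)))

instance : FunLike (Ch M) M (AddCircle (1 : ℚ)) :=
  inferInstanceAs (FunLike (M →+ AddCircle (1 : ℚ)) M _)

instance : AddMonoidHomClass (Ch M) M (AddCircle (1 : ℚ)) :=
  inferInstanceAs (AddMonoidHomClass (M →+ AddCircle (1 : ℚ)) M _)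

variable {M}

@[ext] lemma ext {c d : Ch M} (h : ∀ x, c x = d x) : c = d := DFunLike.ext _ _ h

@[simp] lemma add_apply (c d : Ch M) (x : M) : (c + d) x = c x + d x := rfl
@[simp] lemma zero_apply (x : M) : (0 : Ch M) x = 0 := rfl

lemma sum_apply {ι : Type*} (s : Finset ι) (c : ι → Ch M) (x : M) :
    (∑ i ∈ s, c i) x = ∑ i ∈ s, c i x :=
  map_sum ({ toFun := fun c : Ch M ↦ c x, map_zero' := rfl, map_add' := fun _ _ ↦ rfl } :
    Ch M →+ AddCircle (1 : ℚ)) c s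

variable {R : Type u} [Ring R] [StarRing R] [Module R M]

instance : SMul R (Ch M) :=
  ⟨fun r c ↦ AddMonoidHom.comp (c : M →+ AddCircle (1 : ℚ)) (DistribSMul.toAddMonoidHom M (star r))⟩

@[simp] lemma smul_apply (r : R) (c : Ch M) (x : M) : (r • c) x = c (star r • x) := rfl

instance : Module R (Ch M) where
  one_smul c := by ext; simp
  mul_smul r s c := by ext; simp [mul_smul]
  smul_zero r := by ext; simp
  smul_add r c d := by ext; simp
  add_smul r s c := by ext; simp [add_smul]
  zero_smul c := by ext; simp

end Ch

/-- Homomorphisms to `ℚ/ℤ` extend along injections of abelian groups. -/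
lemma exists_extend_char {A B : Type u} [AddCommGroup A] [AddCommGroup B] (f : A →+ B)
    (hf : Function.Injective f) (c : A →+ AddCircle (1 : ℚ)) :
    ∃ d : B →+ AddCircle (1 : ℚ), d.comp f = c :=
  (Module.Baer.of_divisible _).extension_property_addMonoidHom f hf c

/-- Characters separate an element from a subgroup not containing it. -/
lemma exists_char_separating {A : Type u} [AddCommGroup A] (G : AddSubgroup A) {a : A}
    (ha : a ∉ G) : ∃ c : A →+ AddCircle (1 : ℚ), (∀ g ∈ G, c g = 0) ∧ c a ≠ 0 := by
  obtain ⟨c, hc⟩ := CharacterModule.exists_character_apply_ne_zero_of_ne_zero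
    (a := (QuotientAddGroup.mk a : A ⧸ G)) (by simpa [QuotientAddGroup.eq_zero_iff] using ha)
  refine ⟨AddMonoidHom.comp (c : A ⧸ G →+ AddCircle (1 : ℚ)) (QuotientAddGroup.mk' G), ?_, hc⟩
  intro g hg
  have : (QuotientAddGroup.mk g : A ⧸ G) = 0 := (QuotientAddGroup.eq_zero_iff g).2 hg
  change c (QuotientAddGroup.mk g : A ⧸ G) = 0
  rw [this, map_zero]

variable {R : Type u} [Ring R] [StarRing R]

/-- The character module as an object of the category of modules. -/
abbrev ch (M : ModuleCat.{u} R) : ModuleCat.{u} R := ModuleCat.of R (Ch M)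

/-- The map induced on character modules. -/
def chMap {M N : ModuleCat.{u} R} (f : M ⟶ N) : ch N ⟶ ch M :=
  ModuleCat.ofHom
    { toFun c := AddMonoidHom.comp (c : N →+ AddCircle (1 : ℚ)) f.hom.toAddMonoidHom
      map_add' _ _ := rfl
      map_smul' r c := by
        ext x
        exact congrArg c (f.hom.map_smul (star r) x).symm }

/-- The exchange of arguments `Hom(M, N⁺) → Hom(N, M⁺)`. -/
def swap {M N : ModuleCat.{u} R} (φ : M ⟶ ch N) : N ⟶ ch M :=
  ModuleCat.ofHom
    { toFun n :=
        ({ toFun m := (φ.hom m : Ch N) n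
           map_zero' := by rw [map_zero]; rfl
           map_add' x y := by rw [map_add]; rfl } : M →+ AddCircle (1 : ℚ))
      map_add' x y := by
        ext m
        exact map_add (φ.hom m : Ch N) x y
      map_smul' r x := by
        ext m
        change (φ.hom m : Ch N) (r • x) = (φ.hom (star r • m) : Ch N) x
        rw [φ.hom.map_smul, Ch.smul_apply, star_star] }

@[simp] lemma swap_swap {M N : ModuleCat.{u} R} (φ : M ⟶ ch N) : swap (swap φ) = φ := rfl

lemma swap_comp {M M' N : ModuleCat.{u} R} (f : M' ⟶ M) (φ : M ⟶ ch N) :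
    swap (f ≫ φ) = swap φ ≫ chMap f := rfl

lemma swap_comp_chMap {M N N' : ModuleCat.{u} R} (g : N' ⟶ N) (φ : M ⟶ ch N) :
    swap (φ ≫ chMap g) = g ≫ swap φ := rfl

/-- The evaluation map `M → M⁺⁺`. -/
def ev (M : ModuleCat.{u} R) : M ⟶ ch (ch M) := swap (𝟙 (ch M))

lemma ev_chMap (M : ModuleCat.{u} R) : ev (ch M) ≫ chMap (ev M) = 𝟙 (ch M) := rfl

lemma ev_injective (M : ModuleCat.{u} R) : Function.Injective (ev M).hom := by
  rw [injective_iff_map_eq_zero]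
  intro m hm
  refine CharacterModule.eq_zero_of_character_apply fun c ↦ ?_
  exact congrArg (fun φ : Ch (Ch M) ↦ φ (c : M →+ AddCircle (1 : ℚ))) hm

lemma chMap_injective {M N : ModuleCat.{u} R} (f : M ⟶ N) (hf : Function.Surjective f.hom) :
    Function.Injective (chMap f).hom := by
  intro c d h
  ext x
  obtain ⟨y, rfl⟩ := hf x
  exact congrArg (fun φ : Ch M ↦ φ y) h

lemma chMap_surjective {M N : ModuleCat.{u} R} (f : M ⟶ N) (hf : Function.Injective f.hom) :
    Function.Surjective (chMap f).hom := by
  intro c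
  obtain ⟨d, hd⟩ := exists_extend_char f.hom.toAddMonoidHom hf c
  exact ⟨d, hd⟩

lemma chMap_exact {X Y Z : ModuleCat.{u} R} {f : X ⟶ Y} {g : Y ⟶ Z}
    (h : Function.Exact f.hom g.hom) : Function.Exact (chMap g).hom (chMap f).hom := by
  intro c
  constructor
  · intro hc
    have hc' : ∀ x, (c : Ch Y) (f.hom x) = 0 := fun x ↦ congrArg (fun φ : Ch X ↦ φ x) hc
    have hk : g.hom.toAddMonoidHom.ker ≤ (AddMonoidHomClass.toAddMonoidHom (c : Ch Y)).ker := by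
      intro y hy
      obtain ⟨x, rfl⟩ := (h y).1 hy
      exact hc' x
    let e := QuotientAddGroup.kerLift g.hom.toAddMonoidHom
    obtain ⟨d, hd⟩ := exists_extend_char e (QuotientAddGroup.kerLift_injective _)
      (QuotientAddGroup.lift _ (AddMonoidHomClass.toAddMonoidHom (c : Ch Y)) hk)
    refine ⟨d, ?_⟩
    ext y
    exact congrArg (fun φ ↦ φ (QuotientAddGroup.mk y)) hd
  · rintro ⟨d, rfl⟩
    ext x
    change (d : Ch Z) (g.hom (f.hom x)) = 0
    rw [h.apply_apply_eq_zero, map_zero]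

lemma SES.ch {X Y Z : ModuleCat.{u} R} {f : X ⟶ Y} {g : Y ⟶ Z} (h : SES f g) :
    SES (chMap g) (chMap f) :=
  ⟨chMap_injective g h.surj, chMap_exact h.exact, chMap_surjective f h.inj⟩

/-- Projective modules are flat. -/
lemma injective_ch_of_projective (P : ModuleCat.{u} R) [Projective P] : Injective (ch P) where
  factors {A B} g f hf := by
    have := (ModuleCat.epi_iff_surjective (chMap f)).2
      (chMap_surjective f ((ModuleCat.mono_iff_injective f).1 hf))
    obtain ⟨φ, hφ⟩ := Projective.factors (swap g) (chMap f)
    refine ⟨swap φ, ?_⟩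
    rw [← swap_comp_chMap, hφ, swap_swap]

/-- A retract of `M` has a character module which is a retract of `M⁺`. -/
def chRetract {M N : ModuleCat.{u} R} (r : Retract M N) : Retract (ch M) (ch N) where
  i := chMap r.r
  r := chMap r.i
  retract := by
    have := r.retract
    ext c x
    exact congrArg (c : Ch M) congr($this x)

/-- Symmetry of the vanishing of `Tor`, expressed through character modules. -/
lemma extVanish_ch_symm {M N : ModuleCat.{u} R} {i : ℕ} (h : ExtVanish M (ch N) (i + 1)) :
    ExtVanish N (ch M) (i + 1) := by
  induction i generalizing M N with
  | zero =>
    refine (ses_syz M).ch.coext_one ?_ ?_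
    · have := injective_ch_of_projective (freeCover M)
      exact extVanish_of_injective _ _ _
    · intro φ
      obtain ⟨ψ, hψ⟩ := (ses_syz M).extend h (swap φ)
      exact ⟨swap ψ, by rw [← swap_comp, hψ, swap_swap]⟩
  | succ i ih =>
    have := injective_ch_of_projective (freeCover M)
    refine (ses_syz M).ch.coext₁ (ih ?_) (extVanish_of_injective _ _ _)
    exact (ses_syz M).ext₁ (extVanish_of_projective _ _ _) h

/-! #### Purity and character modules -/

/-- A map whose dual is a split epimorphism is pure: otherwise a character would separate the constants
of an unsolvable system from the constants of the systems solvable in `A`. -/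
lemma EqPure.of_dual_split {A B : ModuleCat.{u} R} (f : A ⟶ B) (s : ch A ⟶ ch B)
    (hs : s ≫ chMap f = 𝟙 _) : EqPure f := by
  intro κ ι _ ρ a t ht
  classical
  have := Fintype.ofFinite ι
  -- the possible right-hand sides form a subgroup of `A ^ ι`
  let Φ : ((κ →₀ R) →ₗ[R] A) →+ (ι → A) :=
    { toFun t' i := t' (ρ i), map_zero' := rfl, map_add' _ _ := rfl }
  by_contra hcon
  have ha : a ∉ Φ.range := by
    rintro ⟨t', rfl⟩
    exact hcon ⟨t', fun _ ↦ rfl⟩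
  obtain ⟨c, hc, hca⟩ := exists_char_separating _ ha
  let χ : ι → Ch A := fun i ↦ c.comp (AddMonoidHom.single (fun _ ↦ (A : Type u)) i)
  have hχ (x : ι → A) : c x = ∑ i, χ i (x i) := by
    conv_lhs => rw [← Finset.univ_sum_single x, map_sum]
    rfl
  have hrel (b : κ) : ∑ i, star (ρ i b) • χ i = 0 := by
    ext x
    have := hc (Φ (Finsupp.lsum ℕ fun b' ↦ if b' = b then LinearMap.toSpanSingleton R A x else 0))
      ⟨_, rfl⟩
    rw [hχ] at this
    rw [Ch.sum_apply]
    refine Eq.trans (Finset.sum_congr rfl fun i _ ↦ ?_) this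
    have h2 : (Finsupp.lsum ℕ fun b' ↦ if b' = b then LinearMap.toSpanSingleton R A x else 0)
        (ρ i) = ρ i b • x := by
      rw [Finsupp.lsum_apply, Finsupp.sum, Finset.sum_eq_single b]
      · simp
      · intro b' _ hb'
        simp [hb']
      · intro hb
        simp [Finsupp.notMem_support_iff.1 hb]
    change (star (ρ i b) • χ i) x = χ i ((Finsupp.lsum ℕ fun b' ↦ _) (ρ i))
    rw [h2, Ch.smul_apply, star_star]
  apply hca
  rw [hχ]
  have hsχ (i : ι) (x : A) : (s.hom (χ i) : Ch B) (f.hom x) = χ i x :=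
    congrArg (fun φ : Ch A ↦ φ x) congr($hs (χ i))
  simp_rw [← hsχ, ← ht]
  have htρ (i : ι) : t (ρ i) = (ρ i).sum fun b r ↦ r • t (Finsupp.single b 1) := by
    conv_lhs => rw [← Finsupp.sum_single (ρ i), map_finsuppSum]
    refine Finsupp.sum_congr fun b _ ↦ ?_
    rw [← map_smul, Finsupp.smul_single_one]
  let S : Finset κ := Finset.univ.biUnion fun i ↦ (ρ i).support
  have hS (i : ι) : t (ρ i) = ∑ b ∈ S, ρ i b • t (Finsupp.single b 1) := by
    rw [htρ]
    refine Finsupp.sum_of_support_subset _ (Finset.subset_biUnion_of_mem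
      (fun i ↦ (ρ i).support) (Finset.mem_univ i)) _ fun b _ ↦ zero_smul _ _
  simp_rw [hS, map_sum]
  rw [Finset.sum_comm]
  refine Finset.sum_eq_zero fun b _ ↦ ?_
  have h0 : ∑ i, star (ρ i b) • s.hom (χ i) = 0 := by
    rw [← map_zero s.hom, ← hrel b, map_sum]
    simp_rw [map_smul]
  have := congrArg (fun φ : Ch B ↦ φ (t (Finsupp.single b 1))) h0
  simp only [Ch.sum_apply] at this
  simpa using this

lemma eqPure_ev (M : ModuleCat.{u} R) : EqPure (ev M) :=
  .of_dual_split (ev M) (ev (ch M)) (ev_chMap M)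

/-- If maps to `A⁺⁺` extend from `A` to `B` along `f`, then `f` is pure. -/
lemma EqPure.of_extend {A B : ModuleCat.{u} R} (f : A ⟶ B) (ψ : B ⟶ ch (ch A))
    (hψ : f ≫ ψ = ev A) : EqPure f := by
  refine .of_dual_split f (swap ψ) ?_
  rw [← swap_comp, hψ]
  rfl

end Characters

section ExtendChar

variable {R : Type u} [Ring R] [StarRing R]

/-- The linear relations `∑ (ρ y)⋆ • y = 0` between elements of `Y`. -/
abbrev LinRel (Y : Type u) [AddCommGroup Y] [Module R Y] : Type u :=
  {ρ : Y →₀ R // ρ.sum (fun y r ↦ star r • y) = 0}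

/-- The map whose cokernel is a model of the tensor product of `Y` (made a right module by means
of the involution) and `M`: it sends the generator of `M` at a relation `ρ` to `∑ y ⊗ ρ y • m`. -/
def relMap (Y M : Type u) [AddCommGroup Y] [Module R Y] [AddCommGroup M] [Module R M] :
    (LinRel (R := R) Y →₀ M) →+ (Y →₀ M) :=
  Finsupp.liftAddHom fun ρ ↦
    { toFun m := ρ.1.mapRange (· • m) (zero_smul R m)
      map_zero' := by ext; simp
      map_add' x y := by ext; simp [smul_add] }

variable {Y M : Type u} [AddCommGroup Y] [Module R Y] [AddCommGroup M] [Module R M]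

lemma relMap_single (ρ : LinRel (R := R) Y) (m : M) :
    relMap Y M (Finsupp.single ρ m) = ρ.1.mapRange (· • m) (zero_smul R m) := by
  exact Finsupp.sum_single_index (by ext; simp)

lemma relMap_apply (c : LinRel (R := R) Y →₀ M) (y : Y) :
    relMap Y M c y = c.sum fun ρ m ↦ ρ.1 y • m := by
  simp only [relMap, Finsupp.liftAddHom_apply, Finsupp.sum, Finsupp.coe_finsetSum,
    Finset.sum_apply]
  rfl

/-- The additive map `Y ⊗ M → ℚ/ℤ` on generators, for a map `M → Y⁺`. -/
def pairing {M : ModuleCat.{u} R} {Y : ModuleCat.{u} R} (φ : M ⟶ ch Y) :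
    (Y →₀ M) →+ AddCircle (1 : ℚ) :=
  Finsupp.liftAddHom fun y ↦
    ({ toFun m := (φ.hom m : Ch Y) y
       map_zero' := by rw [map_zero]; rfl
       map_add' _ _ := by rw [map_add]; rfl } : M →+ AddCircle (1 : ℚ))

lemma pairing_single {M : ModuleCat.{u} R} {Y : ModuleCat.{u} R} (φ : M ⟶ ch Y) (y : Y) (m : M) :
    pairing φ (Finsupp.single y m) = (φ.hom m : Ch Y) y := by
  simp [pairing]

lemma pairing_relMap {M : ModuleCat.{u} R} {Y : ModuleCat.{u} R} (φ : M ⟶ ch Y)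
    (c : LinRel (R := R) Y →₀ M) : pairing φ (relMap Y M c) = 0 := by
  induction c using Finsupp.induction_linear with
  | zero => simp
  | add c d hc hd => rw [map_add, map_add, hc, hd, add_zero]
  | single ρ m =>
    rw [relMap_single]
    have h : ρ.1.mapRange (· • m) (zero_smul R m)
        = ρ.1.sum fun y r ↦ Finsupp.single y (r • m) := by
      ext y
      classical
      rw [Finsupp.sum, Finsupp.finsetSum_apply, Finsupp.mapRange_apply]
      by_cases hy : y ∈ ρ.1.support
      · rw [Finset.sum_eq_single y]
        · simp
        · intro z _ hz
          simp [hz]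
        · exact fun h ↦ absurd hy h
      · rw [Finset.sum_eq_zero, Finsupp.notMem_support_iff.1 hy, zero_smul]
        intro z hz
        rw [Finsupp.single_apply, if_neg]
        rintro rfl
        exact hy hz
    rw [h, Finsupp.sum, map_sum]
    simp only [pairing_single, map_smul]
    simp only [Ch.smul_apply]
    rw [← map_sum]
    exact (congrArg (φ.hom m : Ch Y) ρ.2).trans (map_zero _)

/-- A pure map stays injective after tensoring, and so maps to character modules extend along
it. -/
lemma EqPure.extend_ch {A B : ModuleCat.{u} R} {f : A ⟶ B} (h : EqPure f) {Y : ModuleCat.{u} R}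
    (φ : A ⟶ ch Y) : ∃ ψ : B ⟶ ch Y, f ≫ ψ = φ := by
  classical
  let F : (Y →₀ A) →+ (Y →₀ B) := Finsupp.mapRange.addMonoidHom f.hom.toAddMonoidHom
  have hF (w : Y →₀ A) (y : Y) : F w y = f.hom (w y) := rfl
  have key (w : Y →₀ A) (hw : F w ∈ (relMap (R := R) Y B).range) : w ∈ (relMap (R := R) Y A).range := by
    obtain ⟨c, hc⟩ := hw
    let S : Finset Y := w.support ∪ c.support.biUnion fun ρ ↦ ρ.1.support
    let row (y : Y) : c.support →₀ R := Finsupp.equivFunOnFinite.symm fun ρ ↦ ρ.1.1 y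
    have hrow {N : Type u} [AddCommGroup N] [Module R N] (t : (c.support →₀ R) →ₗ[R] N) (y : Y) :
        t (row y) = ∑ ρ : c.support, ρ.1.1 y • t (Finsupp.single ρ 1) := by
      conv_lhs => rw [← Finsupp.univ_sum_single (row y), map_sum]
      refine Finset.sum_congr rfl fun ρ _ ↦ ?_
      rw [← map_smul, Finsupp.smul_single_one]
      rfl
    obtain ⟨t', ht'⟩ := h c.support S (fun y ↦ row y) (fun y ↦ w y)
      (Finsupp.linearCombination R fun ρ : c.support ↦ (c ρ : B)) (by
        intro y
        rw [hrow (N := B), ← hF, ← hc, relMap_apply, Finsupp.sum]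
        simpa using Finset.sum_coe_sort c.support fun ρ ↦ ρ.1 y • c ρ)
    let c' : LinRel (R := R) Y →₀ A :=
      ∑ ρ : c.support, Finsupp.single ρ.1 (t' (Finsupp.single ρ 1))
    refine ⟨c', ?_⟩
    ext y
    have h1 : relMap Y A c' y = ∑ ρ : c.support, ρ.1.1 y • t' (Finsupp.single ρ 1) := by
      simp only [c', map_sum, relMap_single, Finsupp.finsetSum_apply, Finsupp.mapRange_apply]
    by_cases hy : y ∈ S
    · rw [h1, ← hrow (N := A)]
      exact ht' ⟨y, hy⟩
    · simp only [S, Finset.mem_union, Finset.mem_biUnion, not_or, not_exists, not_and] at hy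
      rw [h1, Finsupp.notMem_support_iff.1 hy.1]
      refine Finset.sum_eq_zero fun ρ _ ↦ ?_
      rw [Finsupp.notMem_support_iff.1 (hy.2 ρ.1 ρ.2), zero_smul]
  let q : (Y →₀ A) ⧸ (relMap (R := R) Y A).range →+ (Y →₀ B) ⧸ (relMap (R := R) Y B).range :=
    QuotientAddGroup.map _ _ F (by
      rintro _ ⟨c, rfl⟩
      induction c using Finsupp.induction_linear with
      | zero => simp
      | add c d hc hd =>
        rw [map_add]
        exact add_mem hc hd
      | single ρ m =>
        refine ⟨Finsupp.single ρ (f.hom m), ?_⟩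
        ext y
        rw [relMap_single, hF, relMap_single]
        simp)
  have hq : Function.Injective q := by
    rw [injective_iff_map_eq_zero]
    intro x hx
    obtain ⟨w, rfl⟩ := QuotientAddGroup.mk_surjective x
    exact (QuotientAddGroup.eq_zero_iff w).2 (key w ((QuotientAddGroup.eq_zero_iff (F w)).1 hx))
  obtain ⟨d, hd⟩ := exists_extend_char q hq (QuotientAddGroup.lift _ (pairing φ) (by
    rintro _ ⟨c, rfl⟩
    exact pairing_relMap φ c))
  let ψ : (Y →₀ B) →+ AddCircle (1 : ℚ) := d.comp (QuotientAddGroup.mk' _)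
  have hψ (ρ : LinRel (R := R) Y) (b : B) : ψ (ρ.1.mapRange (· • b) (zero_smul R b)) = 0 := by
    have : (QuotientAddGroup.mk (ρ.1.mapRange (· • b) (zero_smul R b)) :
        (Y →₀ B) ⧸ (relMap (R := R) Y B).range) = 0 :=
      (QuotientAddGroup.eq_zero_iff _).2 ⟨_, relMap_single ρ b⟩
    exact (congrArg d this).trans (map_zero d)
  have hsum (a b : Y →₀ R) : (a - b).sum (fun y r ↦ star r • y)
      = a.sum (fun y r ↦ star r • y) - b.sum (fun y r ↦ star r • y) :=
    Finsupp.sum_sub_index fun y r s ↦ by rw [star_sub, sub_smul]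
  have h1 (y : Y) (r : R) (b : B) :
      ψ (Finsupp.single y (r • b)) = ψ (Finsupp.single (star r • y) b) := by
    have := hψ ⟨Finsupp.single y r - Finsupp.single (star r • y) 1, by
      rw [hsum, Finsupp.sum_single_index (by simp), Finsupp.sum_single_index (by simp)]; simp⟩ b
    rw [← sub_eq_zero, ← map_sub, ← this]
    congr 1
    ext z
    simp only [Finsupp.sub_apply, Finsupp.mapRange_apply, sub_smul, Finsupp.single_apply]
    split_ifs <;> simp
  have h2 (y z : Y) (b : B) :
      ψ (Finsupp.single (y + z) b) = ψ (Finsupp.single y b) + ψ (Finsupp.single z b) := by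
    have := hψ ⟨Finsupp.single (y + z) 1 - Finsupp.single y 1 - Finsupp.single z 1, by
      rw [hsum, hsum, Finsupp.sum_single_index (by simp), Finsupp.sum_single_index (by simp),
        Finsupp.sum_single_index (by simp)]; simp⟩ b
    rw [← sub_eq_zero, ← sub_sub, ← map_sub, ← map_sub, ← this]
    congr 1
    ext w
    simp only [Finsupp.sub_apply, Finsupp.mapRange_apply, sub_smul, Finsupp.single_apply]
    split_ifs <;> simp
  refine ⟨ModuleCat.ofHom
    { toFun b := (AddMonoidHom.mk' (fun y ↦ ψ (Finsupp.single y b)) fun y z ↦ h2 y z b : Ch Y)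
      map_add' b b' := by
        refine Ch.ext (M := Y) fun y ↦ ?_
        change ψ (Finsupp.single y (b + b')) = ψ _ + ψ _
        rw [Finsupp.single_add, map_add]
      map_smul' r b := by
        refine Ch.ext (M := Y) fun y ↦ ?_
        exact h1 y r b }, ?_⟩
  ext a y
  change ψ (Finsupp.single y (f.hom a)) = _
  have h3 : F (Finsupp.single y a) = Finsupp.single y (f.hom a) :=
    Finsupp.mapRange_single (hf := map_zero f.hom)
  rw [← h3]
  have := congr($hd (QuotientAddGroup.mk (Finsupp.single y a)))
  exact this.trans (pairing_single φ y a)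

/-- The dual of a pure map is a split epimorphism. -/
lemma EqPure.dual_split {A B : ModuleCat.{u} R} {f : A ⟶ B} (h : EqPure f) :
    ∃ s : ch A ⟶ ch B, s ≫ chMap f = 𝟙 _ := by
  obtain ⟨ψ, hψ⟩ := h.extend_ch (ev A)
  exact ⟨swap ψ, by rw [← swap_comp, hψ]; rfl⟩

end ExtendChar

/-! ### Modules of finite flat dimension over a ring with finite `sfli` -/

section FlatDim

variable {R : Type u} [Ring R] [StarRing R]

/-- `X` has flat dimension at most `n`: its character module has injective dimension at most `n`. -/
def FdLE (X : ModuleCat.{u} R) (n : ℕ) : Prop := HasInjectiveDimensionLE (ch X) n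

variable (R) in
/-- Injective modules have flat dimension at most `n`. -/
def SfliLE (n : ℕ) : Prop := ∀ I : ModuleCat.{u} R, Injective I → FdLE I n

lemma FdLE.of_projective (P : ModuleCat.{u} R) [Projective P] (n : ℕ) : FdLE P n :=
  idLE_of_injective (injective_ch_of_projective P) n

lemma SES.fdLE₁ {X Y Z : ModuleCat.{u} R} {f : X ⟶ Y} {g : Y ⟶ Z} (h : SES f g) {n : ℕ}
    (h₂ : FdLE Y n) (h₃ : FdLE Z n) : FdLE X n :=
  h.ch.idLE₃ h₃ h₂

lemma SES.fdLE₂ {X Y Z : ModuleCat.{u} R} {f : X ⟶ Y} {g : Y ⟶ Z} (h : SES f g) {n : ℕ}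
    (h₁ : FdLE X n) (h₃ : FdLE Z n) : FdLE Y n :=
  h.ch.idLE₂ h₃ h₁

lemma FdLE.retract {X Y : ModuleCat.{u} R} (r : Retract X Y) {n : ℕ} (h : FdLE Y n) : FdLE X n :=
  idLE_retract (chRetract r) h

variable {n : ℕ}

lemma SfliLE.fdLE_of_idLE (hR : SfliLE R n) {X : ModuleCat.{u} R} {k : ℕ} (h : HasInjectiveDimensionLE X k) :
    FdLE X n := by
  induction k generalizing X with
  | zero => exact hR X (idLE_zero_iff.1 h)
  | succ k ih =>
    exact (ses_cosyz X).fdLE₁ (hR _ inferInstance)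
      (ih ((ses_cosyz X).idLE₃' h (idLE_of_injective inferInstance _)))

lemma SfliLE.fdLE_ch (hR : SfliLE R n) {X : ModuleCat.{u} R} {k : ℕ} (h : FdLE X k) : FdLE (ch X) n :=
  hR.fdLE_of_idLE h

lemma SfliLE.fdLE_chch (hR : SfliLE R n) {X : ModuleCat.{u} R} {k : ℕ} (h : FdLE X k) : FdLE (ch (ch X)) n :=
  hR.fdLE_ch (hR.fdLE_ch h)

/-- The modules of finite flat dimension are closed under products: a product of such modules is
pure in the product of their double duals, which is a product of modules of bounded injective
dimension. -/
lemma SfliLE.fdLE_pi (hR : SfliLE R n) {ι : Type u} {X : ι → ModuleCat.{u} R} (h : ∀ i, FdLE (X i) n) :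
    FdLE (piMod X) n := by
  obtain ⟨s, hs⟩ := (EqPure.pi fun i ↦ eqPure_ev (X i)).dual_split
  have : FdLE (piMod fun i ↦ ch (ch (X i))) n :=
    hR.fdLE_of_idLE (idLE_pi n _ fun i ↦ hR.fdLE_ch (h i))
  exact idLE_retract ⟨s, _, hs⟩ this

/-- The cokernel of `X → X⁺⁺`. -/
abbrev cokerEv (X : ModuleCat.{u} R) : ModuleCat.{u} R :=
  ModuleCat.of R (Ch (Ch X) ⧸ LinearMap.range (ev X).hom)

lemma ses_cokerEv (X : ModuleCat.{u} R) :
    SES (ev X) (ModuleCat.ofHom (LinearMap.range (ev X).hom).mkQ : ch (ch X) ⟶ cokerEv X) :=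
  ses_coker _ (ev_injective X)

/-- The dual of `0 → X → X⁺⁺ → X⁺⁺ / X → 0` splits, whence the dual of `X⁺⁺ / X` is a summand
of `X⁺⁺⁺`. -/
lemma SfliLE.fdLE_cokerEv (hR : SfliLE R n) {X : ModuleCat.{u} R} (h : FdLE X n) : FdLE (cokerEv X) n := by
  have e := (ses_cokerEv X).ch
  obtain ⟨r, hr⟩ := e.lift (𝟙 _ - chMap (ev X) ≫ ev (ch X)) (by
    rw [Preadditive.sub_comp, Category.assoc, ev_chMap, Category.id_comp, Category.comp_id,
      sub_self])
  refine idLE_retract (Y := ch (ch (ch X)))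
    ⟨chMap (ModuleCat.ofHom (LinearMap.range (ev X).hom).mkQ), r, ?_⟩ (hR.fdLE_chch h)
  · have := (ModuleCat.mono_iff_injective _).2 e.inj
    rw [← cancel_mono (chMap (ModuleCat.ofHom (LinearMap.range (ev X).hom).mkQ)), Category.assoc,
      hr, Preadditive.comp_sub, ← Category.assoc, e.comp_zero]
    simp

/-- `U` is orthogonal to the character modules of the modules of flat dimension at most `n`; this
says `Tor₁(Y, U) = 0` for all such `Y`, made right modules by means of the involution. -/
def TorOrth (n : ℕ) (U : ModuleCat.{u} R) : Prop :=
  ∀ Y : ModuleCat.{u} R, FdLE Y n → ExtVanish U (ch Y) 1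

lemma TorOrth.ext {U : ModuleCat.{u} R} (h : TorOrth n U) {Y : ModuleCat.{u} R} (hY : FdLE Y n)
    (i : ℕ) : ExtVanish U (ch Y) (i + 1) := by
  induction i generalizing Y with
  | zero => exact h Y hY
  | succ i ih =>
    have := injective_ch_of_projective (freeCover Y)
    refine (ses_syz Y).ch.coext₁ (ih ?_) (extVanish_of_injective _ _ _)
    exact (ses_syz Y).fdLE₁ (.of_projective _ _) hY

/-- An extension of a `TorOrth` module by a module of finite flat dimension is pure. -/
lemma SfliLE.eqPure (hR : SfliLE R n) {X E U : ModuleCat.{u} R} {f : X ⟶ E} {g : E ⟶ U} (h : SES f g)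
    (hX : FdLE X n) (hU : TorOrth n U) : EqPure f := by
  obtain ⟨ψ, hψ⟩ := h.extend (hU (ch X) (hR.fdLE_ch hX)) (ev X)
  exact .of_extend f ψ hψ

end FlatDim

/-! ### Solvability of countable systems of linear equations -/

section Solvable

variable {R : Type u} [Ring R]

/-- Every compatible system of linear equations `t (ρ j) = h j` with values in `X` has a solution.
For `M` free this says `Ext¹(M / span ρ, X) = 0`. -/
def Solvable {M : Type u} [AddCommGroup M] [Module R M] {ι : Type*} (ρ : ι → M)
    (X : ModuleCat.{u} R) : Prop :=
  ∀ h : ι → X, (∀ c : ι →₀ R, Finsupp.linearCombination R ρ c = 0 →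
    Finsupp.linearCombination R h c = 0) → ∃ t : M →ₗ[R] X, ∀ j, t (ρ j) = h j

lemma solvable_of_ext {ι : Type*} {K F U : ModuleCat.{u} R} {i : K ⟶ F} {p : F ⟶ U} (e : SES i p)
    (ρ : ι → F) (hρ : Submodule.span R (Set.range ρ) = LinearMap.range i.hom)
    {X : ModuleCat.{u} R} (hX : ExtVanish U X 1) : Solvable ρ X := by
  intro h hh
  have hk : LinearMap.ker (Finsupp.linearCombination R ρ)
      ≤ LinearMap.ker (Finsupp.linearCombination R h) := fun c hc ↦ hh c hc
  have hr : LinearMap.range (Finsupp.linearCombination R ρ) = LinearMap.range i.hom := by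
    rw [Finsupp.range_linearCombination, hρ]
  let e₁ := (Finsupp.linearCombination R ρ).quotKerEquivRange
  let e₂ := LinearEquiv.ofInjective i.hom e.inj
  obtain ⟨t, ht⟩ := e.extend hX (ModuleCat.ofHom
    ((LinearMap.ker (Finsupp.linearCombination R ρ)).liftQ _ hk ∘ₗ e₁.symm.toLinearMap ∘ₗ
      (LinearEquiv.ofEq _ _ hr.symm).toLinearMap ∘ₗ e₂.toLinearMap))
  refine ⟨t.hom, fun j ↦ ?_⟩
  have hj : ρ j ∈ LinearMap.range i.hom := hρ ▸ Submodule.subset_span ⟨j, rfl⟩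
  obtain ⟨k, hk'⟩ := hj
  have h1 : e₁.symm (LinearEquiv.ofEq _ _ hr.symm (e₂ k))
      = Submodule.Quotient.mk (Finsupp.single j 1) := by
    rw [LinearEquiv.symm_apply_eq]
    ext
    simp [e₁, e₂, hk']
  have h2 := congr($ht k)
  rw [← hk']
  refine h2.trans ?_
  change (LinearMap.ker (Finsupp.linearCombination R ρ)).liftQ _ hk
    (e₁.symm (LinearEquiv.ofEq _ _ hr.symm (e₂ k))) = _
  rw [h1, Submodule.liftQ_apply]
  simp

lemma ext_of_solvable {ι : Type*} {K F U : ModuleCat.{u} R} {i : K ⟶ F} {p : F ⟶ U} (e : SES i p)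
    [Projective F] (ρ : ι → F) (hρ : Submodule.span R (Set.range ρ) = LinearMap.range i.hom)
    {X : ModuleCat.{u} R} (hX : Solvable ρ X) : ExtVanish U X 1 := by
  refine e.ext_one (extVanish_of_projective _ _ _) fun φ ↦ ?_
  have hj (j : ι) : ∃ k, i.hom k = ρ j := by
    change ρ j ∈ LinearMap.range i.hom
    exact hρ ▸ Submodule.subset_span ⟨j, rfl⟩
  choose k hk using hj
  obtain ⟨t, ht⟩ := hX (fun j ↦ φ.hom (k j)) fun c hc ↦ by
    have : Finsupp.linearCombination R k c = 0 := by
      apply e.inj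
      rw [map_zero, Finsupp.apply_linearCombination]
      exact (congrArg (fun f ↦ Finsupp.linearCombination R f c) (funext hk)).trans hc
    rw [← Function.comp_def φ.hom k, ← Finsupp.apply_linearCombination, this, map_zero]
  refine ⟨ModuleCat.ofHom t, ?_⟩
  ext x
  have hx : i.hom x ∈ Submodule.span R (Set.range ρ) := hρ ▸ ⟨x, rfl⟩
  obtain ⟨c, hc⟩ := (Finsupp.mem_span_range_iff_exists_finsupp).1 hx
  have hxc : x = Finsupp.linearCombination R k c := by
    apply e.inj
    rw [Finsupp.apply_linearCombination, ← hc]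
    exact congrArg (fun f ↦ Finsupp.linearCombination R f c) (funext fun j ↦ (hk j).symm)
  subst hxc
  change t (i.hom _) = φ.hom _
  rw [Finsupp.apply_linearCombination, Finsupp.apply_linearCombination,
    Finsupp.apply_linearCombination]
  congr 2
  funext j
  simp [hk, ht]

variable [StarRing R]

/-- A countable system over a free module which is solvable in the character modules of all modules
of finite flat dimension is solvable in `Q⁺⁺ / Q` whenever `Q` has finite flat dimension. By purity
finitely many of the equations can be solved at a time; the differences of consecutive partial
solutions lift to `Q⁺⁺`, where solvability is known, and their sum corrects the partial solutions
to a solution. -/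
lemma SfliLE.solvable_cokerEv {n : ℕ} (hR : SfliLE R n) {B : Type u} (ρ : ℕ → B →₀ R)
    (hρ : ∀ Y : ModuleCat.{u} R, FdLE Y n → Solvable ρ (ch Y)) {Q : ModuleCat.{u} R}
    (hQ : FdLE Q n) : Solvable ρ (cokerEv Q) := by
  intro h hh
  obtain ⟨t, ht⟩ := hρ _ (hR.fdLE_ch (hR.fdLE_cokerEv hQ)) (fun j ↦ (ev (cokerEv Q)).hom (h j))
    fun c hc ↦ by
      have := congrArg (ev (cokerEv Q)).hom (hh c hc)
      rwa [Finsupp.apply_linearCombination, map_zero] at this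
  -- the full system is solvable in `(Q⁺⁺ / Q)⁺⁺`, which contains `Q⁺⁺ / Q` as a pure submodule
  have hs (k : ℕ) : ∃ s : (B →₀ R) →ₗ[R] cokerEv Q, ∀ j < k, s (ρ j) = h j := by
    obtain ⟨s, hs⟩ := eqPure_ev (cokerEv Q) B (ULift.{u} (Fin k)) (fun j ↦ ρ j.down)
      (fun j ↦ h j.down) t fun j ↦ ht _
    exact ⟨s, fun j hj ↦ hs ⟨j, hj⟩⟩
  choose s hs using hs
  let π : Ch (Ch Q) →ₗ[R] cokerEv Q := (LinearMap.range (ev Q).hom).mkQ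
  -- a lift of a difference of partial solutions, corrected by a map to `Q`
  have hδ (k : ℕ) : ∃ δ : (B →₀ R) →ₗ[R] Ch (Ch Q),
      π ∘ₗ δ = s (k + 1) - s k ∧ ∀ j < k, δ (ρ j) = 0 := by
    obtain ⟨v, hv⟩ := Module.projective_lifting_property π (s (k + 1) - s k)
      (Submodule.mkQ_surjective _)
    have hq (j : ULift.{u} (Fin k)) : ∃ q : Q, (ev Q).hom q = v (ρ j.down) := by
      change v (ρ j.down) ∈ LinearMap.range (ev Q).hom
      rw [← Submodule.ker_mkQ (LinearMap.range (ev Q).hom)]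
      have := LinearMap.congr_fun hv (ρ j.down)
      rw [LinearMap.sub_apply, hs _ _ (by lia), hs _ _ j.down.2, sub_self] at this
      exact this
    choose q hq using hq
    obtain ⟨w, hw⟩ := eqPure_ev Q B (ULift.{u} (Fin k)) (fun j ↦ ρ j.down) q v
      fun j ↦ (hq j).symm
    refine ⟨v - (ev Q).hom ∘ₗ w, ?_, fun j hj ↦ ?_⟩
    · rw [← hv]
      ext b
      have : π ((ev Q).hom (w (Finsupp.single b 1))) = 0 :=
        (Submodule.Quotient.mk_eq_zero _).2 ⟨_, rfl⟩
      simp [this]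
    · have := hw ⟨j, hj⟩
      change w (ρ j) = _ at this
      rw [LinearMap.sub_apply, LinearMap.comp_apply, this, hq, sub_self]
  choose δ hδπ hδ using hδ
  -- on each `ρ j` only finitely many of the maps `δ i` do not vanish
  have hsum (N j : ℕ) (hN : j < N) :
      ∑ i ∈ Finset.range N, δ i (ρ j) = ∑ i ∈ Finset.range (j + 1), δ i (ρ j) := by
    refine (Finset.sum_subset (by simpa using hN) fun i _ hi ↦ hδ _ _ ?_).symm
    simpa using hi
  obtain ⟨T, hT⟩ := hρ _ (hR.fdLE_ch hQ) (fun j ↦ ∑ i ∈ Finset.range (j + 1), δ i (ρ j))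
    fun c hc ↦ by
      have : Finsupp.linearCombination R (fun j ↦ ∑ i ∈ Finset.range (j + 1), δ i (ρ j)) c
          = ∑ i ∈ Finset.range (c.support.sup id + 1), δ i (Finsupp.linearCombination R ρ c) := by
        simp_rw [Finsupp.apply_linearCombination, Finsupp.linearCombination_apply, Finsupp.sum]
        rw [Finset.sum_comm]
        refine Finset.sum_congr rfl fun j hj ↦ ?_
        rw [← hsum (c.support.sup id + 1) j (Nat.lt_succ_of_le (Finset.le_sup (f := id) hj)),
          Finset.smul_sum]
        rfl
      rw [this, hc]
      simp
  refine ⟨π ∘ₗ T + s 0, fun j ↦ ?_⟩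
  rw [LinearMap.add_apply, LinearMap.comp_apply, hT, map_sum]
  have (i : ℕ) : π (δ i (ρ j)) = s (i + 1) (ρ j) - s i (ρ j) := LinearMap.congr_fun (hδπ i) (ρ j)
  simp_rw [this]
  rw [Finset.sum_range_sub (fun i ↦ s i (ρ j)), sub_add_cancel, hs _ _ (Nat.lt_succ_self j)]

/-- For a countably presented module, orthogonality to character modules of the modules of finite
flat dimension gives the vanishing of `Ext²` into these modules themselves. -/
lemma SfliLE.ext_two {n : ℕ} (hR : SfliLE R n) {B : Type u} {K U : ModuleCat.{u} R}
    {i : K ⟶ ModuleCat.of R (B →₀ R)} {p : ModuleCat.of R (B →₀ R) ⟶ U} (e : SES i p)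
    (ρ : ℕ → B →₀ R) (hρ : Submodule.span R (Set.range ρ) = LinearMap.range i.hom)
    (hU : TorOrth n U) {Q : ModuleCat.{u} R} (hQ : FdLE Q n) : ExtVanish U Q 2 := by
  have h1 : ExtVanish U (cokerEv Q) 1 := ext_of_solvable e ρ hρ
    (hR.solvable_cokerEv ρ (fun Y hY ↦ solvable_of_ext e ρ hρ (hU Y hY)) hQ)
  exact (ses_cokerEv Q).coext₁ h1 (hU.ext (hR.fdLE_ch hQ) 1)

end Solvable

section CountableIndex

variable {R : Type u} [Ring R] {M : Type u} [AddCommGroup M] [Module R M] {ι κ : Type*}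

lemma linearCombination_extend (j : ι → κ) (hj : Function.Injective j) (ρ : ι → M) (c : κ →₀ R) :
    Finsupp.linearCombination R (Function.extend j ρ 0) c
      = Finsupp.linearCombination R ρ (c.comapDomain j hj.injOn) := by
  induction c using Finsupp.induction_linear with
  | zero => simp
  | add c d hc hd => rw [map_add, hc, hd, Finsupp.comapDomain_add_of_injective hj, map_add]
  | single k r =>
    rw [Finsupp.linearCombination_single]
    by_cases hk : ∃ i, j i = k
    · obtain ⟨i, rfl⟩ := hk
      rw [hj.extend_apply, Finsupp.comapDomain_single, Finsupp.linearCombination_single]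
    · rw [Function.extend_apply' _ _ _ hk]
      have : (Finsupp.single k r).comapDomain j hj.injOn = 0 := by
        ext i
        rw [Finsupp.comapDomain_apply, Finsupp.single_eq_of_ne fun h ↦ hk ⟨i, h⟩]
        rfl
      rw [this]
      simp

lemma Solvable.extend {j : ι → κ} (hj : Function.Injective j) {ρ : ι → M} {X : ModuleCat.{u} R}
    (h : Solvable ρ X) : Solvable (Function.extend j ρ 0) X := by
  intro a ha
  obtain ⟨t, ht⟩ := h (a ∘ j) fun c hc ↦ by
    have := ha (c.mapDomain j) (by
      rw [linearCombination_extend j hj, Finsupp.comapDomain_mapDomain _ hj, hc])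
    rwa [Finsupp.linearCombination_mapDomain] at this
  refine ⟨t, fun k ↦ ?_⟩
  by_cases hk : ∃ i, j i = k
  · obtain ⟨i, rfl⟩ := hk
    rw [hj.extend_apply, ht]
    rfl
  · rw [Function.extend_apply' _ _ _ hk]
    have := ha (Finsupp.single k 1) (by
      rw [Finsupp.linearCombination_single, Function.extend_apply' _ _ _ hk]
      simp)
    rw [Finsupp.linearCombination_single, one_smul] at this
    rw [this]
    exact map_zero t

lemma Solvable.of_extend {j : ι → κ} (hj : Function.Injective j) {ρ : ι → M} {X : ModuleCat.{u} R}
    (h : Solvable (Function.extend j ρ 0) X) : Solvable ρ X := by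
  intro a ha
  obtain ⟨t, ht⟩ := h (Function.extend j a 0) fun c hc ↦ by
    rw [linearCombination_extend j hj] at hc ⊢
    exact ha _ hc
  exact ⟨t, fun i ↦ by simpa only [hj.extend_apply] using ht (j i)⟩

lemma SfliLE.solvable_cokerEv' [StarRing R] {n : ℕ} (hR : SfliLE R n) {B : Type u} {ι : Type u}
    [Countable ι] (ρ : ι → B →₀ R) (hρ : ∀ Y : ModuleCat.{u} R, FdLE Y n → Solvable ρ (ch Y))
    {Q : ModuleCat.{u} R} (hQ : FdLE Q n) : Solvable ρ (cokerEv Q) := by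
  obtain ⟨j, hj⟩ := exists_injective_nat ι
  exact (hR.solvable_cokerEv _ (fun Y hY ↦ (hρ Y hY).extend hj) hQ).of_extend hj

end CountableIndex

/-! ### Tensoring matrices with modules -/

section Tens

variable {R : Type u} [Ring R] [StarRing R] {A B C : Type u}

/-- The map obtained by tensoring the matrix `d` with `Y`, where `Y` is made a right module by
means of the involution, and `Y ⊗ (B →₀ R)` is identified with `B →₀ Y`. -/
def tens (d : B → C →₀ R) (Y : Type u) [AddCommGroup Y] [Module R Y] : (B →₀ Y) →+ (C →₀ Y) :=
  Finsupp.liftAddHom fun b ↦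
    { toFun y := (d b).mapRange (fun r ↦ star r • y) (by simp)
      map_zero' := by ext; simp
      map_add' x y := by ext; simp }

section
variable {Y Y' : Type u} [AddCommGroup Y] [Module R Y] [AddCommGroup Y'] [Module R Y']

lemma tens_single (d : B → C →₀ R) (b : B) (y : Y) :
    tens d Y (Finsupp.single b y) = (d b).mapRange (fun r ↦ star r • y) (by simp) :=
  Finsupp.sum_single_index (by ext; simp)

lemma tens_single_apply (d : B → C →₀ R) (b : B) (y : Y) (c : C) :
    tens d Y (Finsupp.single b y) c = star (d b c) • y := by
  rw [tens_single]; rfl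

lemma tens_mapRange (d : B → C →₀ R) (p : Y →ₗ[R] Y') (z : B →₀ Y) :
    tens d Y' (z.mapRange p (map_zero p)) = (tens d Y z).mapRange p (map_zero p) := by
  induction z using Finsupp.induction_linear with
  | zero => simp
  | add z w hz hw =>
    rw [Finsupp.mapRange_add (map_add p), map_add, hz, hw, map_add,
      Finsupp.mapRange_add (map_add p)]
  | single b y =>
    ext c
    rw [Finsupp.mapRange_single, Finsupp.mapRange_apply, tens_single_apply, tens_single_apply,
      map_smul]

lemma tens_comp_zero (d : A → B →₀ R) (d' : B → C →₀ R)
    (h : ∀ a, Finsupp.linearCombination R d' (d a) = 0) (z : A →₀ Y) :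
    tens d' Y (tens d Y z) = 0 := by
  induction z using Finsupp.induction_linear with
  | zero => simp
  | add z w hz hw => rw [map_add, map_add, hz, hw, add_zero]
  | single a y =>
    have key (x : B →₀ R) : tens d' Y (x.mapRange (fun r ↦ star r • y) (by simp))
        = (Finsupp.linearCombination R d' x).mapRange (fun r ↦ star r • y) (by simp) := by
      induction x using Finsupp.induction_linear with
      | zero => simp
      | add x w hx hw =>
        have hadd (r s : R) : star (r + s) • y = star r • y + star s • y := by simp [add_smul]
        rw [Finsupp.mapRange_add hadd, map_add, hx, hw, map_add, Finsupp.mapRange_add hadd]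
      | single b r =>
        ext c
        rw [Finsupp.mapRange_single, tens_single_apply, Finsupp.mapRange_apply,
          Finsupp.linearCombination_single, Finsupp.smul_apply, smul_eq_mul, star_mul, mul_smul]
    rw [tens_single, key, h]
    simp

end

/-- A map `(B →₀ R) → Y⁺` as a character of `B →₀ Y`. -/
def toChar {Y : ModuleCat.{u} R} (φ : (B →₀ R) →ₗ[R] Ch Y) : (B →₀ Y) →+ AddCircle (1 : ℚ) :=
  Finsupp.liftAddHom fun b ↦ (φ (Finsupp.single b 1) : Y →+ AddCircle (1 : ℚ))

/-- A character of `B →₀ Y` as a map `(B →₀ R) → Y⁺`. -/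
def ofChar {Y : ModuleCat.{u} R} (χ : (B →₀ Y) →+ AddCircle (1 : ℚ)) : (B →₀ R) →ₗ[R] Ch Y :=
  Finsupp.linearCombination R fun b ↦ (χ.comp (Finsupp.singleAddHom b) : Ch Y)

variable {Y : ModuleCat.{u} R}

lemma toChar_single (φ : (B →₀ R) →ₗ[R] Ch Y) (b : B) (y : Y) :
    toChar φ (Finsupp.single b y) = (φ (Finsupp.single b 1) : Ch Y) y :=
  Finsupp.sum_single_index (map_zero (φ (Finsupp.single b 1) : Ch Y))

lemma toChar_ofChar (χ : (B →₀ Y) →+ AddCircle (1 : ℚ)) : toChar (ofChar χ) = χ := by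
  ext b y
  rw [AddMonoidHom.comp_apply, Finsupp.singleAddHom_apply, toChar_single]
  let c : Ch Y := χ.comp (Finsupp.singleAddHom b)
  have : ofChar χ (Finsupp.single b 1) = (1 : R) • c :=
    Finsupp.linearCombination_single R 1 b
  rw [this, one_smul]
  rfl

lemma toChar_zero : toChar (0 : (B →₀ R) →ₗ[R] Ch Y) = 0 := by
  ext b y
  rw [AddMonoidHom.comp_apply, Finsupp.singleAddHom_apply, toChar_single]
  rfl

lemma toChar_injective : Function.Injective (toChar (B := B) (Y := Y)) := by
  intro φ ψ h
  refine Finsupp.lhom_ext' fun b ↦ LinearMap.ext_ring (Ch.ext (M := Y) fun y ↦ ?_)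
  have := congr($h (Finsupp.single b y))
  rw [toChar_single, toChar_single] at this
  exact this

lemma toChar_tens (d : B → C →₀ R) (φ : (C →₀ R) →ₗ[R] Ch Y) (z : B →₀ Y) :
    toChar φ (tens d Y z) = toChar (φ ∘ₗ Finsupp.linearCombination R d) z := by
  induction z using Finsupp.induction_linear with
  | zero => simp
  | add z w hz hw => rw [map_add, map_add, hz, hw, map_add]
  | single b y =>
    rw [toChar_single, LinearMap.comp_apply, Finsupp.linearCombination_single, one_smul, tens_single]
    generalize d b = x
    induction x using Finsupp.induction_linear with
    | zero => simp
    | add x w hx hw =>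
      have hadd (r s : R) : star (r + s) • y = star r • y + star s • y := by simp [add_smul]
      rw [Finsupp.mapRange_add hadd, map_add, hx, hw, map_add, Ch.add_apply]
    | single c r =>
      rw [Finsupp.mapRange_single, toChar_single, ← Ch.smul_apply, ← map_smul,
        Finsupp.smul_single_one]

/-- Exactness after tensoring with `Y` gives exactness after applying `Hom(-, Y⁺)`. -/
lemma exists_factor_of_tens_exact (d : A → B →₀ R) (d' : B → C →₀ R)
    (h : ∀ z : B →₀ Y, tens d' Y z = 0 → ∃ w, tens d Y w = z)
    (φ : (B →₀ R) →ₗ[R] Ch Y) (hφ : φ ∘ₗ Finsupp.linearCombination R d = 0) :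
    ∃ ψ : (C →₀ R) →ₗ[R] Ch Y, ψ ∘ₗ Finsupp.linearCombination R d' = φ := by
  have hk : (tens d' Y).ker ≤ (toChar φ).ker := by
    intro z hz
    obtain ⟨w, rfl⟩ := h z hz
    rw [AddMonoidHom.mem_ker, toChar_tens, hφ, toChar_zero, AddMonoidHom.zero_apply]
  obtain ⟨χ, hχ⟩ := exists_extend_char (QuotientAddGroup.kerLift (tens d' Y))
    (QuotientAddGroup.kerLift_injective _) (QuotientAddGroup.lift _ (toChar φ) hk)
  refine ⟨ofChar χ, toChar_injective ?_⟩
  ext b y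
  have := congr($hχ (QuotientAddGroup.mk (Finsupp.single b y)))
  rw [AddMonoidHom.comp_apply, AddMonoidHom.comp_apply, ← toChar_tens, toChar_ofChar]
  exact this

/-- Exactness after applying `Hom(-, Y⁺)` gives exactness after tensoring with `Y`. -/
lemma tens_exact_of_exists_factor (d : A → B →₀ R) (d' : B → C →₀ R)
    (h : ∀ φ : (B →₀ R) →ₗ[R] Ch Y, φ ∘ₗ Finsupp.linearCombination R d = 0 →
      ∃ ψ : (C →₀ R) →ₗ[R] Ch Y, ψ ∘ₗ Finsupp.linearCombination R d' = φ)
    (z : B →₀ Y) (hz : tens d' Y z = 0) : ∃ w, tens d Y w = z := by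
  by_contra hcon
  obtain ⟨χ, hχ, hχz⟩ := exists_char_separating (tens d Y).range (a := z) (by
    rintro ⟨w, hw⟩
    exact hcon ⟨w, hw⟩)
  obtain ⟨ψ, hψ⟩ := h (ofChar χ) (toChar_injective (by
    ext a y
    rw [AddMonoidHom.comp_apply, ← toChar_tens, toChar_ofChar, hχ _ ⟨_, rfl⟩, toChar_zero]
    rfl))
  apply hχz
  rw [← toChar_ofChar χ, ← hψ, ← toChar_tens, hz, map_zero]

end Tens

/-! ### Countable closed subsets of a basis -/

section Uniform

/-- A countable set lies in a countable set which is closed under an operation on finite subsets. -/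
lemma exists_countable_closure {B : Type u} (c : Finset B → Finset B) {S : Set B}
    (hS : S.Countable) : ∃ N : Set B, S ⊆ N ∧ N.Countable ∧
      ∀ t : Finset B, (t : Set B) ⊆ N → (c t : Set B) ⊆ N := by
  classical
  let Φ (S : Set B) : Set B := S ∪ ⋃ t ∈ {t : Finset B | (t : Set B) ⊆ S}, (c t : Set B)
  let T (n : ℕ) : Set B := Φ^[n] S
  have hT (n : ℕ) : T (n + 1) = Φ (T n) := Function.iterate_succ_apply' Φ n S
  have hmono : Monotone T := monotone_nat_of_le_succ fun n ↦ by
    rw [hT]; exact Set.subset_union_left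
  have hc (n : ℕ) : (T n).Countable := by
    induction n with
    | zero => exact hS
    | succ n ih =>
      rw [hT]
      refine ih.union (Set.Countable.biUnion ?_ fun t _ ↦ (c t).countable_toSet)
      refine ((Set.countable_ofPred_finite_subset ih).preimage_of_injOn
        (f := fun t : Finset B ↦ (t : Set B)) Finset.coe_injective.injOn).mono fun t ht ↦ ?_
      exact ⟨t.finite_toSet, ht⟩
  refine ⟨⋃ n, T n, Set.subset_iUnion T 0, Set.countable_iUnion hc, fun t ht ↦ ?_⟩
  obtain ⟨n, hn⟩ : ∃ n, (t : Set B) ⊆ T n :=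
    hmono.directed_le.exists_mem_subset_of_finset_subset_biUnion ht
  refine Set.Subset.trans ?_ (Set.subset_iUnion T (n + 1))
  rw [hT]
  exact Set.subset_union_of_subset_right (Set.subset_biUnion_of_mem (u := fun t ↦ (c t : Set B)) hn) _

variable {R : Type u} [Ring R] [StarRing R] {B : Type u}

/-- If tensoring with any module of finite flat dimension makes the cycles supported in a finite
set (modulo `T`) boundaries, then these are boundaries of chains supported in a finite set
independent of the module. Otherwise the product of the counterexamples would be one. -/
lemma SfliLE.exists_uniform {n : ℕ} (hR : SfliLE R n) (d : A → B →₀ R) (d' : B → C →₀ R)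
    (T : Set B) (T' : Set C) (t : Finset B)
    (h : ∀ Y : ModuleCat.{u} R, FdLE Y n → ∀ z : B →₀ Y, z.support ⊆ t →
      (∀ c ∉ T', tens d' Y z c = 0) → ∃ w : A →₀ Y, ∀ b ∉ T, tens d Y w b = z b) :
    ∃ t' : Finset A, ∀ Y : ModuleCat.{u} R, FdLE Y n → ∀ z : B →₀ Y, z.support ⊆ t →
      (∀ c ∉ T', tens d' Y z c = 0) →
      ∃ w : A →₀ Y, w.support ⊆ t' ∧ ∀ b ∉ T, tens d Y w b = z b := by
  by_contra! hcon
  choose Y hY z hzt hz hw using hcon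
  let zz : B →₀ piMod Y := Finsupp.onFinset t (fun b i ↦ z i b) fun b hb ↦ by
    by_contra hbt
    exact hb (funext fun i ↦ Finsupp.notMem_support_iff.1 fun h ↦ hbt (hzt i h))
  let p (i : Finset A) : piMod Y →ₗ[R] Y i := LinearMap.proj i
  have hp (i : Finset A) : zz.mapRange (p i) (map_zero _) = z i := by ext b; rfl
  obtain ⟨w, hw'⟩ := h (piMod Y) (hR.fdLE_pi hY) zz Finsupp.support_onFinset_subset fun c hc ↦ by
    funext i
    have := hz i c hc
    rw [← hp i, tens_mapRange] at this
    exact this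
  obtain ⟨b, hb, hne⟩ := hw w.support (w.mapRange (p _) (map_zero _)) Finsupp.support_mapRange
  apply hne
  rw [tens_mapRange, ← hp, Finsupp.mapRange_apply, Finsupp.mapRange_apply, hw' b hb]

end Uniform

/-! ### Periodic complexes of free modules -/

section Periodic

variable {R : Type u} [Ring R]

section Support
variable {B C M : Type u} [AddCommGroup M] [Module R M]

lemma linearCombination_congr {g g' : B → M} {x : B →₀ R} (h : ∀ b, x b ≠ 0 → g b = g' b) :
    Finsupp.linearCombination R g x = Finsupp.linearCombination R g' x := by
  rw [Finsupp.linearCombination_apply, Finsupp.linearCombination_apply]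
  exact Finsupp.sum_congr fun b hb ↦ by rw [h b (Finsupp.mem_support_iff.1 hb)]

lemma linearCombination_eq_zero {g : B → M} {x : B →₀ R} (h : ∀ b, x b ≠ 0 → g b = 0) :
    Finsupp.linearCombination R g x = 0 :=
  (linearCombination_congr (g' := 0) h).trans (by simp)

lemma linearCombination_matrix_apply (d : B → C →₀ R) (x : B →₀ R) (c : C) :
    Finsupp.linearCombination R d x c = x.sum fun b r ↦ r * d b c := by
  rw [Finsupp.linearCombination_apply, Finsupp.sum, Finsupp.finsetSum_apply]
  rfl

lemma linearCombination_matrix_apply_eq_zero {d : B → C →₀ R} {x : B →₀ R} {c : C}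
    (h : ∀ b, x b ≠ 0 → d b c = 0) : Finsupp.linearCombination R d x c = 0 := by
  rw [linearCombination_matrix_apply]
  exact Finset.sum_eq_zero fun b hb ↦ by simp [h b (Finsupp.mem_support_iff.1 hb)]

variable [StarRing R] {Y : Type u} [AddCommGroup Y] [Module R Y]

lemma tens_apply (d : B → C →₀ R) (z : B →₀ Y) (c : C) :
    tens d Y z c = z.sum fun b y ↦ star (d b c) • y := by
  induction z using Finsupp.induction_linear with
  | zero => simp
  | add z w hz hw =>
    rw [map_add, Finsupp.add_apply, hz, hw, Finsupp.sum_add_index']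
    · simp
    · simp
  | single b y => 
    exact (tens_single_apply d b y c).trans
      (Finsupp.sum_single_index (h := fun b y ↦ star (d b c) • y) (smul_zero _)).symm

lemma tens_apply_eq_zero {d : B → C →₀ R} {z : B →₀ Y} {c : C}
    (h : ∀ b, z b ≠ 0 → d b c = 0) : tens d Y z c = 0 := by
  rw [tens_apply]
  exact Finset.sum_eq_zero fun b hb ↦ by simp [h b (Finsupp.mem_support_iff.1 hb)]

/-- Tensoring a matrix with the regular module. -/
lemma tens_star (d : B → C →₀ R) (z : B →₀ R) :
    tens d R (z.mapRange star (star_zero R))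
      = (Finsupp.linearCombination R d z).mapRange star (star_zero R) := by
  ext c
  rw [tens_apply, Finsupp.mapRange_apply, linearCombination_matrix_apply,
    Finsupp.sum_mapRange_index (by simp), Finsupp.sum, Finsupp.sum, star_sum]
  exact Finset.sum_congr rfl fun b _ ↦ by rw [star_mul, smul_eq_mul]

end Support

section Subquotient

variable {B : Type u} (d : B → B →₀ R) (N : Set B)

/-- The square block of a matrix on a set of basis elements. -/
def block (b : N) : N →₀ R := (d b).comapDomain (fun b : N ↦ (b : B)) Subtype.val_injective.injOn

/-- The extension of a finitely supported function on `N` by zero. -/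
abbrev inc {Y : Type u} [AddCommGroup Y] (z : N →₀ Y) : B →₀ Y :=
  z.mapDomain (fun b : N ↦ (b : B))

variable {N}

lemma inc_apply {Y : Type u} [AddCommGroup Y] (z : N →₀ Y) {b : B} (hb : b ∈ N) :
    inc N z b = z ⟨b, hb⟩ :=
  Finsupp.mapDomain_apply Subtype.val_injective z ⟨b, hb⟩

lemma inc_apply_of_notMem {Y : Type u} [AddCommGroup Y] (z : N →₀ Y) {b : B} (hb : b ∉ N) :
    inc N z b = 0 :=
  Finsupp.mapDomain_of_notMem_range _ _ (by simpa using hb)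

lemma linearCombination_block (x : N →₀ R) (c : N) :
    Finsupp.linearCombination R (block d N) x c = Finsupp.linearCombination R d (inc N x) c := by
  rw [linearCombination_matrix_apply, linearCombination_matrix_apply,
    Finsupp.sum_mapDomain_index (by simp) (by simp [add_mul])]
  rfl

variable [StarRing R]

lemma tens_block {Y : Type u} [AddCommGroup Y] [Module R Y] (z : N →₀ Y) (c : N) :
    tens (block d N) Y z c = tens d Y (inc N z) c := by
  rw [tens_apply, tens_apply, Finsupp.sum_mapDomain_index (by simp) (by simp)]
  rfl

end Subquotient

variable [StarRing R] {n : ℕ} {B : Type u}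

/-- The matrix `d` is exact after tensoring with all modules of flat dimension at most `n`, modulo
the part supported in `T`. -/
def TensExact (n : ℕ) (d : B → B →₀ R) (T : Set B) : Prop :=
  ∀ Y : ModuleCat.{u} R, FdLE Y n → ∀ z : B →₀ Y, (∀ b ∉ T, tens d Y z b = 0) →
    ∃ w : B →₀ Y, ∀ b ∉ T, tens d Y w b = z b

lemma TensExact.exists_of_empty {d : B → B →₀ R} (h : TensExact n d ∅) (Y : ModuleCat.{u} R)
    (hY : FdLE Y n) (z : B →₀ Y) (hz : tens d Y z = 0) : ∃ w, tens d Y w = z := by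
  obtain ⟨w, hw⟩ := h Y hY z fun b _ ↦ by rw [hz]; rfl
  exact ⟨w, Finsupp.ext fun b ↦ hw b (Set.notMem_empty b)⟩

lemma TensExact.exists_linearCombination {d : B → B →₀ R} (h : TensExact n d ∅) (x : B →₀ R)
    (hx : Finsupp.linearCombination R d x = 0) : ∃ w, Finsupp.linearCombination R d w = x := by
  obtain ⟨w, hw⟩ := h.exists_of_empty (ModuleCat.of R R) (.of_projective _ _)
    (x.mapRange star (star_zero R)) (by
      rw [tens_star, hx]
      simp)
  refine ⟨w.mapRange star (star_zero R), ?_⟩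
  have h1 : (w.mapRange star (star_zero R)).mapRange star (star_zero R) = w := by ext; simp
  rw [← h1, tens_star] at hw
  ext b
  have := congrArg star congr($hw b)
  simpa using this

/-- Over a countable basis, exactness of the tensor products implies exactness of the maps into
modules of finite flat dimension. The equations are first solved in `Q⁺⁺`; the image of this solution
in `Q⁺⁺ / Q` factors through `d`, and subtracting a lift of the factorization gives a solution
in `Q`. -/
lemma SfliLE.exists_solution_of_countable (hR : SfliLE R n) [Countable B] (d : B → B →₀ R)
    (hd : ∀ b, Finsupp.linearCombination R d (d b) = 0) (hex : TensExact n d ∅)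
    {Q : ModuleCat.{u} R} (hQ : FdLE Q n) (f : B → Q)
    (hf : ∀ b, Finsupp.linearCombination R f (d b) = 0) :
    ∃ g : B → Q, ∀ b, Finsupp.linearCombination R g (d b) = f b := by
  have hs (Y : ModuleCat.{u} R) (hY : FdLE Y n) : Solvable d (ch Y) := by
    intro h hh
    obtain ⟨t, ht⟩ := exists_factor_of_tens_exact d d (hex.exists_of_empty Y hY)
      (Finsupp.linearCombination R h) (by
        ext b
        simp [hh _ (hd b)])
    refine ⟨t, fun j ↦ ?_⟩
    have := LinearMap.congr_fun ht (Finsupp.single j 1)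
    simpa using this
  let π : Ch (Ch Q) →ₗ[R] cokerEv Q := (LinearMap.range (ev Q).hom).mkQ
  obtain ⟨k, hk⟩ := hs _ (hR.fdLE_ch hQ) (fun b ↦ (ev Q).hom (f b)) fun c hc ↦ by
    obtain ⟨w, rfl⟩ := hex.exists_linearCombination c hc
    have h0 : Finsupp.linearCombination R f ∘ₗ Finsupp.linearCombination R d = 0 := by
      ext b
      simp [hf]
    have := congrArg (ev Q).hom (LinearMap.congr_fun h0 w)
    rw [LinearMap.comp_apply, Finsupp.apply_linearCombination] at this
    exact this.trans (map_zero _)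
  obtain ⟨ψ, hψ⟩ := hR.solvable_cokerEv' d hs hQ (fun b ↦ π (k (Finsupp.single b 1))) fun c hc ↦ by
    obtain ⟨w, rfl⟩ := hex.exists_linearCombination c hc
    have h0 : π ∘ₗ k ∘ₗ Finsupp.linearCombination R d = 0 := by
      ext b
      simp only [LinearMap.comp_apply, Finsupp.lsingle_apply, Finsupp.linearCombination_single,
        one_smul, hk]
      exact (Submodule.Quotient.mk_eq_zero _).2 ⟨_, rfl⟩
    have h1 : Finsupp.linearCombination R (fun b ↦ π (k (Finsupp.single b 1))) = π ∘ₗ k := by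
      ext b
      simp
    rw [h1]
    exact LinearMap.congr_fun h0 w
  obtain ⟨ψ', hψ'⟩ := Module.projective_lifting_property π ψ (Submodule.mkQ_surjective _)
  have hg (b : B) : ∃ q, (ev Q).hom q = k (Finsupp.single b 1) - ψ' (d b) := by
    change _ ∈ LinearMap.range (ev Q).hom
    rw [← Submodule.ker_mkQ (LinearMap.range (ev Q).hom), LinearMap.mem_ker, map_sub]
    change π _ - π (ψ' (d b)) = 0
    rw [← LinearMap.comp_apply π ψ', hψ', hψ, sub_self]
  choose g hg using hg
  refine ⟨g, fun b ↦ ev_injective Q ?_⟩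
  have h1 : (ev Q).hom ∘ₗ Finsupp.linearCombination R g
      = k - ψ' ∘ₗ Finsupp.linearCombination R d := by
    ext b
    simp [hg]
  have := LinearMap.congr_fun h1 (d b)
  rw [LinearMap.sub_apply, LinearMap.comp_apply, LinearMap.comp_apply, hd, map_zero, sub_zero,
    hk] at this
  exact this

/-- The set `T` of basis elements spans a subcomplex. -/
def MatClosed (d : B → B →₀ R) (T : Set B) : Prop := ∀ b ∈ T, ∀ b' ∉ T, d b b' = 0

/-- Over a ring with finite `sfli`, exactness after tensoring with the modules of finite flat
dimension implies exactness of the maps to these modules. Partial solutions are defined on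
subcomplexes with exact quotient; a maximal one is everything, since the complex has countable
subquotients of this kind. -/
theorem SfliLE.exists_solution (hR : SfliLE R n) (d : B → B →₀ R)
    (hd : ∀ b, Finsupp.linearCombination R d (d b) = 0) (hex : TensExact n d ∅)
    {Q : ModuleCat.{u} R} (hQ : FdLE Q n) (f : B → Q)
    (hf : ∀ b, Finsupp.linearCombination R f (d b) = 0) :
    ∃ g : B → Q, ∀ b, Finsupp.linearCombination R g (d b) = f b := by
  classical
  let P : Type u := {p : Set B × (B → Q) // MatClosed d p.1 ∧ TensExact n d p.1 ∧
    ∀ b ∈ p.1, Finsupp.linearCombination R p.2 (d b) = f b}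
  let r (p q : P) : Prop := p.1.1 ⊆ q.1.1 ∧ ∀ b ∈ p.1.1, p.1.2 b = q.1.2 b
  have : Nonempty P := ⟨⟨(∅, 0), fun b hb ↦ absurd hb (Set.notMem_empty b), hex,
    fun b hb ↦ absurd hb (Set.notMem_empty b)⟩⟩
  obtain ⟨⟨⟨T, g⟩, hcl, hT, hg⟩, hmax⟩ := exists_maximal_of_nonempty_chains_bounded (r := r)
    (by
      intro c hc hne
      have hrefl (p : P) : r p p := ⟨subset_rfl, fun _ _ ↦ rfl⟩
      have : Std.Refl r := ⟨hrefl⟩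
      let T : Set B := ⋃ p ∈ c, p.1.1
      let g (b : B) : Q := if h : ∃ p ∈ c, b ∈ p.1.1 then h.choose.1.2 b else 0
      have hgp (p : P) (hp : p ∈ c) (b : B) (hb : b ∈ p.1.1) : p.1.2 b = g b := by
        have h : ∃ p ∈ c, b ∈ p.1.1 := ⟨p, hp, hb⟩
        simp only [g, dif_pos h]
        rcases hc.total hp h.choose_spec.1 with h' | h'
        · exact h'.2 b hb
        · exact (h'.2 b h.choose_spec.2).symm
      have hmem {b : B} (p : P) (hp : p ∈ c) (hb : b ∈ p.1.1) : b ∈ T :=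
        Set.mem_biUnion hp hb
      refine ⟨⟨(T, g), ?_, ?_, ?_⟩, fun p hp ↦ ⟨fun b hb ↦ hmem p hp hb, hgp p hp⟩⟩
      · intro b hb b' hb'
        obtain ⟨p, hp, hbp⟩ := Set.mem_iUnion₂.1 hb
        exact p.2.1 b hbp b' fun h ↦ hb' (hmem p hp h)
      · intro Y hY z hz
        have hdir : DirectedOn (fun p q : P ↦ p.1.1 ⊆ q.1.1) c := by
          intro p hp q hq
          rcases hc.total hp hq with h | h
          · exact ⟨q, hq, h.1, subset_rfl⟩
          · exact ⟨p, hp, subset_rfl, h.1⟩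
        have hsub : ((tens d Y z).support : Set B) ⊆ ⋃ p ∈ c, p.1.1 := by
          intro b hb
          by_contra hbT
          exact (Finsupp.mem_support_iff.1 hb) (hz b hbT)
        obtain ⟨p, hp, hpz⟩ := DirectedOn.exists_mem_subset_of_finset_subset_biUnion hne hdir hsub
        obtain ⟨w, hw⟩ := p.2.2.1 Y hY z fun b hb ↦ by
          by_contra h
          exact hb (hpz (Finsupp.mem_support_iff.2 h))
        exact ⟨w, fun b hb ↦ hw b fun h ↦ hb (hmem p hp h)⟩
      · intro b hb
        obtain ⟨p, hp, hbp⟩ := Set.mem_iUnion₂.1 hb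
        rw [← p.2.2.2 b hbp]
        refine linearCombination_congr fun b' hb' ↦ (hgp p hp b' ?_).symm
        by_contra h
        exact hb' (p.2.1 b hbp b' h))
    (fun {p q s} h h' ↦ ⟨h.1.trans h'.1, fun b hb ↦ (h.2 b hb).trans (h'.2 b (h.1 hb))⟩)
  simp only at hcl hT hg
  suffices h : ∀ b, b ∈ T from ⟨g, fun b ↦ hg b (h b)⟩
  intro b₀
  by_contra hb₀
  -- a countable subcomplex containing `b₀` with exact image modulo `T`
  choose v hv using fun t ↦ hR.exists_uniform d d T T t fun Y hY z _ hz ↦ hT Y hY z hz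
  obtain ⟨N', hbN', hN', hcN'⟩ := exists_countable_closure
    (fun t ↦ v t ∪ t.biUnion fun b ↦ (d b).support) (Set.countable_singleton b₀)
  have hdN' (b : B) (hb : b ∈ N') (b' : B) (hb' : b' ∉ N') : d b b' = 0 := by
    by_contra h
    refine hb' (hcN' {b} (by simpa using hb) ?_)
    simp [h]
  let N : Set B := N' \ T
  have : Countable N := (hN'.mono Set.sdiff_subset).to_subtype
  let g₀ (b : B) : Q := if b ∈ T then g b else 0
  -- modulo `T`, the part of a chain supported in `N'` is determined by its values on `N`
  have hsplit (x : B →₀ R) (hx : ∀ b ∉ N', x b = 0) : ∀ b ∉ T,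
      x b = inc N (x.comapDomain (fun b : N ↦ (b : B)) Subtype.val_injective.injOn) b := by
    intro b hb
    by_cases hbN : b ∈ N'
    · rw [inc_apply _ (show b ∈ N from ⟨hbN, hb⟩)]
      rfl
    · rw [inc_apply_of_notMem _ fun h ↦ hbN h.1, hx b hbN]
  have hTd (x : B →₀ R) (hx : ∀ b ∉ T, x b = 0) : ∀ c ∉ T,
      Finsupp.linearCombination R d x c = 0 := fun c hc ↦
    linearCombination_matrix_apply_eq_zero fun b hb ↦
      hcl b (by by_contra h; exact hb (hx b h)) c hc
  have hTt {Y : ModuleCat.{u} R} (z : B →₀ Y) (hz : ∀ b ∉ T, z b = 0) : ∀ c ∉ T,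
      tens d Y z c = 0 := fun c hc ↦
    tens_apply_eq_zero fun b hb ↦ hcl b (by by_contra h; exact hb (hz b h)) c hc
  -- the obstruction vanishes on `T`
  let F : (B →₀ R) →ₗ[R] Q := Finsupp.linearCombination R f -
    Finsupp.linearCombination R g₀ ∘ₗ Finsupp.linearCombination R d
  have hg₀ (b : B) (hb : b ∈ T) : Finsupp.linearCombination R g₀ (d b) = f b := by
    rw [← hg b hb]
    refine linearCombination_congr fun b' hb' ↦ if_pos ?_
    by_contra h
    exact hb' (hcl b hb b' h)
  have hFT (x : B →₀ R) (hx : ∀ b ∉ T, x b = 0) : F x = 0 := by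
    have : F = Finsupp.linearCombination R fun b ↦ f b - Finsupp.linearCombination R g₀ (d b) := by
      ext b
      simp [F]
    rw [this]
    refine linearCombination_eq_zero fun b hb ↦ ?_
    rw [hg₀ b (by by_contra h; exact hb (hx b h)), sub_self]
  have hFd (b : B) : F (d b) = 0 := by simp [F, hf, hd]
  -- the block of `d` on `N` is the matrix of the countable subquotient
  obtain ⟨k, hk⟩ := hR.exists_solution_of_countable (block d N)
    (by
      intro b
      ext c
      rw [linearCombination_block]
      have := hTd (d b - inc N (block d N b)) (fun b' hb' ↦ by
        rw [Finsupp.sub_apply, hsplit (d b) (hdN' b b.2.1) b' hb']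
        exact sub_self _) c c.2.2
      rw [map_sub, hd, zero_sub, Finsupp.neg_apply, neg_eq_zero] at this
      exact this)
    (by
      intro Y hY z hz
      have hz' : ∀ b ∉ T, tens d Y (inc N z) b = 0 := by
        intro b hb
        by_cases hbN : b ∈ N'
        · rw [← hz ⟨b, hbN, hb⟩ (Set.notMem_empty _), tens_block]
        · refine tens_apply_eq_zero fun b' hb' ↦ hdN' b' ?_ b hbN
          by_contra h
          exact hb' (inc_apply_of_notMem z fun h' ↦ h h'.1)
      obtain ⟨w, hw, hwz⟩ := hv (inc N z).support Y hY (inc N z) subset_rfl hz'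
      have hwN : ∀ b ∉ N', w b = 0 := by
        intro b hb
        by_contra h
        refine hb (hcN' (inc N z).support ?_ (Finset.mem_coe.2 (Finset.mem_union_left _
          (hw (Finsupp.mem_support_iff.2 h)))))
        intro b' hb'
        by_contra h'
        exact (Finsupp.mem_support_iff.1 hb') (inc_apply_of_notMem z fun h'' ↦ h' h''.1)
      let w' : N →₀ Y := w.comapDomain (fun b : N ↦ (b : B)) Subtype.val_injective.injOn
      refine ⟨w', fun b _ ↦ ?_⟩
      have h1 := hTt (w - inc N w') (fun b' hb' ↦ by
        rw [Finsupp.sub_apply]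
        by_cases hbN : b' ∈ N'
        · rw [inc_apply _ (show b' ∈ N from ⟨hbN, hb'⟩)]
          exact sub_self _
        · rw [inc_apply_of_notMem _ fun h ↦ hbN h.1, hwN b' hbN, sub_self]) b b.2.2
      rw [map_sub, Finsupp.sub_apply, hwz b b.2.2, sub_eq_zero] at h1
      rw [tens_block, ← h1, inc_apply _ b.2])
    hQ (fun b ↦ F (Finsupp.single b 1)) (by
      intro b
      have h1 (x : N →₀ R) : Finsupp.linearCombination R (fun b : N ↦ F (Finsupp.single b 1)) x
          = F (inc N x) := by
        induction x using Finsupp.induction_linear with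
        | zero => simp
        | add x y hx hy => rw [map_add, hx, hy, inc, inc, inc, Finsupp.mapDomain_add, map_add]
        | single b r =>
          rw [Finsupp.linearCombination_single, inc, Finsupp.mapDomain_single, ← map_smul,
            Finsupp.smul_single_one]
      rw [h1]
      have := hFT (d b - inc N (block d N b)) (fun b' hb' ↦ by
        rw [Finsupp.sub_apply, hsplit (d b) (hdN' b b.2.1) b' hb']
        exact sub_self _)
      rw [map_sub, hFd, zero_sub, neg_eq_zero] at this
      exact this)
  let k' : B → Q := Function.extend (fun b : N ↦ (b : B)) k 0
  have hk' (b : B) (hb : b ∈ T) : k' b = 0 :=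
    Function.extend_apply' _ _ _ (by rintro ⟨⟨c, hc⟩, rfl⟩; exact hc.2 hb)
  have hadd (x : B →₀ R) : Finsupp.linearCombination R (g₀ + k') x
      = Finsupp.linearCombination R g₀ x + Finsupp.linearCombination R k' x := by
    induction x using Finsupp.induction_linear with
    | zero => simp
    | add x y hx hy => rw [map_add, hx, hy, map_add, map_add]; abel
    | single b r => simp
  have hnew : ∀ b ∈ T ∪ N', Finsupp.linearCombination R (g₀ + k') (d b) = f b := by
    intro b hb
    rw [hadd]
    by_cases hbT : b ∈ T
    · rw [hg₀ b hbT, linearCombination_eq_zero, add_zero]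
      intro b' hb'
      refine hk' b' ?_
      by_contra h
      exact hb' (hcl b hbT b' h)
    · have hbN : b ∈ N := ⟨hb.resolve_left hbT, hbT⟩
      have h1 := hk ⟨b, hbN⟩
      rw [linearCombination_extend _ Subtype.val_injective]
      refine (congrArg _ h1).trans ?_
      simp [F]
  have := hmax ⟨(T ∪ N', g₀ + k'), ?_, ?_, hnew⟩ ⟨Set.subset_union_left, fun b hb ↦ ?_⟩
  · exact hb₀ (this.1 (Set.mem_union_right _ (hbN' rfl)))
  · intro b hb b' hb'
    rcases hb with hb | hb
    · exact hcl b hb b' fun h ↦ hb' (Or.inl h)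
    · exact hdN' b hb b' fun h ↦ hb' (Or.inr h)
  · intro Y hY z hz
    let y := tens d Y z
    have hyy : tens d Y y = 0 := tens_comp_zero d d hd z
    obtain ⟨w, hw, hwy⟩ := hv (y.filter (· ∉ T)).support Y hY (y.filter (· ∉ T)) subset_rfl (by
      intro b hb
      have := hTt (y - y.filter (· ∉ T)) (fun b' hb' ↦ by
        rw [Finsupp.sub_apply, Finsupp.filter_apply_pos (· ∉ T) _ hb', sub_self]) b hb
      rw [map_sub, hyy, zero_sub, Finsupp.neg_apply, neg_eq_zero] at this
      exact this)
    obtain ⟨x, hx⟩ := hT Y hY (z - w) fun b hb ↦ by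
      rw [map_sub, Finsupp.sub_apply, hwy b hb, Finsupp.filter_apply_pos (· ∉ T) _ hb, sub_self]
    refine ⟨x, fun b hb ↦ ?_⟩
    rw [hx b fun h ↦ hb (Or.inl h), Finsupp.sub_apply]
    have : w b = 0 := by
      by_contra h
      refine hb (Or.inr (hcN' (y.filter (· ∉ T)).support ?_ (Finset.mem_coe.2
        (Finset.mem_union_left _ (hw (Finsupp.mem_support_iff.2 h))))))
      intro b' hb'
      rw [Finset.mem_coe, Finsupp.support_filter, Finset.mem_filter, Finsupp.mem_support_iff] at hb'
      by_contra h'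
      exact hb'.1 (hz b' fun h ↦ h.elim hb'.2 h')
    rw [this, sub_zero]
  · change g b = g₀ b + k' b
    rw [hk' b hb, add_zero]
    exact (if_pos hb).symm

end Periodic

/-! ### The Eilenberg swindle -/

section Swindle

variable {R : Type u} [Ring R]

/-- If `P` is a direct summand of `S`, then adding `P` to the direct sum of countably many copies
of `S` does not change it. -/
def swindle {P S : Type u} [AddCommGroup P] [Module R P] [AddCommGroup S] [Module R S]
    (s : P →ₗ[R] S) (r : S →ₗ[R] P) (hrs : r ∘ₗ s = LinearMap.id) :
    (P × (ℕ →₀ S)) ≃ₗ[R] (ℕ →₀ S) :=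
  have hr (p : P) : r (s p) = p := LinearMap.congr_fun hrs p
  let e : S →ₗ[R] S := s ∘ₗ r
  let f : S →ₗ[R] S := LinearMap.id - e
  let up : (ℕ →₀ S) →ₗ[R] (ℕ →₀ S) := Finsupp.lmapDomain S R Nat.succ
  let down : (ℕ →₀ S) →ₗ[R] (ℕ →₀ S) := Finsupp.lcomapDomain Nat.succ Nat.succ_injective
  have h0 (x : ℕ →₀ S) : up x 0 = 0 :=
    Finsupp.mapDomain_of_notMem_range _ _ (by simp)
  have h1 (x : ℕ →₀ S) (k : ℕ) : up x (k + 1) = x k :=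
    Finsupp.mapDomain_apply Nat.succ_injective x k
  have h2 (x : ℕ →₀ S) (k : ℕ) : down x k = x (k + 1) := rfl
  LinearEquiv.ofLinearMap
    (LinearMap.coprod (Finsupp.lsingle 0 ∘ₗ s)
      (Finsupp.mapRange.linearMap f + up ∘ₗ Finsupp.mapRange.linearMap e))
    (LinearMap.prod (r ∘ₗ Finsupp.lapply 0)
      (Finsupp.mapRange.linearMap f + Finsupp.mapRange.linearMap e ∘ₗ down))
    (by
      refine LinearMap.ext fun y ↦ Finsupp.ext fun k ↦ ?_
      cases k with
      | zero => simp [h0, h2, e, f, hr]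
      | succ k => simp [h1, h2, e, f, hr])
    (by
      refine LinearMap.ext fun ⟨p, x⟩ ↦ Prod.ext ?_ (Finsupp.ext fun k ↦ ?_)
      · simp [h0, e, f, hr]
      · cases k with
        | zero => simp [h0, h1, h2, e, f, hr]
        | succ k => simp [h1, h2, e, f, hr])

/-- Every projective module becomes free after adding a suitable free module. -/
lemma exists_free_prod (P : Type u) [AddCommGroup P] [Module R P] [Module.Projective R P] :
    ∃ S : Type u, Module.Free R (P × (S →₀ R)) := by
  obtain ⟨s, hs⟩ := Module.Projective.out (R := R) (P := P)
  have e := swindle s (Finsupp.linearCombination R id) (LinearMap.ext hs)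
  have e' : (ℕ →₀ (P →₀ R)) ≃ₗ[R] (ℕ × P →₀ R) := (Finsupp.curryLinearEquiv R).symm
  exact ⟨ℕ × P, Module.Free.of_equiv
    (((LinearEquiv.refl R P).prodCongr e'.symm).trans (e.trans e')).symm⟩

end Swindle

/-! ### Syzygies in unbounded sequences of projective modules -/

section Unbounded

variable {R : Type u} [Ring R]

/-- A product of two modules. -/
abbrev prodMod (X Y : ModuleCat.{u} R) : ModuleCat.{u} R := ModuleCat.of R (X × Y)

lemma SES.prod {X Y Z X' Y' Z' : ModuleCat.{u} R} {f : X ⟶ Y} {g : Y ⟶ Z} {f' : X' ⟶ Y'}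
    {g' : Y' ⟶ Z'} (h : SES f g) (h' : SES f' g') :
    SES (ModuleCat.ofHom (f.hom.prodMap f'.hom) : prodMod X X' ⟶ prodMod Y Y')
      (ModuleCat.ofHom (g.hom.prodMap g'.hom) : prodMod Y Y' ⟶ prodMod Z Z') where
  inj := Function.Injective.prodMap h.inj h'.inj
  exact := by
    rintro ⟨y, y'⟩
    constructor
    · intro hy
      obtain ⟨x, hx⟩ := (h.exact y).1 congr($(hy).1)
      obtain ⟨x', hx'⟩ := (h'.exact y').1 congr($(hy).2)
      exact ⟨(x, x'), Prod.ext hx hx'⟩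
    · rintro ⟨⟨x, x'⟩, hx⟩
      rw [← hx]
      exact Prod.ext (h.exact.apply_apply_eq_zero x) (h'.exact.apply_apply_eq_zero x')
  surj := Function.Surjective.prodMap h.surj h'.surj

/-- The first factor is a retract of a product. -/
def prodRetract (X Y : ModuleCat.{u} R) : Retract X (prodMod X Y) where
  i := ModuleCat.ofHom (LinearMap.inl R X Y)
  r := ModuleCat.ofHom (LinearMap.fst R X Y)
  retract := rfl

lemma ses_prod (X Y : ModuleCat.{u} R) :
    SES (ModuleCat.ofHom (LinearMap.inl R X Y) : X ⟶ prodMod X Y)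
      (ModuleCat.ofHom (LinearMap.snd R X Y)) where
  inj := LinearMap.inl_injective
  exact := Function.Exact.inl_snd
  surj := LinearMap.snd_surjective

lemma SES.ext_of_periodic {W F : ModuleCat.{u} R} {i : W ⟶ F} {p : F ⟶ W} (h : SES i p)
    [Projective F] {N : ModuleCat.{u} R} {m : ℕ} (hN : ExtVanish W N (m + 1)) :
    ExtVanish W N 1 := by
  induction m with
  | zero => exact hN
  | succ m ih => exact ih (h.ext₁ (extVanish_of_projective _ _ _) hN)

section DirectSum

variable (X : ℤ → ModuleCat.{u} R)

/-- The direct sum of a family indexed by the integers. -/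
abbrev sumMod : ModuleCat.{u} R := ModuleCat.of R (Π₀ k, X k)

/-- Each summand is a retract of the direct sum. -/
def sumRetract (k : ℤ) : Retract (X k) (sumMod X) where
  i := ModuleCat.ofHom (DFinsupp.lsingle (R := R) (M := fun k ↦ X k) k)
  r := ModuleCat.ofHom (DFinsupp.lapply (R := R) (M := fun k ↦ X k) k)
  retract := by ext x; simp

variable {X} {Y : ℤ → ModuleCat.{u} R}

/-- A sum of maps `X k → Y (k + 1)`. -/
def sumShift (p : ∀ k, X k ⟶ Y (k + 1)) : sumMod X ⟶ sumMod Y :=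
  ModuleCat.ofHom (DFinsupp.lsum ℕ fun k ↦
    DFinsupp.lsingle (R := R) (M := fun k ↦ Y k) (k + 1) ∘ₗ (p k).hom)

lemma sumShift_single (p : ∀ k, X k ⟶ Y (k + 1)) (k : ℤ) (x : X k) :
    (sumShift p).hom (DFinsupp.single k x) = DFinsupp.single (k + 1) ((p k).hom x) := by
  simp [sumShift]

lemma sumShift_apply (p : ∀ k, X k ⟶ Y (k + 1)) (x : Π₀ k, X k) (k : ℤ) :
    ((sumShift p).hom x : Π₀ k, Y k) (k + 1) = (p k).hom (x k) := by
  induction x using DFinsupp.induction with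
  | h0 => rw [map_zero, DFinsupp.zero_apply, DFinsupp.zero_apply, map_zero]
  | ha j y x _ _ ih =>
    rw [map_add, DFinsupp.add_apply, DFinsupp.add_apply, map_add, ih, sumShift_single]
    congr 1
    by_cases hjk : j = k
    · subst hjk
      rw [DFinsupp.single_eq_same, DFinsupp.single_eq_same]
    · rw [DFinsupp.single_eq_of_ne (by lia), DFinsupp.single_eq_of_ne (by lia), map_zero]

lemma ses_sumShift {W P : ℤ → ModuleCat.{u} R} {i : ∀ k, W k ⟶ P k} {p : ∀ k, P k ⟶ W (k + 1)}
    (h : ∀ k, SES (i k) (p k)) :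
    SES (ModuleCat.ofHom (DFinsupp.mapRange.linearMap fun k ↦ (i k).hom) : sumMod W ⟶ sumMod P)
      (sumShift p) where
  inj x y hxy := by
    ext k
    exact (h k).inj congr($hxy k)
  exact x := by
    classical
    constructor
    · intro hx
      have hk (k : ℤ) : ∃ w, (i k).hom w = x k := by
        refine ((h k).exact (x k)).1 ?_
        rw [← sumShift_apply, hx]
        rfl
      choose w hw using hk
      refine ⟨∑ k ∈ x.support, DFinsupp.single k (w k), ?_⟩
      change DFinsupp.mapRange.linearMap (fun k ↦ (i k).hom) _ = x
      rw [map_sum]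
      refine Eq.trans (Finset.sum_congr rfl fun k _ ↦ ?_) (DFinsupp.sum_single (f := x))
      rw [DFinsupp.mapRange.linearMap_apply, DFinsupp.mapRange_single, hw]
    · rintro ⟨w, rfl⟩
      ext k
      obtain ⟨k, rfl⟩ : ∃ j, k = j + 1 := ⟨k - 1, by lia⟩
      rw [sumShift_apply]
      exact (h k).exact.apply_apply_eq_zero (w k)
  surj w := by
    induction w using DFinsupp.induction with
    | h0 => exact ⟨0, map_zero _⟩
    | ha j y x _ _ ih =>
      obtain ⟨z, rfl⟩ := ih
      obtain ⟨k, rfl⟩ : ∃ k, j = k + 1 := ⟨j - 1, by lia⟩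
      obtain ⟨v, rfl⟩ := (h k).surj y
      exact ⟨DFinsupp.single k v + z, by rw [map_add, sumShift_single]⟩

lemma projective_sumMod (h : ∀ k, Projective (X k)) : Projective (sumMod X) := by
  have (k : ℤ) : Module.Projective R (X k) := (IsProjective.iff_projective _).2 (h k)
  exact (IsProjective.iff_projective _).1 (inferInstanceAs (Module.Projective R (Π₀ k, X k)))

end DirectSum

variable [StarRing R] {n : ℕ}

/-- The case of a single short exact sequence `0 → W → F → W → 0` with `F` free. The composition
`F → W → F` is a matrix of square zero; it is exact after tensoring because `Tor` of `W` is periodic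
and vanishes in high degrees. -/
lemma SfliLE.ext_of_periodic_free (hR : SfliLE R n) {W F : ModuleCat.{u} R} {i : W ⟶ F} {p : F ⟶ W}
    (h : SES i p) (hF : Module.Free R F) {Q : ModuleCat.{u} R} (hQ : FdLE Q n) :
    ExtVanish W Q 1 := by
  let C : Type u := Module.Free.ChooseBasisIndex R F
  let β : F ≃ₗ[R] (C →₀ R) := (Module.Free.chooseBasis R F).repr
  have : Projective F := ModuleCat.projective_of_free (Module.Free.chooseBasis R F)
  let D : (C →₀ R) →ₗ[R] (C →₀ R) := β.toLinearMap ∘ₗ i.hom ∘ₗ p.hom ∘ₗ β.symm.toLinearMap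
  let d (c : C) : C →₀ R := D (Finsupp.single c 1)
  have hD : Finsupp.linearCombination R d = D := by
    ext c : 2
    simp [d]
  have hpi (w : W) : p.hom (i.hom w) = 0 := h.exact.apply_apply_eq_zero w
  have hDD (x : C →₀ R) : D (D x) = 0 := by simp [D, hpi]
  have hex : TensExact n d ∅ := by
    intro Y hY z hz
    have hW : ExtVanish W (ch Y) 1 :=
      h.ext_of_periodic (m := n) (idLE_vanish hY _ (Nat.lt_succ_self n))
    obtain ⟨w, hw⟩ := tens_exact_of_exists_factor d d (fun φ hφ ↦ by
      rw [hD] at hφ ⊢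
      obtain ⟨ψ, hψ⟩ := h.desc (ModuleCat.ofHom (φ ∘ₗ β.toLinearMap) : F ⟶ ch Y) (by
        ext w : 2
        obtain ⟨x, rfl⟩ := h.surj w
        have := LinearMap.congr_fun hφ (β x)
        simpa [D] using this)
      obtain ⟨ψ', hψ'⟩ := h.extend hW ψ
      refine ⟨ψ'.hom ∘ₗ β.symm.toLinearMap, LinearMap.ext fun x ↦ ?_⟩
      have h1 : ψ'.hom (i.hom (p.hom (β.symm x))) = ψ.hom (p.hom (β.symm x)) := congr($hψ' _)
      have h2 : ψ.hom (p.hom (β.symm x)) = φ (β (β.symm x)) := congr($hψ _)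
      simp only [D, LinearMap.comp_apply, LinearEquiv.coe_coe, LinearEquiv.symm_apply_apply]
      rw [h1, h2, LinearEquiv.apply_symm_apply]) z (Finsupp.ext fun b ↦ hz b (Set.notMem_empty b))
    exact ⟨w, fun b _ ↦ by rw [hw]⟩
  refine h.ext_one (extVanish_of_projective _ _ _) fun φ ↦ ?_
  have hf : Finsupp.linearCombination R (fun c ↦ φ.hom (p.hom (β.symm (Finsupp.single c 1))))
      = φ.hom ∘ₗ p.hom ∘ₗ β.symm.toLinearMap := by
    ext c
    simp
  obtain ⟨g, hg⟩ := hR.exists_solution d (fun c ↦ by rw [hD]; exact hDD _) hex hQ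
    (fun c ↦ φ.hom (p.hom (β.symm (Finsupp.single c 1)))) (fun c ↦ by
      rw [hf]
      simp [d, D, hpi])
  refine ⟨ModuleCat.ofHom (Finsupp.linearCombination R g ∘ₗ β.toLinearMap), ?_⟩
  have : (Finsupp.linearCombination R g) ∘ₗ D = φ.hom ∘ₗ p.hom ∘ₗ β.symm.toLinearMap := by
    ext c
    exact hg c
  ext w
  obtain ⟨x, rfl⟩ := h.surj w
  have := LinearMap.congr_fun this (β x)
  simpa [D] using this

/-- The syzygies in an unbounded exact sequence of projective modules over a ring with finite `sfli`
are orthogonal to the modules of finite flat dimension: the direct sum of all the sequences is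
periodic, and its middle term becomes free by the Eilenberg swindle. -/
theorem SfliLE.ext_one_of_unbounded (hR : SfliLE R n) {W P : ℤ → ModuleCat.{u} R}
    {i : ∀ k, W k ⟶ P k} {p : ∀ k, P k ⟶ W (k + 1)} (h : ∀ k, SES (i k) (p k))
    (hP : ∀ k, Projective (P k)) {Q : ModuleCat.{u} R} (hQ : FdLE Q n) (k : ℤ) :
    ExtVanish (W k) Q 1 := by
  have := projective_sumMod hP
  have : Module.Projective R (sumMod P) := (IsProjective.iff_projective _).2 this
  obtain ⟨S, hS⟩ := exists_free_prod (R := R) (sumMod P)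
  let L : ModuleCat.{u} R := ModuleCat.of R (S →₀ R)
  have hfree : Module.Free R (prodMod (sumMod P) (prodMod L L)) :=
    Module.Free.of_equiv (LinearEquiv.prodAssoc R (sumMod P) L L)
  exact ((hR.ext_of_periodic_free ((ses_sumShift h).prod (ses_prod L L)) hfree hQ).retract_left
    (prodRetract _ _)).retract_left (sumRetract W k)

end Unbounded

/-! ### Finiteness of dimensions -/

section Finiteness

lemma lt_top_iff_exists_le {x : WithBot ℕ∞} : x < ⊤ ↔ ∃ n : ℕ, x ≤ n := by
  constructor
  · intro h
    induction x with
    | bot => exact ⟨0, bot_le⟩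
    | coe x =>
      have hx : x ≠ ⊤ := by
        rintro rfl
        exact absurd h (lt_irrefl _)
      lift x to ℕ using hx
      exact ⟨x, le_rfl⟩
  · rintro ⟨n, hn⟩
    refine hn.trans_lt ?_
    have : ((n : ℕ∞) : WithBot ℕ∞) < ((⊤ : ℕ∞) : WithBot ℕ∞) :=
      WithBot.coe_lt_coe.2 (ENat.natCast_lt_top n)
    exact this

variable {R : Type u} [Ring R]

lemma resolutionDim_lt_top_iff {𝒞 : ModuleCat.{u} R → Prop} {M : ModuleCat.{u} R} :
    resolutionDim 𝒞 M < ⊤ ↔ ∃ n, HasResolution 𝒞 n M := by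
  rw [resolutionDim, iInf_lt_iff]
  refine exists_congr fun n ↦ ?_
  rw [iInf_lt_iff]
  exact ⟨fun ⟨h, _⟩ ↦ h, fun h ↦ ⟨h, lt_top_iff_exists_le.2 ⟨n, le_rfl⟩⟩⟩

lemma coresolutionDim_lt_top_iff {𝒞 : ModuleCat.{u} R → Prop} {M : ModuleCat.{u} R} :
    coresolutionDim 𝒞 M < ⊤ ↔ ∃ n, HasCoresolution 𝒞 n M := by
  rw [coresolutionDim, iInf_lt_iff]
  refine exists_congr fun n ↦ ?_
  rw [iInf_lt_iff]
  exact ⟨fun ⟨h, _⟩ ↦ h, fun h ↦ ⟨h, lt_top_iff_exists_le.2 ⟨n, le_rfl⟩⟩⟩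

lemma exists_hasResolution_of_le {𝒞 : ModuleCat.{u} R → Prop} {M : ModuleCat.{u} R} {n : ℕ}
    (h : resolutionDim 𝒞 M ≤ n) : ∃ m ≤ n, HasResolution 𝒞 m M := by
  by_contra! hcon
  have : ((n + 1 : ℕ) : WithBot ℕ∞) ≤ resolutionDim 𝒞 M := by
    refine le_iInf₂ fun m hm ↦ ?_
    have : n + 1 ≤ m := by
      by_contra h'
      exact hcon m (by lia) hm
    exact_mod_cast this
  have h2 : ((n + 1 : ℕ) : WithBot ℕ∞) ≤ (n : WithBot ℕ∞) := this.trans h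
  have h3 : n + 1 ≤ n := by exact_mod_cast h2
  lia

lemma pd_lt_top_iff {M : ModuleCat.{u} R} : pd R M < ⊤ ↔ ∃ n, HasProjectiveDimensionLE M n := by
  rw [lt_top_iff_exists_le]
  exact exists_congr fun n ↦ projectiveDimension_le_iff M n

lemma spli_lt_top_iff : spli R < ⊤ ↔
    ∃ n, ∀ I : ModuleCat.{u} R, Injective I → HasProjectiveDimensionLE I n := by
  rw [lt_top_iff_exists_le]
  refine exists_congr fun n ↦ ?_
  rw [spli, iSup₂_le_iff]
  exact forall₂_congr fun I _ ↦ projectiveDimension_le_iff I n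

end Finiteness

/-! ### Balanced tensor products and character modules -/

section Balanced

variable {R : Type u} [Ring R]

section
variable {N M : Type u} [AddCommGroup N] [Module Rᵐᵒᵖ N] [AddCommGroup M] [Module R M]

/-- The class of `n ⊗ m` in the balanced tensor product. -/
def balMk (n : N) (m : M) : BalTensor R N M := QuotientAddGroup.mk (TensorProduct.tmul ℤ n m)

lemma balMk_smul (n : N) (r : R) (m : M) :
    balMk (R := R) (MulOpposite.op r • n) m = balMk n (r • m) := by
  rw [balMk, balMk, QuotientAddGroup.eq, neg_add_eq_sub, ← neg_sub]
  exact neg_mem (AddSubgroup.subset_closure ⟨n, r, m, rfl⟩)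

lemma balMk_add_left (n n' : N) (m : M) :
    balMk (R := R) (n + n') m = balMk n m + balMk n' m := by
  rw [balMk, TensorProduct.add_tmul]; rfl

lemma balMk_add_right (n : N) (m m' : M) :
    balMk (R := R) n (m + m') = balMk n m + balMk n m' := by
  rw [balMk, TensorProduct.tmul_add]; rfl

lemma balTensor_hom_ext {G : Type*} [AddCommGroup G] {c c' : BalTensor R N M →+ G}
    (h : ∀ n m, c (balMk n m) = c' (balMk n m)) : c = c' := by
  refine QuotientAddGroup.addMonoidHom_ext _ ?_
  ext t
  induction t using TensorProduct.induction_on with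
  | zero => rw [map_zero, map_zero]
  | tmul n m => exact h n m
  | add x y hx hy => rw [map_add, map_add, hx, hy]

/-- The character of the balanced tensor product given by a balanced pairing. -/
def balLift (b : N →+ M →+ AddCircle (1 : ℚ))
    (hb : ∀ n (r : R) m, b (MulOpposite.op r • n) m = b n (r • m)) :
    BalTensor R N M →+ AddCircle (1 : ℚ) :=
  QuotientAddGroup.lift _ (TensorProduct.liftAddHom b (fun k n m ↦ by
    rw [map_zsmul, map_zsmul, AddMonoidHom.smul_apply])) (by
    rw [balancedRel, AddSubgroup.closure_le]
    rintro _ ⟨n, r, m, rfl⟩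
    change _ = _
    rw [map_sub, TensorProduct.liftAddHom_tmul, TensorProduct.liftAddHom_tmul, hb, sub_self])

end

variable [StarRing R]

/-- A right module as a left module, by means of the involution. -/
abbrev toLeft (N : ModuleCat.{u} Rᵐᵒᵖ) : ModuleCat.{u} R :=
  (ModuleCat.restrictScalars (starRingEquiv (R := R)).toRingHom).obj N

/-- A left module as a right module, by means of the involution. -/
abbrev toRight (X : ModuleCat.{u} R) : ModuleCat.{u} Rᵐᵒᵖ :=
  (ModuleCat.restrictScalars (starRingEquiv (R := R)).symm.toRingHom).obj X

/-- The identity of a right module, as a map to the associated left module. -/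
def lft (N : ModuleCat.{u} Rᵐᵒᵖ) : N ≃+ toLeft N := AddEquiv.refl N

/-- The identity of a left module, as a map to the associated right module. -/
def rgt (X : ModuleCat.{u} R) : X ≃+ toRight X := AddEquiv.refl X

lemma smul_lft (N : ModuleCat.{u} Rᵐᵒᵖ) (r : R) (n : N) :
    r • lft N n = lft N (MulOpposite.op (star r) • n) := rfl

lemma smul_rgt (X : ModuleCat.{u} R) (r : R) (x : X) :
    MulOpposite.op r • rgt X x = rgt X (star r • x) := rfl

/-- Maps from a right module to a character module are balanced pairings. -/
def charOfLeft {N : ModuleCat.{u} Rᵐᵒᵖ} {M : ModuleCat.{u} R} (φ : M ⟶ ch (toLeft N)) :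
    BalTensor R N M →+ AddCircle (1 : ℚ) :=
  balLift
    { toFun n :=
        { toFun m := (φ.hom m : Ch (toLeft N)) (lft N n)
          map_zero' := by rw [map_zero]; rfl
          map_add' x y := by rw [map_add]; rfl }
      map_zero' := by
        ext m
        exact map_zero (φ.hom m : Ch (toLeft N))
      map_add' x y := by
        ext m
        exact map_add (φ.hom m : Ch (toLeft N)) _ _ }
    (by
      intro n r m
      change (φ.hom m : Ch (toLeft N)) (lft N _) = (φ.hom (r • m) : Ch (toLeft N)) (lft N n)
      rw [φ.hom.map_smul, Ch.smul_apply, smul_lft, star_star])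

/-- The map to a character module given by a character of the balanced tensor product. -/
def leftOfChar {N : ModuleCat.{u} Rᵐᵒᵖ} {M : ModuleCat.{u} R}
    (c : BalTensor R N M →+ AddCircle (1 : ℚ)) : M ⟶ ch (toLeft N) :=
  ModuleCat.ofHom
    { toFun m := (AddMonoidHom.mk' (fun n ↦ c (balMk ((lft N).symm n) m)) fun x y ↦ by
        rw [map_add, balMk_add_left, map_add] : toLeft N →+ AddCircle (1 : ℚ))
      map_add' x y := by
        refine Ch.ext (M := toLeft N) fun n ↦ ?_
        exact (congrArg c (balMk_add_right _ x y)).trans (map_add c _ _)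
      map_smul' r x := by
        refine Ch.ext (M := toLeft N) fun n ↦ ?_
        obtain ⟨n, rfl⟩ := (lft N).surjective n
        change c (balMk n (r • x)) = c (balMk ((lft N).symm (star r • lft N n)) x)
        rw [smul_lft, star_star, AddEquiv.symm_apply_apply, balMk_smul] }

lemma charOfLeft_leftOfChar {N : ModuleCat.{u} Rᵐᵒᵖ} {M : ModuleCat.{u} R}
    (c : BalTensor R N M →+ AddCircle (1 : ℚ)) : charOfLeft (leftOfChar c) = c :=
  balTensor_hom_ext fun _ _ ↦ rfl

lemma leftOfChar_charOfLeft {N : ModuleCat.{u} Rᵐᵒᵖ} {M : ModuleCat.{u} R}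
    (φ : M ⟶ ch (toLeft N)) : leftOfChar (charOfLeft φ) = φ := rfl

lemma eq_zero_of_forall_char {A : Type u} [AddCommGroup A] {a : A}
    (h : ∀ c : A →+ AddCircle (1 : ℚ), c a = 0) : a = 0 :=
  CharacterModule.eq_zero_of_character_apply h

/-- Lambek's criterion: a module is flat if and only if its character module is injective. -/
lemma isFlat_iff (M : ModuleCat.{u} R) : IsFlat M ↔ Injective (ch M) := by
  constructor
  · intro hM
    refine ⟨fun {X Y} g f hf ↦ ?_⟩
    have hinj : Function.Injective f.hom := (ModuleCat.mono_iff_injective f).1 hf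
    let f' : toRight X ⟶ toRight Y := (ModuleCat.restrictScalars _).map f
    let g' : BalTensor R (toRight X) M →+ AddCircle (1 : ℚ) := balLift
      { toFun x := AddMonoidHomClass.toAddMonoidHom (g.hom ((rgt X).symm x) : Ch M)
        map_zero' := by
          rw [map_zero, map_zero]; rfl
        map_add' x y := by
          rw [map_add, map_add]; rfl }
      (by
        intro x r m
        obtain ⟨x, rfl⟩ := (rgt X).surjective x
        rw [smul_rgt]
        change (g.hom (star r • x) : Ch M) m = (g.hom x : Ch M) (r • m)
        rw [g.hom.map_smul, Ch.smul_apply, star_star])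
    obtain ⟨c, hc⟩ := exists_extend_char _ (hM (toRight X) (toRight Y) f' hinj) g'
    refine ⟨ModuleCat.ofHom
      { toFun y := (AddMonoidHom.mk' (fun m : M ↦ c (balMk (rgt Y y) m)) fun a b ↦ by
          rw [balMk_add_right, map_add] : M →+ AddCircle (1 : ℚ))
        map_add' x y := by
          refine Ch.ext (M := M) fun m ↦ ?_
          exact (congrArg c (balMk_add_left (rgt Y x) (rgt Y y) m)).trans (map_add c _ _)
        map_smul' r x := by
          refine Ch.ext (M := M) fun m ↦ ?_
          change c (balMk (rgt Y (r • x)) m) = c (balMk (rgt Y x) (star r • m))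
          rw [← balMk_smul, smul_rgt, star_star] }, ?_⟩
    ext x m
    exact congr($hc (balMk (rgt X x) m))
  · intro hM N N' f hf
    rw [injective_iff_map_eq_zero]
    intro t ht
    refine eq_zero_of_forall_char fun c ↦ ?_
    let f' : toLeft N ⟶ toLeft N' := (ModuleCat.restrictScalars _).map f
    have : Mono f' := (ModuleCat.mono_iff_injective f').2 hf
    let ψ := swap (Injective.factorThru (swap (leftOfChar c)) f')
    have hψ : c = (charOfLeft ψ).comp (BalTensor.rTensor (R := R) M f.hom) := by
      refine balTensor_hom_ext fun n m ↦ ?_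
      have := Injective.comp_factorThru (swap (leftOfChar c)) f'
      have := congrArg (fun φ : Ch M ↦ φ m) congr($this (lft N n))
      exact this.symm
    rw [hψ, AddMonoidHom.comp_apply, ht, map_zero]

/-- Exactness after tensoring with a right module, in terms of maps to its character module. -/
lemma exact_lTensor_iff (N : ModuleCat.{u} Rᵐᵒᵖ) {X Y Z : ModuleCat.{u} R} (f : X ⟶ Y) (g : Y ⟶ Z)
    (hfg : f ≫ g = 0) :
    Function.Exact (BalTensor.lTensor (R := R) N f.hom) (BalTensor.lTensor (R := R) N g.hom) ↔
      ∀ φ : Y ⟶ ch (toLeft N), f ≫ φ = 0 → ∃ ψ : Z ⟶ ch (toLeft N), g ≫ ψ = φ := by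
  have hcomp {X Y : ModuleCat.{u} R} (f : X ⟶ Y) (φ : Y ⟶ ch (toLeft N)) :
      (charOfLeft φ).comp (BalTensor.lTensor (R := R) N f.hom) = charOfLeft (f ≫ φ) :=
    balTensor_hom_ext fun _ _ ↦ rfl
  have hzero {X : ModuleCat.{u} R} : charOfLeft (0 : X ⟶ ch (toLeft N)) = 0 :=
    balTensor_hom_ext fun _ _ ↦ rfl
  constructor
  · intro h φ hφ
    have hk : (BalTensor.lTensor (R := R) N g.hom).ker ≤ (charOfLeft φ).ker := by
      intro t ht
      obtain ⟨s, rfl⟩ := (h t).1 ht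
      change ((charOfLeft φ).comp (BalTensor.lTensor (R := R) N f.hom)) s = 0
      rw [hcomp, hφ, hzero]
      rfl
    obtain ⟨χ, hχ⟩ := exists_extend_char (QuotientAddGroup.kerLift (BalTensor.lTensor N g.hom))
      (QuotientAddGroup.kerLift_injective _) (QuotientAddGroup.lift _ (charOfLeft φ) hk)
    refine ⟨leftOfChar χ, ?_⟩
    have h1 : charOfLeft (g ≫ leftOfChar χ) = charOfLeft φ := by
      rw [← hcomp, charOfLeft_leftOfChar]
      ext t
      exact congr($hχ (QuotientAddGroup.mk t))
    rw [← leftOfChar_charOfLeft (g ≫ leftOfChar χ), h1, leftOfChar_charOfLeft]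
  · intro h t
    constructor
    · intro ht
      by_contra hcon
      obtain ⟨c, hc, hct⟩ := exists_char_separating
        (BalTensor.lTensor (R := R) N f.hom).range (a := t) hcon
      obtain ⟨ψ, hψ⟩ := h (leftOfChar c) (by
        ext x n
        exact hc _ ⟨balMk ((lft N).symm n) x, rfl⟩)
      apply hct
      rw [← charOfLeft_leftOfChar c, ← hψ, ← hcomp, AddMonoidHom.comp_apply, ht, map_zero]
    · rintro ⟨s, rfl⟩
      have : (BalTensor.lTensor (R := R) N g.hom).comp (BalTensor.lTensor (R := R) N f.hom) = 0 := by
        refine balTensor_hom_ext fun n x ↦ ?_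
        change balMk n (g.hom (f.hom x)) = 0
        have : g.hom (f.hom x) = 0 := congr($hfg x)
        rw [this, balMk, TensorProduct.tmul_zero]
        rfl
      exact congr($this s)

lemma injective_toLeft {I : ModuleCat.{u} Rᵐᵒᵖ} (h : Injective I) : Injective (toLeft I) :=
  (ModuleCat.restrictScalarsEquivalenceOfRingEquiv (starRingEquiv (R := R))).map_injective_iff I
    |>.2 h

lemma injective_toRight {I : ModuleCat.{u} R} (h : Injective I) : Injective (toRight I) :=
  (ModuleCat.restrictScalarsEquivalenceOfRingEquiv (starRingEquiv (R := R)).symm).map_injective_iff I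
    |>.2 h

/-- Turning a left module into a right module and back does not change it. -/
def toLeftToRight (X : ModuleCat.{u} R) : toLeft (toRight X) ≅ X :=
  (((rgt X).trans (lft (toRight X))).symm.toLinearEquiv fun r x ↦ by
    obtain ⟨x, rfl⟩ := ((rgt X).trans (lft (toRight X))).surjective x
    rw [AddEquiv.symm_apply_apply, AddEquiv.symm_apply_eq]
    refine (smul_lft (toRight X) r (rgt X x)).trans ?_
    rw [smul_rgt, star_star]
    rfl).toModuleIso

lemma hasResolution_isFlat_iff {n : ℕ} {M : ModuleCat.{u} R} :
    HasResolution IsFlat n M ↔ FdLE M n := by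
  induction n generalizing M with
  | zero => exact (isFlat_iff M).trans idLE_zero_iff.symm
  | succ n ih =>
    constructor
    · rintro ⟨K, C, i, p, hC, hi, he, hp, hK⟩
      have e : SES i p := ⟨hi, he, hp⟩
      exact e.ch.idLE₁ (ih.1 hK) (idLE_of_injective ((isFlat_iff C).1 hC) _)
    · intro hM
      have e := ses_syz M
      refine ⟨_, _, _, _, (isFlat_iff _).2 (injective_ch_of_projective _), e.inj, e.exact, e.surj,
        ih.2 ?_⟩
      exact e.ch.idLE₃' hM (idLE_of_injective (injective_ch_of_projective _) _)

lemma fd_lt_top_iff {M : ModuleCat.{u} R} : fd R M < ⊤ ↔ ∃ n, FdLE M n := by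
  rw [fd, resolutionDim_lt_top_iff]
  exact exists_congr fun n ↦ hasResolution_isFlat_iff

lemma FdLE.mono {M : ModuleCat.{u} R} {m n : ℕ} (hmn : m ≤ n) (h : FdLE M m) : FdLE M n :=
  idLE_mono hmn h

lemma exists_sfliLE_of_sfli_lt_top (h : sfli R < ⊤) : ∃ n, SfliLE R n := by
  obtain ⟨n, hn⟩ := lt_top_iff_exists_le.1 h
  refine ⟨n, fun I hI ↦ ?_⟩
  obtain ⟨m, hm, hI'⟩ := exists_hasResolution_of_le ((iSup₂_le_iff.1 hn) I hI)
  exact (hasResolution_isFlat_iff.1 hI').mono hm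

lemma SES.fdLE₃ {X Y Z : ModuleCat.{u} R} {f : X ⟶ Y} {g : Y ⟶ Z} (h : SES f g) {n : ℕ}
    (h₁ : FdLE X n) (h₂ : FdLE Y (n + 1)) : FdLE Z (n + 1) :=
  h.ch.idLE₁ h₁ h₂

lemma FdLE.of_pdLE {M : ModuleCat.{u} R} {n : ℕ} (h : HasProjectiveDimensionLE M n) : FdLE M n := by
  induction n generalizing M with
  | zero =>
    have := pdLE_zero_iff.1 h
    exact .of_projective _ _
  | succ n ih =>
    refine (ses_syz M).fdLE₃ (ih ?_) (.of_projective _ _)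
    exact (ses_syz M).shortExact.hasProjectiveDimensionLT_X₁ (n + 1)
      (hasProjectiveDimensionLT_of_ge _ 1 _ (by lia)) h

end Balanced

/-! ### Acyclic complexes and unbounded sequences of short exact sequences -/

section Complexes

variable {R : Type u} [Ring R]

lemma function_exact_of_acyclic {P : CochainComplex (ModuleCat.{u} R) ℤ} (h : P.Acyclic)
    {i j k : ℤ} (hij : i + 1 = j) (hjk : j + 1 = k) :
    Function.Exact (P.d i j).hom (P.d j k).hom := by
  have := h j
  rw [HomologicalComplex.exactAt_iff' P i j k (by simp [← hij]) (by simp [hjk])] at this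
  exact (ShortComplex.ShortExact.moduleCat_exact_iff_function_exact _).1 this

lemma ses_cycles {P : CochainComplex (ModuleCat.{u} R) ℤ} (h : P.Acyclic) {i j : ℤ}
    (hij : i + 1 = j) : SES (P.iCycles i) (P.toCycles i j) := by
  have hinj (k : ℤ) : Function.Injective (P.iCycles k).hom :=
    (ModuleCat.mono_iff_injective _).1 inferInstance
  have hto (y : P.X i) : (P.iCycles j).hom ((P.toCycles i j).hom y) = (P.d i j).hom y :=
    congr($(P.toCycles_i i j) y)
  refine ⟨hinj i, fun y ↦ ⟨fun hy ↦ ?_, ?_⟩, fun z ↦ ?_⟩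
  · have hy' : (P.d i j).hom y = 0 := by rw [← hto, hy, map_zero]
    let φ : ModuleCat.of R (LinearMap.ker (P.d i j).hom) ⟶ P.X i :=
      ModuleCat.ofHom (LinearMap.ker (P.d i j).hom).subtype
    refine ⟨(P.liftCycles φ j (by simp [hij]) (by ext x; exact x.2)).hom ⟨y, hy'⟩, ?_⟩
    exact congr($(P.liftCycles_i φ j (by simp [hij]) (by ext x; exact x.2)) ⟨y, hy'⟩)
  · rintro ⟨z, rfl⟩
    apply hinj j
    rw [hto, map_zero]
    exact congr($(P.iCycles_d i j) z)
  · have hz : (P.d j (j + 1)).hom ((P.iCycles j).hom z) = 0 := congr($(P.iCycles_d j (j + 1)) z)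
    obtain ⟨y, hy⟩ := (function_exact_of_acyclic h hij rfl _).1 hz
    exact ⟨y, hinj j (by rw [hto, hy])⟩

/-- Submodules of the same module with the same underlying set are isomorphic. -/
lemma nonempty_iso_of_range_eq {X X' Y : ModuleCat.{u} R} {f : X ⟶ Y} {f' : X' ⟶ Y}
    (hf : Function.Injective f.hom) (hf' : Function.Injective f'.hom)
    (h : LinearMap.range f.hom = LinearMap.range f'.hom) : Nonempty (X ≅ X') :=
  ⟨((LinearEquiv.ofInjective _ hf).trans ((LinearEquiv.ofEq _ _ h).trans
    (LinearEquiv.ofInjective _ hf').symm)).toModuleIso⟩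

section
variable {W P : ℤ → ModuleCat.{u} R} {i : ∀ k, W k ⟶ P k} {p : ∀ k, P k ⟶ W (k + 1)}

/-- The complex obtained by splicing short exact sequences `0 → W k → P k → W (k + 1) → 0`. -/
def splice (h : ∀ k, SES (i k) (p k)) : CochainComplex (ModuleCat.{u} R) ℤ :=
  CochainComplex.of P (fun k ↦ p k ≫ i (k + 1)) fun k ↦ by
    rw [Category.assoc, ← Category.assoc (i (k + 1)), (h (k + 1)).comp_zero]
    simp

lemma splice_d (h : ∀ k, SES (i k) (p k)) (k : ℤ) :
    (splice h).d k (k + 1) = p k ≫ i (k + 1) :=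
  CochainComplex.of_d P (fun k ↦ p k ≫ i (k + 1)) k

lemma splice_acyclic (h : ∀ k, SES (i k) (p k)) : (splice h).Acyclic := by
  intro k
  obtain ⟨j, rfl⟩ : ∃ j, k = j + 1 := ⟨k - 1, by lia⟩
  rw [HomologicalComplex.exactAt_iff' _ j (j + 1) (j + 1 + 1) (by simp) (by simp)]
  refine (ShortComplex.ShortExact.moduleCat_exact_iff_function_exact _).2 ?_
  change Function.Exact ((splice h).d j (j + 1)).hom ((splice h).d (j + 1) (j + 1 + 1)).hom
  rw [splice_d, splice_d]
  intro y
  constructor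
  · intro hy
    obtain ⟨w, rfl⟩ := ((h (j + 1)).exact y).1 ((h (j + 1 + 1)).inj (hy.trans (map_zero _).symm))
    obtain ⟨x, rfl⟩ := (h j).surj w
    exact ⟨x, rfl⟩
  · rintro ⟨x, rfl⟩
    have := (h (j + 1)).exact.apply_apply_eq_zero ((p j).hom x)
    exact (congrArg (i (j + 1 + 1)).hom this).trans (map_zero _)

lemma nonempty_iso_splice_cycles (h : ∀ k, SES (i k) (p k)) :
    Nonempty (W 0 ≅ (splice h).cycles 0) := by
  have e := ses_cycles (splice_acyclic h) (zero_add 1)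
  refine nonempty_iso_of_range_eq (h 0).inj e.inj ?_
  refine (LinearMap.exact_iff.1 (h 0).exact).symm.trans
    (Eq.trans ?_ (LinearMap.exact_iff.1 e.exact))
  have hd : (splice h).toCycles 0 1 ≫ (splice h).iCycles 1 = p 0 ≫ i (0 + 1) :=
    ((splice h).toCycles_i 0 1).trans (splice_d h 0)
  have hinj : Function.Injective ((splice h).iCycles 1).hom :=
    (ModuleCat.mono_iff_injective _).1 inferInstance
  ext y
  have hy := congr($hd y)
  constructor
  · intro hy0
    apply hinj
    refine hy.trans ?_
    rw [map_zero]
    exact (congrArg (i (0 + 1)).hom hy0).trans (map_zero _)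
  · intro hy0
    apply (h (0 + 1)).inj
    refine hy.symm.trans ?_
    rw [map_zero]
    exact (congrArg ((splice h).iCycles 1).hom hy0).trans (map_zero _)

end

/-- Exactness of `Hom(-, N)` on three consecutive terms of a spliced complex. -/
lemma hom_exact_iff {P₀ W₁ P₁ W₂ P₂ W₃ N : ModuleCat.{u} R} {a : P₀ ⟶ W₁}
    {i₁ : W₁ ⟶ P₁} {p₁ : P₁ ⟶ W₂} {i₂ : W₂ ⟶ P₂} {p₂ : P₂ ⟶ W₃}
    (ha : Function.Surjective a.hom) (h₁ : SES i₁ p₁) (h₂ : SES i₂ p₂) (hN : ExtVanish P₂ N 1) :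
    Function.Exact (fun f : P₂ ⟶ N ↦ (p₁ ≫ i₂) ≫ f) (fun f : P₁ ⟶ N ↦ (a ≫ i₁) ≫ f) ↔
      ExtVanish W₃ N 1 := by
  have := (ModuleCat.epi_iff_surjective a).2 ha
  have := (ModuleCat.epi_iff_surjective p₁).2 h₁.surj
  constructor
  · intro h
    refine h₂.ext_one hN fun φ ↦ ?_
    obtain ⟨ψ, hψ⟩ := (h (p₁ ≫ φ)).1 (by
      simp only [Category.assoc]
      rw [← Category.assoc i₁, h₁.comp_zero]
      simp)
    refine ⟨ψ, ?_⟩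
    rw [← cancel_epi p₁]
    exact (Category.assoc _ _ _).symm.trans hψ
  · intro h f
    constructor
    · intro hf
      have hf' : i₁ ≫ f = 0 := by
        rw [← cancel_epi a, ← Category.assoc]
        simpa using hf
      obtain ⟨g, rfl⟩ := h₁.desc f hf'
      obtain ⟨ψ, rfl⟩ := h₂.extend h g
      exact ⟨ψ, by simp⟩
    · rintro ⟨ψ, rfl⟩
      simp only [Category.assoc]
      rw [← Category.assoc i₁, h₁.comp_zero]
      simp

/-- Exactness of `Hom(I, -)` on three consecutive terms of a spliced complex. -/
lemma hom_exact_iff' {W₀ P₀ W₁ P₁ W₂ P₂ I : ModuleCat.{u} R} {i₀ : W₀ ⟶ P₀} {p₀ : P₀ ⟶ W₁}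
    {i₁ : W₁ ⟶ P₁} {p₁ : P₁ ⟶ W₂} {i₂ : W₂ ⟶ P₂} (h₀ : SES i₀ p₀) (h₁ : SES i₁ p₁)
    (hi : Function.Injective i₂.hom) (hI : ExtVanish I P₀ 1) :
    Function.Exact (fun f : I ⟶ P₀ ↦ f ≫ (p₀ ≫ i₁)) (fun f : I ⟶ P₁ ↦ f ≫ (p₁ ≫ i₂)) ↔
      ExtVanish I W₀ 1 := by
  have := (ModuleCat.mono_iff_injective i₂).2 hi
  have := (ModuleCat.mono_iff_injective i₁).2 h₁.inj
  constructor
  · intro h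
    refine h₀.coext_one hI fun φ ↦ ?_
    obtain ⟨ψ, hψ⟩ := (h (φ ≫ i₁)).1 (by
      simp only [Category.assoc]
      rw [← Category.assoc i₁, h₁.comp_zero]
      simp)
    refine ⟨ψ, ?_⟩
    rw [← cancel_mono i₁]
    exact (Category.assoc _ _ _).trans hψ
  · intro h f
    constructor
    · intro hf
      have hf' : f ≫ p₁ = 0 := by
        rw [← cancel_mono i₂, Category.assoc]
        simpa using hf
      obtain ⟨g, rfl⟩ := h₁.lift f hf'
      obtain ⟨ψ, rfl⟩ := h₀.colift h g
      exact ⟨ψ, by simp⟩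
    · rintro ⟨ψ, rfl⟩
      simp only [Category.assoc]
      rw [← Category.assoc i₁, h₁.comp_zero]
      simp

/-- Gorenstein projective modules in terms of unbounded sequences. -/
lemma isGorensteinProjective_iff {M : ModuleCat.{u} R} : IsGorensteinProjective M ↔
    ∃ (W P : ℤ → ModuleCat.{u} R) (i : ∀ k, W k ⟶ P k) (p : ∀ k, P k ⟶ W (k + 1)),
      (∀ k, SES (i k) (p k)) ∧ (∀ k, Projective (P k)) ∧
      (∀ Q : ModuleCat.{u} R, Projective Q → ∀ k, ExtVanish (W k) Q 1) ∧ Nonempty (M ≅ W 0) := by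
  constructor
  · rintro ⟨P, hac, hP, hex, hM⟩
    refine ⟨fun k ↦ P.cycles k, P.X, fun k ↦ P.iCycles k, fun k ↦ P.toCycles k (k + 1), fun k ↦ ses_cycles hac rfl, hP,
      fun Q hQ k ↦ ?_, hM⟩
    obtain ⟨n, rfl⟩ : ∃ n, k = n + 1 + 1 := ⟨k - 2, by lia⟩
    have := hP (n + 1)
    have h := hex Q hQ n
    simp_rw [← P.toCycles_i n (n + 1), ← P.toCycles_i (n - 1) n] at h
    exact (hom_exact_iff (ses_cycles hac (by lia)).surj (ses_cycles hac rfl) (ses_cycles hac rfl)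
      (extVanish_of_projective _ _ _)).1 h
  · rintro ⟨W, P, i, p, h, hP, hex, ⟨e⟩⟩
    refine ⟨splice h, splice_acyclic h, hP, fun Q hQ n ↦ ?_, ?_⟩
    · suffices H : ∀ j n l : ℤ, j + 1 = n → n + 1 = l →
          Function.Exact (fun f : (splice h).X l ⟶ Q => (splice h).d n l ≫ f)
            (fun f : (splice h).X n ⟶ Q => (splice h).d j n ≫ f) from H _ _ _ (by lia) rfl
      rintro j n l rfl rfl
      rw [splice_d, splice_d]
      have := hP (j + 1 + 1)
      exact (hom_exact_iff (h j).surj (h (j + 1)) (h (j + 1 + 1))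
        (extVanish_of_projective _ _ _)).2 (hex Q hQ _)
    · obtain ⟨e'⟩ := nonempty_iso_splice_cycles h
      exact ⟨e ≪≫ e'⟩

/-- Gorenstein injective modules in terms of unbounded sequences. -/
lemma isGorensteinInjective_iff {M : ModuleCat.{u} R} : IsGorensteinInjective M ↔
    ∃ (W P : ℤ → ModuleCat.{u} R) (i : ∀ k, W k ⟶ P k) (p : ∀ k, P k ⟶ W (k + 1)),
      (∀ k, SES (i k) (p k)) ∧ (∀ k, Injective (P k)) ∧
      (∀ I : ModuleCat.{u} R, Injective I → ∀ k, ExtVanish I (W k) 1) ∧ Nonempty (M ≅ W 0) := by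
  constructor
  · rintro ⟨P, hac, hP, hex, hM⟩
    refine ⟨fun k ↦ P.cycles k, P.X, fun k ↦ P.iCycles k, fun k ↦ P.toCycles k (k + 1), fun k ↦ ses_cycles hac rfl, hP,
      fun I hI k ↦ ?_, hM⟩
    have h (n : ℤ) : ExtVanish I (P.cycles (n - 1)) 1 := by
      have := hP (n - 1)
      have h := hex I hI n
      simp_rw [← P.toCycles_i n (n + 1), ← P.toCycles_i (n - 1) n] at h
      exact (hom_exact_iff' (ses_cycles hac (by lia)) (ses_cycles hac rfl)
        (ses_cycles hac rfl).inj (extVanish_of_injective _ _ _)).1 h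
    have := h (k + 1)
    rwa [add_sub_cancel_right] at this
  · rintro ⟨W, P, i, p, h, hP, hex, ⟨e⟩⟩
    refine ⟨splice h, splice_acyclic h, hP, fun I hI n ↦ ?_, ?_⟩
    · suffices H : ∀ j n l : ℤ, j + 1 = n → n + 1 = l →
          Function.Exact (fun f : I ⟶ (splice h).X j => f ≫ (splice h).d j n)
            (fun f : I ⟶ (splice h).X n => f ≫ (splice h).d n l) from H _ _ _ (by lia) rfl
      rintro j n l rfl rfl
      rw [splice_d, splice_d]
      have := hP j
      exact (hom_exact_iff' (h j) (h (j + 1)) (h (j + 1 + 1)).inj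
        (extVanish_of_injective _ _ _)).2 (hex I hI _)
    · obtain ⟨e'⟩ := nonempty_iso_splice_cycles h
      exact ⟨e ≪≫ e'⟩

section Flat
variable [StarRing R]

lemma extVanish_of_isFlat {F : ModuleCat.{u} R} (hF : IsFlat F) (N : ModuleCat.{u} R) (i : ℕ) :
    ExtVanish F (ch N) (i + 1) := by
  have := (isFlat_iff F).1 hF
  exact extVanish_ch_symm (extVanish_of_injective N (ch F) i)

lemma exact_lTensor_iff_hom (I : ModuleCat.{u} Rᵐᵒᵖ) {X Y Z : ModuleCat.{u} R} (f : X ⟶ Y)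
    (g : Y ⟶ Z) (hfg : f ≫ g = 0) :
    Function.Exact (BalTensor.lTensor (R := R) I f.hom) (BalTensor.lTensor (R := R) I g.hom) ↔
      Function.Exact (fun φ : Z ⟶ ch (toLeft I) ↦ g ≫ φ) (fun φ : Y ⟶ ch (toLeft I) ↦ f ≫ φ) := by
  rw [exact_lTensor_iff I f g hfg]
  refine ⟨fun h φ ↦ ⟨h φ, ?_⟩, fun h φ hφ ↦ (h φ).1 hφ⟩
  rintro ⟨ψ, rfl⟩
  change f ≫ g ≫ ψ = 0
  rw [← Category.assoc, hfg, Limits.zero_comp]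

/-- Gorenstein flat modules in terms of unbounded sequences. -/
lemma isGorensteinFlat_iff {M : ModuleCat.{u} R} : IsGorensteinFlat M ↔
    ∃ (W P : ℤ → ModuleCat.{u} R) (i : ∀ k, W k ⟶ P k) (p : ∀ k, P k ⟶ W (k + 1)),
      (∀ k, SES (i k) (p k)) ∧ (∀ k, IsFlat (P k)) ∧
      (∀ J : ModuleCat.{u} R, Injective J → ∀ k, ExtVanish (W k) (ch J) 1) ∧
      Nonempty (M ≅ W 0) := by
  constructor
  · rintro ⟨P, hac, hP, hex, hM⟩
    refine ⟨fun k ↦ P.cycles k, P.X, fun k ↦ P.iCycles k, fun k ↦ P.toCycles k (k + 1), fun k ↦ ses_cycles hac rfl, hP,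
      fun J hJ k ↦ ?_, hM⟩
    obtain ⟨n, rfl⟩ : ∃ n, k = n + 1 + 1 := ⟨k - 2, by lia⟩
    have h := (exact_lTensor_iff_hom _ _ _ (P.d_comp_d _ _ _)).1
      (hex (toRight J) (injective_toRight hJ) n)
    simp_rw [← P.toCycles_i n (n + 1), ← P.toCycles_i (n - 1) n] at h
    refine ((hom_exact_iff (ses_cycles hac (by lia)).surj (ses_cycles hac rfl) (ses_cycles hac rfl)
      (extVanish_of_isFlat (hP _) _ 0)).1 h).retract_right ?_
    exact chRetract (Retract.ofIso (toLeftToRight J).symm)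
  · rintro ⟨W, P, i, p, h, hP, hex, ⟨e⟩⟩
    refine ⟨splice h, splice_acyclic h, hP, fun I hI n ↦ ?_, ?_⟩
    · rw [exact_lTensor_iff_hom _ _ _ ((splice h).d_comp_d _ _ _)]
      suffices H : ∀ j n l : ℤ, j + 1 = n → n + 1 = l →
          Function.Exact (fun f : (splice h).X l ⟶ ch (toLeft I) => (splice h).d n l ≫ f)
            (fun f : (splice h).X n ⟶ ch (toLeft I) => (splice h).d j n ≫ f) from
        H _ _ _ (by lia) rfl
      rintro j n l rfl rfl
      rw [splice_d, splice_d]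
      exact (hom_exact_iff (h j).surj (h (j + 1)) (h (j + 1 + 1))
        (extVanish_of_isFlat (hP _) _ 0)).2 (hex _ (injective_toLeft hI) _)
    · obtain ⟨e'⟩ := nonempty_iso_splice_cycles h
      exact ⟨e ≪≫ e'⟩

end Flat

/-- Two one-sided sequences of short exact sequences combine to an unbounded one. -/
lemma exists_unbounded {𝒞 : ModuleCat.{u} R → Prop} (A B : ℕ → ModuleCat.{u} R) (h0 : A 0 = B 0)
    (hA : ∀ m, ∃ (P : ModuleCat.{u} R) (i : A m ⟶ P) (p : P ⟶ A (m + 1)), 𝒞 P ∧ SES i p)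
    (hB : ∀ m, ∃ (P : ModuleCat.{u} R) (i : B (m + 1) ⟶ P) (p : P ⟶ B m), 𝒞 P ∧ SES i p) :
    ∃ (W P : ℤ → ModuleCat.{u} R) (i : ∀ k, W k ⟶ P k) (p : ∀ k, P k ⟶ W (k + 1)),
      (∀ k, SES (i k) (p k)) ∧ (∀ k, 𝒞 (P k)) ∧ W 0 = A 0 ∧
      ∀ k, (∃ m, W k = A m) ∨ ∃ m, W k = B m := by
  let W : ℤ → ModuleCat.{u} R
    | Int.ofNat m => A m
    | Int.negSucc m => B (m + 1)
  have hstep (k : ℤ) : ∃ (P : ModuleCat.{u} R) (i : W k ⟶ P) (p : P ⟶ W (k + 1)), 𝒞 P ∧ SES i p := by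
    match k with
    | Int.ofNat m => exact hA m
    | Int.negSucc 0 =>
      have := hB 0
      rw [← h0] at this
      exact this
    | Int.negSucc (m + 1) => exact hB (m + 1)
  choose P i p hP hS using hstep
  refine ⟨W, P, i, p, hS, hP, rfl, fun k ↦ ?_⟩
  match k with
  | Int.ofNat m => exact Or.inl ⟨m, rfl⟩
  | Int.negSucc m => exact Or.inr ⟨m + 1, rfl⟩

end Complexes

/-! ### Horseshoe lemmas -/

section Horseshoe

variable {R : Type u} [Ring R]

lemma injective_prodMod {I J : ModuleCat.{u} R} (hI : Injective I) (hJ : Injective J) :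
    Injective (prodMod I J) :=
  idLE_zero_iff.1 ((ses_prod I J).idLE₂ (idLE_zero_iff.2 hI) (idLE_zero_iff.2 hJ))

lemma projective_prodMod {P Q : ModuleCat.{u} R} (hP : Projective P) (hQ : Projective Q) :
    Projective (prodMod P Q) := by
  have : Module.Projective R P := (IsProjective.iff_projective _).2 hP
  have : Module.Projective R Q := (IsProjective.iff_projective _).2 hQ
  exact (IsProjective.iff_projective _).1 (inferInstanceAs (Module.Projective R (P × Q)))

variable {X Y Z : ModuleCat.{u} R} {f : X ⟶ Y} {g : Y ⟶ Z}

lemma SES.horseshoe (h : SES f g) : ∃ (Y₁ P : ModuleCat.{u} R) (a : Y₁ ⟶ P) (b : P ⟶ Y),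
    Projective P ∧ SES a b ∧ ∃ (f₁ : syz X ⟶ Y₁) (g₁ : Y₁ ⟶ syz Z), SES f₁ g₁ := by
  have := (ModuleCat.epi_iff_surjective g).2 h.surj
  let l := Projective.factorThru (freeCoverMap Z) g
  have hl (z : freeCover Z) : g.hom (l.hom z) = (freeCoverMap Z).hom z :=
    congr($(Projective.factorThru_comp (freeCoverMap Z) g) z)
  let b : prodMod (freeCover X) (freeCover Z) ⟶ Y :=
    ModuleCat.ofHom (LinearMap.coprod (f.hom ∘ₗ (freeCoverMap X).hom) l.hom)
  have hb (x : freeCover X) (z : freeCover Z) :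
      b.hom (x, z) = f.hom ((freeCoverMap X).hom x) + l.hom z := rfl
  have hbs : Function.Surjective b.hom := by
    intro y
    obtain ⟨z, hz⟩ := freeCoverMap_surjective Z (g.hom y)
    obtain ⟨x, hx⟩ := (h.exact (y - l.hom z)).1 (by rw [map_sub, hl, hz, sub_self])
    obtain ⟨x, rfl⟩ := freeCoverMap_surjective X x
    exact ⟨(x, z), by rw [hb, hx, sub_add_cancel]⟩
  have hg₁ (w : LinearMap.ker b.hom) : (freeCoverMap Z).hom w.1.2 = 0 := by
    have := congrArg g.hom w.2
    change g.hom (f.hom _ + l.hom _) = _ at this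
    rw [map_add, h.exact.apply_apply_eq_zero, hl, zero_add] at this
    exact this.trans (map_zero _)
  refine ⟨_, _, _, b, ?_, ses_ker b hbs,
    ModuleCat.ofHom (LinearMap.codRestrict (LinearMap.ker b.hom)
      (LinearMap.inl R _ _ ∘ₗ (LinearMap.ker (freeCoverMap X).hom).subtype) fun x ↦ ?_),
    ModuleCat.ofHom (LinearMap.codRestrict (LinearMap.ker (freeCoverMap Z).hom)
      (LinearMap.snd R _ _ ∘ₗ (LinearMap.ker b.hom).subtype) hg₁), ?_, ?_, ?_⟩
  · exact projective_prodMod inferInstance inferInstance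
  · have : (freeCoverMap X).hom x.1 = 0 := x.2
    change f.hom ((freeCoverMap X).hom x.1) + l.hom 0 = 0
    rw [this, map_zero, map_zero, add_zero]
  · intro x x' hxx'
    exact Subtype.ext congr(($hxx').1.1)
  · intro w
    constructor
    · intro hw
      have hw2 : w.1.2 = 0 := congrArg Subtype.val hw
      have hw1 : f.hom ((freeCoverMap X).hom w.1.1) + l.hom w.1.2 = 0 := w.2
      rw [hw2, map_zero, add_zero] at hw1
      exact ⟨⟨w.1.1, h.inj (hw1.trans (map_zero _).symm)⟩, Subtype.ext (Prod.ext rfl hw2.symm)⟩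
    · rintro ⟨x, rfl⟩
      rfl
  · intro z
    have hz : (freeCoverMap Z).hom z.1 = 0 := z.2
    obtain ⟨x, hx⟩ := (h.exact (l.hom z.1)).1 (by rw [hl, hz])
    obtain ⟨x, rfl⟩ := freeCoverMap_surjective X x
    refine ⟨⟨(-x, z.1), ?_⟩, rfl⟩
    change f.hom ((freeCoverMap X).hom (-x)) + l.hom z.1 = 0
    rw [map_neg, map_neg, hx, neg_add_cancel]

lemma SES.cohorseshoe (h : SES f g) : ∃ (E Y₁ : ModuleCat.{u} R) (a : Y ⟶ E) (b : E ⟶ Y₁),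
    Injective E ∧ SES a b ∧ ∃ (f₁ : cosyz X ⟶ Y₁) (g₁ : Y₁ ⟶ cosyz Z), SES f₁ g₁ := by
  have := (ModuleCat.mono_iff_injective f).2 h.inj
  let l := Injective.factorThru (Injective.ι X) f
  have hl (x : X) : l.hom (f.hom x) = (Injective.ι X).hom x :=
    congr($(Injective.comp_factorThru (Injective.ι X) f) x)
  let a : Y ⟶ prodMod (Injective.under X) (Injective.under Z) :=
    ModuleCat.ofHom (LinearMap.prod l.hom ((Injective.ι Z).hom ∘ₗ g.hom))
  have ha (y : Y) : a.hom y = (l.hom y, (Injective.ι Z).hom (g.hom y)) := rfl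
  have hai : Function.Injective a.hom := by
    rw [injective_iff_map_eq_zero]
    intro y hy
    have h2 : (Injective.ι Z).hom (g.hom y) = 0 := congr(($hy).2)
    obtain ⟨x, rfl⟩ := (h.exact y).1 (injective_ι_injective Z (h2.trans (map_zero _).symm))
    have h1 : l.hom (f.hom x) = 0 := congr(($hy).1)
    rw [hl] at h1
    rw [injective_ι_injective X (h1.trans (map_zero _).symm), map_zero]
  refine ⟨_, _, a, _, ?_, ses_coker a hai,
    ModuleCat.ofHom (Submodule.mapQ _ (LinearMap.range a.hom) (LinearMap.inl R _ _) ?_),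
    ModuleCat.ofHom (Submodule.mapQ _ (LinearMap.range (Injective.ι Z).hom)
      (LinearMap.snd R _ _) ?_), ?_, ?_, ?_⟩
  · exact injective_prodMod inferInstance inferInstance
  · rintro _ ⟨x, rfl⟩
    refine ⟨f.hom x, ?_⟩
    rw [ha, hl, h.exact.apply_apply_eq_zero, map_zero]
    rfl
  · rintro _ ⟨y, rfl⟩
    exact ⟨g.hom y, rfl⟩
  · rw [injective_iff_map_eq_zero]
    intro e he
    obtain ⟨e, rfl⟩ := Submodule.mkQ_surjective _ e
    obtain ⟨y, hy⟩ := (Submodule.Quotient.mk_eq_zero _).1 he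
    rw [ha] at hy
    have h2 : (Injective.ι Z).hom (g.hom y) = 0 := congr(($hy).2)
    obtain ⟨x, rfl⟩ := (h.exact y).1 (injective_ι_injective Z (h2.trans (map_zero _).symm))
    have h1 : l.hom (f.hom x) = e := congr(($hy).1)
    rw [hl] at h1
    exact (Submodule.Quotient.mk_eq_zero _).2 ⟨x, h1⟩
  · intro e
    obtain ⟨e, rfl⟩ := Submodule.mkQ_surjective _ e
    constructor
    · intro he
      obtain ⟨z, hz⟩ := (Submodule.Quotient.mk_eq_zero _).1 he
      obtain ⟨y, rfl⟩ := h.surj z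
      refine ⟨Submodule.Quotient.mk (e.1 - l.hom y), (Submodule.Quotient.eq _).2 ⟨-y, ?_⟩⟩
      rw [map_neg, ha, hz]
      ext <;> simp
    · rintro ⟨x, hx⟩
      obtain ⟨x, rfl⟩ := Submodule.mkQ_surjective _ x
      rw [← hx]
      exact (Submodule.Quotient.mk_eq_zero _).2 ⟨0, map_zero _⟩
  · intro z
    obtain ⟨z, rfl⟩ := Submodule.mkQ_surjective _ z
    exact ⟨Submodule.Quotient.mk (0, z), rfl⟩

lemma SES.iterate_syz (h : SES f g) (D : ℕ → ModuleCat.{u} R → Prop)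
    (hD : ∀ (m : ℕ) (K P Y : ModuleCat.{u} R) (i : K ⟶ P) (p : P ⟶ Y), Projective P → SES i p →
      D (m + 1) Y → D m K) {n : ℕ} (hY : D n Y) :
    ∃ (L : ModuleCat.{u} R) (f' : syz^[n] X ⟶ L) (g' : L ⟶ syz^[n] Z), D 0 L ∧ SES f' g' := by
  induction n generalizing X Y Z with
  | zero => exact ⟨Y, f, g, hY, h⟩
  | succ n ih =>
    obtain ⟨Y₁, P, a, b, hP, e, f₁, g₁, h₁⟩ := h.horseshoe
    exact ih h₁ (hD n _ _ _ a b hP e hY)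

lemma SES.iterate_cosyz (h : SES f g) {n : ℕ} (hY : HasInjectiveDimensionLE Y n) :
    ∃ (L : ModuleCat.{u} R) (f' : cosyz^[n] X ⟶ L) (g' : L ⟶ cosyz^[n] Z),
      Injective L ∧ SES f' g' := by
  induction n generalizing X Y Z with
  | zero => exact ⟨Y, f, g, idLE_zero_iff.1 hY, h⟩
  | succ n ih =>
    obtain ⟨E, Y₁, a, b, hE, e, f₁, g₁, h₁⟩ := h.cohorseshoe
    exact ih h₁ (e.idLE₃' hY (idLE_of_injective hE _))

end Horseshoe

section Syzygies

variable {R : Type u} [Ring R]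

lemma SES.pdLE₁ {X Y Z : ModuleCat.{u} R} {f : X ⟶ Y} {g : Y ⟶ Z} (h : SES f g) {n : ℕ}
    (h₂ : Projective Y) (h₃ : HasProjectiveDimensionLE Z (n + 1)) :
    HasProjectiveDimensionLE X n :=
  h.shortExact.hasProjectiveDimensionLT_X₁ (n + 1)
    (hasProjectiveDimensionLT_of_ge _ 1 _ (by lia)) h₃

lemma ext_of_ext_syz {M N : ModuleCat.{u} R} {n i : ℕ} (h : ExtVanish (syz^[n] M) N (i + 1)) :
    ExtVanish M N (n + i + 1) := by
  induction n generalizing M with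
  | zero => simpa using h
  | succ n ih =>
    have := (ses_syz M).ext₃ (ih h) (extVanish_of_projective _ _ _)
    rwa [show n + 1 + i + 1 = n + i + 1 + 1 by lia]

lemma ext_syz_of_ext {M N : ModuleCat.{u} R} {n i : ℕ} (h : ExtVanish M N (n + i + 1)) :
    ExtVanish (syz^[n] M) N (i + 1) := by
  induction n generalizing M with
  | zero => simpa using h
  | succ n ih =>
    refine ih ((ses_syz M).ext₁ (extVanish_of_projective _ _ _) ?_)
    rwa [show n + i + 1 + 1 = n + 1 + i + 1 by lia]

lemma ext_cosyz_of_ext {M N : ModuleCat.{u} R} {n i : ℕ} (h : ExtVanish N M (n + i + 1)) :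
    ExtVanish N (cosyz^[n] M) (i + 1) := by
  induction n generalizing M with
  | zero => simpa using h
  | succ n ih =>
    refine ih ((ses_cosyz M).coext₃ (extVanish_of_injective _ _ _) ?_)
    rwa [show n + i + 1 + 1 = n + 1 + i + 1 by lia]

lemma hasResolution_of_syz {𝒞 : ModuleCat.{u} R → Prop} (h𝒞 : ∀ M : ModuleCat.{u} R, 𝒞 (freeCover M))
    {n : ℕ} {M : ModuleCat.{u} R} (h : 𝒞 (syz^[n] M)) : HasResolution 𝒞 n M := by
  induction n generalizing M with
  | zero => exact h
  | succ n ih =>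
    have e := ses_syz M
    exact ⟨_, _, _, _, h𝒞 M, e.inj, e.exact, e.surj, ih h⟩

lemma hasCoresolution_of_cosyz {𝒞 : ModuleCat.{u} R → Prop}
    (h𝒞 : ∀ M : ModuleCat.{u} R, 𝒞 (Injective.under M))
    {n : ℕ} {M : ModuleCat.{u} R} (h : 𝒞 (cosyz^[n] M)) : HasCoresolution 𝒞 n M := by
  induction n generalizing M with
  | zero => exact h
  | succ n ih =>
    have e := ses_cosyz M
    exact ⟨_, _, _, _, h𝒞 M, e.inj, e.exact, e.surj, ih h⟩

lemma isGorensteinProjective_of_projective {P : ModuleCat.{u} R} (h : Projective P) :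
    IsGorensteinProjective P :=
  isGorensteinProjective_iff.2 ⟨fun _ ↦ P, fun _ ↦ prodMod P P, _, _, fun _ ↦ ses_prod P P,
    fun _ ↦ projective_prodMod h h,
    fun _ _ _ ↦ extVanish_of_projective _ _ 0, ⟨Iso.refl _⟩⟩

lemma isGorensteinInjective_of_injective {I : ModuleCat.{u} R} (h : Injective I) :
    IsGorensteinInjective I :=
  isGorensteinInjective_iff.2 ⟨fun _ ↦ I, fun _ ↦ prodMod I I, _, _, fun _ ↦ ses_prod I I,
    fun _ ↦ injective_prodMod h h, fun _ _ _ ↦ extVanish_of_injective _ _ 0, ⟨Iso.refl _⟩⟩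

lemma isGorensteinFlat_of_isFlat [StarRing R] {F : ModuleCat.{u} R} (h : IsFlat F) :
    IsGorensteinFlat F :=
  have h' : FdLE F 0 := hasResolution_isFlat_iff.1 h
  isGorensteinFlat_iff.2 ⟨fun _ ↦ F, fun _ ↦ prodMod F F, _, _, fun _ ↦ ses_prod F F,
    fun _ ↦ hasResolution_isFlat_iff.2 ((ses_prod F F).fdLE₂ h' h'),
    fun _ _ _ ↦ extVanish_of_isFlat h _ 0, ⟨Iso.refl _⟩⟩

end Syzygies

/-! ### Finiteness of Gorenstein dimensions -/

section Forward

variable {R : Type u} [Ring R]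

variable (R) in
/-- Injective modules have projective dimension at most `n`. -/
def SpliLE (n : ℕ) : Prop :=
  ∀ I : ModuleCat.{u} R, Injective I → HasProjectiveDimensionLE I n

/-- An `n`-th syzygy is a syzygy in an unbounded exact sequence: to the left it is resolved by free
modules, and to the right by the `n`-th syzygies of the injective modules in a coresolution. -/
lemma exists_unbounded_syz {n : ℕ} (D : ℕ → ModuleCat.{u} R → Prop)
    (hD : ∀ (m : ℕ) (K P Y : ModuleCat.{u} R) (i : K ⟶ P) (p : P ⟶ Y), Projective P → SES i p →
      D (m + 1) Y → D m K) (hI : ∀ I : ModuleCat.{u} R, Injective I → D n I)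
    (hP : ∀ P : ModuleCat.{u} R, Projective P → D 0 P) (M : ModuleCat.{u} R) :
    ∃ (W P : ℤ → ModuleCat.{u} R) (i : ∀ k, W k ⟶ P k) (p : ∀ k, P k ⟶ W (k + 1)),
      (∀ k, SES (i k) (p k)) ∧ (∀ k, D 0 (P k)) ∧ W 0 = syz^[n] M ∧
      ∀ k, ∃ N, W k = syz^[n] N := by
  obtain ⟨W, P, i, p, h, hP, h0, hW⟩ := exists_unbounded (𝒞 := D 0)
    (fun m ↦ syz^[n] (cosyz^[m] M)) (fun m ↦ syz^[m] (syz^[n] M)) rfl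
    (by
      intro m
      obtain ⟨L, f', g', hL, e⟩ :=
        (ses_cosyz (cosyz^[m] M)).iterate_syz D hD (hI _ inferInstance)
      rw [Function.iterate_succ_apply']
      exact ⟨L, f', g', hL, e⟩)
    (by
      intro m
      rw [Function.iterate_succ_apply']
      exact ⟨_, _, _, hP _ inferInstance, ses_syz _⟩)
  refine ⟨W, P, i, p, h, hP, h0, fun k ↦ ?_⟩
  rcases hW k with ⟨m, hm⟩ | ⟨m, hm⟩
  · exact ⟨_, hm⟩
  · exact ⟨syz^[m] M, hm.trans (by rw [← Function.iterate_add_apply, add_comm,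
      Function.iterate_add_apply])⟩

variable [StarRing R] {n : ℕ}

lemma SpliLE.sfliLE (h : SpliLE R n) : SfliLE R n := fun I hI ↦ .of_pdLE (h I hI)

/-- If the injective modules have projective dimension at most `n`, then all `n`-th syzygies are
Gorenstein projective. -/
lemma SpliLE.isGorensteinProjective_syz (h : SpliLE R n) (M : ModuleCat.{u} R) :
    IsGorensteinProjective (syz^[n] M) := by
  obtain ⟨W, P, i, p, e, hP, h0, -⟩ := exists_unbounded_syz
    (fun m N ↦ HasProjectiveDimensionLE N m) (fun m K P Y i p hP e hY ↦ e.pdLE₁ hP hY)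
    h (fun P hP ↦ pdLE_zero_iff.2 hP) M
  have hP' (k : ℤ) : Projective (P k) := pdLE_zero_iff.1 (hP k)
  exact isGorensteinProjective_iff.2 ⟨W, P, i, p, e, hP', fun Q hQ k ↦
    h.sfliLE.ext_one_of_unbounded e hP' (.of_projective _ _) k, ⟨eqToIso h0.symm⟩⟩

lemma SpliLE.hasResolution (h : SpliLE R n) (M : ModuleCat.{u} R) :
    HasResolution IsGorensteinProjective n M :=
  hasResolution_of_syz (fun _ ↦ isGorensteinProjective_of_projective inferInstance)
    (h.isGorensteinProjective_syz M)

/-- Finiteness of `spli` implies that projective modules have bounded injective dimension. -/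
lemma SpliLE.idLE_of_projective (h : SpliLE R n) {Q : ModuleCat.{u} R} (hQ : Projective Q) :
    HasInjectiveDimensionLE Q n := by
  rw [idLE_iff]
  intro Z
  obtain ⟨W, P, i, p, e, hP, hex, ⟨e'⟩⟩ := isGorensteinProjective_iff.1
    (h.isGorensteinProjective_syz Z)
  exact ext_of_ext_syz (i := 0) ((hex Q hQ 0).retract_left (Retract.ofIso e'))

lemma SpliLE.isGorensteinInjective_cosyz (h : SpliLE R n) (M : ModuleCat.{u} R) :
    IsGorensteinInjective (cosyz^[n] M) := by
  obtain ⟨W, P, i, p, e, hP, h0, hW⟩ := exists_unbounded (𝒞 := fun P ↦ Injective P)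
    (fun m ↦ cosyz^[m] (cosyz^[n] M)) (fun m ↦ cosyz^[n] (syz^[m] M)) rfl
    (by
      intro m
      rw [Function.iterate_succ_apply']
      exact ⟨_, _, _, inferInstance, ses_cosyz _⟩)
    (by
      intro m
      rw [Function.iterate_succ_apply']
      exact (ses_syz (syz^[m] M)).iterate_cosyz (h.idLE_of_projective inferInstance))
  have hW' (k : ℤ) : ∃ N, W k = cosyz^[n] N := by
    rcases hW k with ⟨m, hm⟩ | ⟨m, hm⟩
    · exact ⟨cosyz^[m] M, hm.trans (by rw [← Function.iterate_add_apply, add_comm,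
        Function.iterate_add_apply])⟩
    · exact ⟨_, hm⟩
  refine isGorensteinInjective_iff.2 ⟨W, P, i, p, e, hP, fun I hI k ↦ ?_, ⟨eqToIso h0.symm⟩⟩
  obtain ⟨N, hN⟩ := hW' k
  rw [hN]
  exact ext_cosyz_of_ext (pdLE_vanish (h I hI) _ (by lia))

lemma SpliLE.hasCoresolution (h : SpliLE R n) (M : ModuleCat.{u} R) :
    HasCoresolution IsGorensteinInjective n M :=
  hasCoresolution_of_cosyz (fun _ ↦ isGorensteinInjective_of_injective inferInstance)
    (h.isGorensteinInjective_cosyz M)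

lemma SfliLE.isGorensteinFlat_syz (h : SfliLE R n) (M : ModuleCat.{u} R) :
    IsGorensteinFlat (syz^[n] M) := by
  obtain ⟨W, P, i, p, e, hP, h0, hW⟩ := exists_unbounded_syz
    (fun m N ↦ FdLE N m)
    (fun m K P Y i p hP e hY ↦ e.ch.idLE₃' hY (FdLE.of_projective P m))
    h (fun P hP ↦ .of_projective P 0) M
  refine isGorensteinFlat_iff.2 ⟨W, P, i, p, e, fun k ↦ hasResolution_isFlat_iff.2 (hP k),
    fun J hJ k ↦ ?_, ⟨eqToIso h0.symm⟩⟩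
  obtain ⟨N, hN⟩ := hW k
  rw [hN]
  exact ext_syz_of_ext (idLE_vanish (h J hJ) _ (by lia))

lemma SfliLE.hasResolution (h : SfliLE R n) (M : ModuleCat.{u} R) :
    HasResolution IsGorensteinFlat n M :=
  hasResolution_of_syz (fun _ ↦ isGorensteinFlat_of_isFlat
    ((isFlat_iff _).2 (injective_ch_of_projective _))) (h.isGorensteinFlat_syz M)

end Forward

/-! ### Finite Gorenstein dimensions bound `spli` and `sfli` -/

section Pushouts

variable {R : Type u} [Ring R] {X Y Z : ModuleCat.{u} R} {f : X ⟶ Y} {g : Y ⟶ Z}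

/-- Pushouts of short exact sequences. -/
lemma SES.pushout (h : SES f g) {X' : ModuleCat.{u} R} (φ : X ⟶ X') :
    ∃ (E : ModuleCat.{u} R) (f' : X' ⟶ E) (g' : E ⟶ Z) (ψ : Y ⟶ E), SES f' g' ∧
      f ≫ ψ = φ ≫ f' ∧ ψ ≫ g' = g ∧
      ∀ (V : ModuleCat.{u} R) (χ : X' ⟶ V), SES φ χ → ∃ χ' : E ⟶ V, SES ψ χ' := by
  let S : Submodule R (Y × X') := LinearMap.range (LinearMap.prod f.hom (-φ.hom))
  have hS (y : Y) (x' : X') : (y, x') ∈ S ↔ ∃ x, f.hom x = y ∧ -φ.hom x = x' := by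
    constructor
    · rintro ⟨x, hx⟩
      exact ⟨x, congr(($hx).1), congr(($hx).2)⟩
    · rintro ⟨x, rfl, rfl⟩
      exact ⟨x, rfl⟩
  have hg0 (x : X) : g.hom (f.hom x) = 0 := h.exact.apply_apply_eq_zero x
  let g' : ModuleCat.of R ((Y × X') ⧸ S) ⟶ Z := ModuleCat.ofHom
    (S.liftQ (g.hom ∘ₗ LinearMap.fst R Y X') (by rintro _ ⟨x, rfl⟩; exact hg0 x))
  refine ⟨ModuleCat.of R ((Y × X') ⧸ S), ModuleCat.ofHom (S.mkQ ∘ₗ LinearMap.inr R Y X'), g',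
    ModuleCat.ofHom (S.mkQ ∘ₗ LinearMap.inl R Y X'), ⟨?_, ?_, ?_⟩, ?_, ?_, ?_⟩
  · rw [injective_iff_map_eq_zero]
    intro x' hx'
    obtain ⟨x, hx, rfl⟩ := (hS _ _).1 ((Submodule.Quotient.mk_eq_zero S).1 hx')
    rw [h.inj (hx.trans (map_zero _).symm)]
    simp
  · intro e
    obtain ⟨⟨y, x'⟩, rfl⟩ := S.mkQ_surjective e
    constructor
    · intro hy
      obtain ⟨x, rfl⟩ := (h.exact y).1 hy
      refine ⟨x' + φ.hom x, (Submodule.Quotient.eq S).2 ((hS _ _).2 ⟨-x, ?_, ?_⟩)⟩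
      · simp
      · simp
    · rintro ⟨x'', hx''⟩
      rw [← hx'']
      exact map_zero g.hom
  · intro z
    obtain ⟨y, rfl⟩ := h.surj z
    exact ⟨S.mkQ (y, 0), rfl⟩
  · ext x
    exact (Submodule.Quotient.eq S).2 ((hS _ _).2 ⟨x, (sub_zero _).symm, (zero_sub _).symm⟩)
  · rfl
  · intro V χ hχ
    have hc0 (x : X) : χ.hom (φ.hom x) = 0 := hχ.exact.apply_apply_eq_zero x
    refine ⟨ModuleCat.ofHom (S.liftQ (χ.hom ∘ₗ LinearMap.snd R Y X') (by
      rintro _ ⟨x, rfl⟩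
      change χ.hom (-φ.hom x) = 0
      rw [map_neg, hc0, neg_zero])), ?_, ?_, ?_⟩
    · rw [injective_iff_map_eq_zero]
      intro y hy
      obtain ⟨x, rfl, hx⟩ := (hS _ _).1 ((Submodule.Quotient.mk_eq_zero S).1 hy)
      replace hx : φ.hom x = 0 := neg_eq_zero.1 hx
      rw [hχ.inj (hx.trans (map_zero _).symm), map_zero]
    · intro e
      obtain ⟨⟨y, x'⟩, rfl⟩ := S.mkQ_surjective e
      constructor
      · intro hx'
        obtain ⟨x, rfl⟩ := (hχ.exact x').1 hx'
        refine ⟨y + f.hom x, (Submodule.Quotient.eq S).2 ((hS _ _).2 ⟨x, ?_, ?_⟩)⟩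
        · simp
        · simp
      · rintro ⟨y', hy'⟩
        rw [← hy']
        exact map_zero χ.hom
    · intro v
      obtain ⟨x', rfl⟩ := hχ.surj v
      exact ⟨S.mkQ (0, x'), rfl⟩

/-- The quotients in a composition of two monomorphisms. -/
lemma SES.comp (h : SES f g) {P V : ModuleCat.{u} R} {a : Y ⟶ P} {b : P ⟶ V} (h' : SES a b) :
    ∃ (E : ModuleCat.{u} R) (q : P ⟶ E) (c : Z ⟶ E) (d : E ⟶ V), SES (f ≫ a) q ∧ SES c d ∧
      g ≫ c = a ≫ q := by
  have h1 := ses_coker (f ≫ a) (h'.inj.comp h.inj)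
  let q : P ⟶ _ := ModuleCat.ofHom (LinearMap.range (f ≫ a).hom).mkQ
  obtain ⟨c, hc⟩ := h.desc (a ≫ q) (by rw [← Category.assoc]; exact h1.comp_zero)
  obtain ⟨d, hd⟩ := h1.desc b (by rw [Category.assoc, h'.comp_zero, Limits.comp_zero])
  have hc' (y : Y) : c.hom (g.hom y) = q.hom (a.hom y) := congr($hc y)
  have hd' (p : P) : d.hom (q.hom p) = b.hom p := congr($hd p)
  refine ⟨_, q, c, d, h1, ⟨?_, ?_, ?_⟩, hc⟩
  · rw [injective_iff_map_eq_zero]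
    intro z hz
    obtain ⟨y, rfl⟩ := h.surj z
    rw [hc'] at hz
    obtain ⟨x, hx⟩ := (h1.exact _).1 hz
    rw [← h'.inj hx]
    exact h.exact.apply_apply_eq_zero x
  · intro e
    obtain ⟨p, rfl⟩ := h1.surj e
    constructor
    · intro hp
      obtain ⟨y, rfl⟩ := (h'.exact p).1 ((hd' p).symm.trans hp)
      exact ⟨g.hom y, hc' y⟩
    · rintro ⟨z, hz⟩
      obtain ⟨y, rfl⟩ := h.surj z
      rw [← hz, hc']
      exact (hd' _).trans (h'.exact.apply_apply_eq_zero y)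
  · intro v
    obtain ⟨p, rfl⟩ := h'.surj v
    exact ⟨q.hom p, hd' p⟩

end Pushouts

section Reverse

variable {R : Type u} [Ring R]

lemma pdLE_iff {X : ModuleCat.{u} R} {n : ℕ} :
    HasProjectiveDimensionLE X n ↔ ∀ Z : ModuleCat.{u} R, ExtVanish X Z (n + 1) :=
  ⟨fun h Z ↦ pdLE_vanish h Z (Nat.lt_succ_self n),
    fun h ↦ hasProjectiveDimensionLT_of_enoughInjectives X (n + 1) h⟩

lemma ext_of_isGorensteinInjective {M I : ModuleCat.{u} R} (hM : IsGorensteinInjective M)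
    (hI : Injective I) (m : ℕ) : ExtVanish I M (m + 1) := by
  obtain ⟨W, P, i, p, e, hP, hex, ⟨e'⟩⟩ := isGorensteinInjective_iff.1 hM
  have h (m : ℕ) (k : ℤ) : ExtVanish I (W k) (m + 1) := by
    induction m generalizing k with
    | zero => exact hex I hI k
    | succ m ih =>
      have := hP k
      exact (e k).coext₁ (ih (k + 1)) (extVanish_of_injective _ _ _)
  exact (h m 0).retract_right (Retract.ofIso e')

lemma ext_of_hasCoresolution {M I : ModuleCat.{u} R} {n : ℕ}
    (hM : HasCoresolution IsGorensteinInjective n M) (hI : Injective I) (m : ℕ) :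
    ExtVanish I M (n + m + 1) := by
  induction n generalizing M with
  | zero => simpa using ext_of_isGorensteinInjective hM hI m
  | succ n ih =>
    obtain ⟨C, K, i, p, hC, hi, hip, hp, hK⟩ := hM
    rw [show n + 1 + m + 1 = n + m + 1 + 1 by lia]
    exact SES.coext₁ ⟨hi, hip, hp⟩ (ih hK) (ext_of_isGorensteinInjective hC hI _)

/-- If every module has finite Gorenstein injective dimension, then the projective dimensions of the
injective modules are bounded: otherwise a product of counterexamples would have infinite
dimension. -/
lemma exists_spliLE_of_coresolution
    (h : ∀ M : ModuleCat.{u} R, ∃ n, HasCoresolution IsGorensteinInjective n M) :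
    ∃ n, SpliLE R n := by
  by_contra! hcon
  have hcon' (n : ℕ) : ∃ I N : ModuleCat.{u} R, Injective I ∧ ¬ ExtVanish I N (n + 1) := by
    have := hcon n
    simp only [SpliLE, not_forall, exists_prop] at this
    obtain ⟨I, hI, hn⟩ := this
    rw [pdLE_iff] at hn
    push Not at hn
    obtain ⟨N, hN⟩ := hn
    exact ⟨I, N, hI, hN⟩
  choose I N hI hN using hcon'
  obtain ⟨n, hn⟩ := h (piMod fun k : ULift.{u} ℕ ↦ N k.down)
  have := ext_of_hasCoresolution hn (injective_pi (fun k : ULift.{u} ℕ ↦ I k.down) fun k ↦ hI _) 0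
  exact hN n ((this.retract_left (piRetract _ ⟨n⟩)).retract_right
    (piRetract (fun k : ULift.{u} ℕ ↦ N k.down) ⟨n⟩))

/-- The modules with a right resolution by projective modules all of whose cosyzygies (including the
module itself) are orthogonal to projective modules. They form the greatest class of modules which
are orthogonal to projective modules and embed in a projective module with quotient in the
class. -/
def RightGP (W : ModuleCat.{u} R) : Prop :=
  ∃ 𝒞 : ModuleCat.{u} R → Prop, 𝒞 W ∧ ∀ X, 𝒞 X →
    (∀ Q : ModuleCat.{u} R, Projective Q → ∀ m, ExtVanish X Q (m + 1)) ∧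
    ∃ (P Z : ModuleCat.{u} R) (f : X ⟶ P) (g : P ⟶ Z), Projective P ∧ SES f g ∧ 𝒞 Z

lemma RightGP.ext {W : ModuleCat.{u} R} (h : RightGP W) {Q : ModuleCat.{u} R} (hQ : Projective Q)
    (m : ℕ) : ExtVanish W Q (m + 1) := by
  obtain ⟨𝒞, hW, h𝒞⟩ := h
  exact (h𝒞 W hW).1 Q hQ m

lemma RightGP.exists_ses {W : ModuleCat.{u} R} (h : RightGP W) :
    ∃ (P Z : ModuleCat.{u} R) (f : W ⟶ P) (g : P ⟶ Z), Projective P ∧ SES f g ∧ RightGP Z := by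
  obtain ⟨𝒞, hW, h𝒞⟩ := h
  obtain ⟨P, Z, f, g, hP, e, hZ⟩ := (h𝒞 W hW).2
  exact ⟨P, Z, f, g, hP, e, 𝒞, hZ, h𝒞⟩

lemma IsGorensteinProjective.ext {M Q : ModuleCat.{u} R} (hM : IsGorensteinProjective M)
    (hQ : Projective Q) (m : ℕ) : ExtVanish M Q (m + 1) := by
  obtain ⟨W, P, i, p, e, hP, hex, ⟨e'⟩⟩ := isGorensteinProjective_iff.1 hM
  have h (m : ℕ) (k : ℤ) : ExtVanish (W k) Q (m + 1) := by
    induction m generalizing k with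
    | zero => exact hex Q hQ k
    | succ m ih =>
      obtain ⟨k, rfl⟩ : ∃ j, k = j + 1 := ⟨k - 1, by lia⟩
      have := hP k
      exact (e k).ext₃ (ih k) (extVanish_of_projective _ _ _)
  exact (h m 0).retract_left (Retract.ofIso e')

lemma IsGorensteinProjective.rightGP {M : ModuleCat.{u} R} (hM : IsGorensteinProjective M) :
    RightGP M := by
  refine ⟨IsGorensteinProjective, hM, fun X hX ↦ ⟨fun Q hQ m ↦ hX.ext hQ m, ?_⟩⟩
  obtain ⟨W, P, i, p, e, hP, hex, ⟨e'⟩⟩ := isGorensteinProjective_iff.1 hX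
  refine ⟨P 0, W (0 + 1), e'.hom ≫ i 0, p 0, hP 0, ?_, ?_⟩
  · refine ⟨(e 0).inj.comp e'.toLinearEquiv.injective, fun y ↦ ?_, (e 0).surj⟩
    rw [(e 0).exact y]
    constructor
    · rintro ⟨w, rfl⟩
      obtain ⟨x, rfl⟩ := e'.toLinearEquiv.surjective w
      exact ⟨x, rfl⟩
    · rintro ⟨x, rfl⟩
      exact ⟨e'.hom.hom x, rfl⟩
  · exact isGorensteinProjective_iff.2 ⟨fun k ↦ W (k + 1), fun k ↦ P (k + 1), fun k ↦ i (k + 1),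
      fun k ↦ p (k + 1), fun k ↦ e (k + 1), fun k ↦ hP (k + 1), fun Q hQ k ↦ hex Q hQ (k + 1),
      ⟨Iso.refl _⟩⟩

lemma SES.rightGP {X Y Z : ModuleCat.{u} R} {f : X ⟶ Y} {g : Y ⟶ Z} (h : SES f g)
    (hX : RightGP X) (hZ : RightGP Z) : RightGP Y := by
  refine ⟨fun Y ↦ ∃ (X Z : ModuleCat.{u} R) (f : X ⟶ Y) (g : Y ⟶ Z), SES f g ∧ RightGP X ∧
    RightGP Z, ⟨X, Z, f, g, h, hX, hZ⟩, ?_⟩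
  clear! X Y Z
  rintro Y ⟨X, Z, f, g, h, hX, hZ⟩
  refine ⟨fun Q hQ m ↦ h.ext₂ (hX.ext hQ m) (hZ.ext hQ m), ?_⟩
  obtain ⟨P, X', a, b, hP, e, hX'⟩ := hX.exists_ses
  obtain ⟨P', Z', a', b', hP', e', hZ'⟩ := hZ.exists_ses
  obtain ⟨l, hl⟩ := h.extend (hZ.ext hP 0) a
  have hl' (x : X) : l.hom (f.hom x) = a.hom x := congr($hl x)
  have hgf (x : X) : g.hom (f.hom x) = 0 := h.exact.apply_apply_eq_zero x
  let c : Y ⟶ prodMod P P' := ModuleCat.ofHom (LinearMap.prod l.hom (a'.hom ∘ₗ g.hom))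
  have hc (y : Y) : c.hom y = (l.hom y, a'.hom (g.hom y)) := rfl
  have hci : Function.Injective c.hom := by
    rw [injective_iff_map_eq_zero]
    intro y hy
    have h2 : a'.hom (g.hom y) = 0 := congr(($hy).2)
    obtain ⟨x, rfl⟩ := (h.exact y).1 (e'.inj (h2.trans (map_zero _).symm))
    have h1 : l.hom (f.hom x) = 0 := congr(($hy).1)
    rw [hl'] at h1
    rw [e.inj (h1.trans (map_zero _).symm), map_zero]
  have e₁ := ses_coker c hci
  let q : prodMod P P' ⟶ _ := ModuleCat.ofHom (LinearMap.range c.hom).mkQ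
  obtain ⟨s, hs⟩ := e.desc (ModuleCat.ofHom (LinearMap.inl R P P') ≫ q) (by
    ext x
    refine (Submodule.Quotient.mk_eq_zero _).2 ⟨f.hom x, ?_⟩
    rw [hc, hl', hgf, map_zero]
    rfl)
  obtain ⟨t, ht⟩ := e₁.desc (ModuleCat.ofHom (LinearMap.snd R P P') ≫ b') (by
    ext y
    exact e'.exact.apply_apply_eq_zero (g.hom y))
  have hs' (x : P) : s.hom (b.hom x) = q.hom (x, 0) := congr($hs x)
  have ht' (x : P × P') : t.hom (q.hom x) = b'.hom x.2 := congr($ht x)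
  refine ⟨_, _, c, _, projective_prodMod hP hP', e₁, X', Z', s, t, ⟨?_, ?_, ?_⟩, hX', hZ'⟩
  · rw [injective_iff_map_eq_zero]
    intro x' hx'
    obtain ⟨x, rfl⟩ := e.surj x'
    rw [hs'] at hx'
    obtain ⟨y, hy⟩ := (e₁.exact _).1 hx'
    have h2 : a'.hom (g.hom y) = 0 := congr(($hy).2)
    obtain ⟨w, rfl⟩ := (h.exact y).1 (e'.inj (h2.trans (map_zero _).symm))
    have h1 : l.hom (f.hom w) = x := congr(($hy).1)
    rw [← h1, hl']
    exact e.exact.apply_apply_eq_zero w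
  · intro v
    obtain ⟨⟨x, x'⟩, rfl⟩ := e₁.surj v
    constructor
    · intro hx
      obtain ⟨z, hz⟩ := (e'.exact x').1 ((ht' (x, x')).symm.trans hx)
      obtain ⟨y, rfl⟩ := h.surj z
      refine ⟨b.hom (x - l.hom y), (hs' _).trans ((Submodule.Quotient.eq _).2 ⟨-y, ?_⟩)⟩
      rw [map_neg, hc, hz]
      ext <;> simp
    · rintro ⟨x'', hx''⟩
      obtain ⟨w, rfl⟩ := e.surj x''
      rw [← hx'', hs']
      exact (ht' (w, 0)).trans (map_zero _)
  · intro z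
    obtain ⟨x', rfl⟩ := e'.surj z
    exact ⟨q.hom (0, x'), ht' (0, x')⟩

/-- A module of Gorenstein projective dimension at most `n` embeds in a module of projective
dimension at most `n`, with quotient in `RightGP`. -/
lemma exists_ses_of_hasResolution {n : ℕ} {M : ModuleCat.{u} R}
    (h : HasResolution IsGorensteinProjective n M) :
    ∃ (L W : ModuleCat.{u} R) (f : M ⟶ L) (g : L ⟶ W), SES f g ∧
      HasProjectiveDimensionLE L n ∧ RightGP W := by
  induction n generalizing M with
  | zero =>
    obtain ⟨P, Z, f, g, hP, e, hZ⟩ := (IsGorensteinProjective.rightGP h).exists_ses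
    exact ⟨P, Z, f, g, e, pdLE_zero_iff.2 hP, hZ⟩
  | succ n ih =>
    obtain ⟨K, C, i, p, hC, hi, hip, hp, hK⟩ := h
    obtain ⟨L, W, f, g, e, hL, hW⟩ := ih hK
    obtain ⟨E, f', g', ψ, e₁, -, -, h₂⟩ := SES.pushout ⟨hi, hip, hp⟩ f
    obtain ⟨χ, e₂⟩ := h₂ W g e
    obtain ⟨P, Z, a, b, hP, e₃, hZ⟩ := (e₂.rightGP hC.rightGP hW).exists_ses
    obtain ⟨L', q, c, d, e₄, e₅, -⟩ := e₁.comp e₃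
    refine ⟨L', Z, c, d, e₅, ?_, hZ⟩
    exact e₄.shortExact.hasProjectiveDimensionLT_X₃ (n + 1) hL
      (hasProjectiveDimensionLT_of_ge _ 1 _ (by lia))

lemma pdLE_retract {X Y : ModuleCat.{u} R} (r : Retract X Y) {n : ℕ}
    (h : HasProjectiveDimensionLE Y n) : HasProjectiveDimensionLE X n :=
  pdLE_iff.2 fun Z ↦ (pdLE_iff.1 h Z).retract_left r

lemma exists_spliLE_of_resolution
    (h : ∀ M : ModuleCat.{u} R, ∃ n, HasResolution IsGorensteinProjective n M) :
    ∃ n, SpliLE R n := by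
  have hfin (I : ModuleCat.{u} R) (hI : Injective I) : ∃ n, HasProjectiveDimensionLE I n := by
    obtain ⟨n, hn⟩ := h I
    obtain ⟨L, W, f, g, e, hL, -⟩ := exists_ses_of_hasResolution hn
    have := (ModuleCat.mono_iff_injective f).2 e.inj
    exact ⟨n, pdLE_retract ⟨f, Injective.factorThru (𝟙 I) f, Injective.comp_factorThru _ _⟩ hL⟩
  by_contra! hcon
  simp only [SpliLE, not_forall, exists_prop] at hcon
  choose I hI hn using hcon
  obtain ⟨n, h'⟩ := hfin _ (injective_pi (fun k : ULift.{u} ℕ ↦ I k.down) fun k ↦ hI _)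
  exact hn n (pdLE_retract (piRetract (fun k : ULift.{u} ℕ ↦ I k.down) ⟨n⟩) h')

variable [StarRing R]

lemma ext_of_isGorensteinFlat {M J : ModuleCat.{u} R} (hM : IsGorensteinFlat M)
    (hJ : Injective J) (m : ℕ) : ExtVanish M (ch J) (m + 1) := by
  obtain ⟨W, P, i, p, e, hP, hex, ⟨e'⟩⟩ := isGorensteinFlat_iff.1 hM
  have h (m : ℕ) (k : ℤ) : ExtVanish (W k) (ch J) (m + 1) := by
    induction m generalizing k with
    | zero => exact hex J hJ k
    | succ m ih =>
      obtain ⟨k, rfl⟩ : ∃ j, k = j + 1 := ⟨k - 1, by lia⟩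
      exact (e k).ext₃ (ih k) (extVanish_of_isFlat (hP k) _ _)
  exact (h m 0).retract_left (Retract.ofIso e')

lemma ext_of_hasResolution_flat {M J : ModuleCat.{u} R} {n : ℕ}
    (hM : HasResolution IsGorensteinFlat n M) (hJ : Injective J) (m : ℕ) :
    ExtVanish M (ch J) (n + m + 1) := by
  induction n generalizing M with
  | zero => simpa using ext_of_isGorensteinFlat hM hJ m
  | succ n ih =>
    obtain ⟨K, C, i, p, hC, hi, hip, hp, hK⟩ := hM
    rw [show n + 1 + m + 1 = n + m + 1 + 1 by lia]
    exact SES.ext₃ ⟨hi, hip, hp⟩ (ih hK) (ext_of_isGorensteinFlat hC hJ _)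

lemma exists_sfliLE_of_resolution
    (h : ∀ M : ModuleCat.{u} R, ∃ n, HasResolution IsGorensteinFlat n M) :
    ∃ n, SfliLE R n := by
  by_contra! hcon
  have hcon' (n : ℕ) : ∃ J N : ModuleCat.{u} R, Injective J ∧ ¬ ExtVanish N (ch J) (n + 1) := by
    have := hcon n
    simp only [SfliLE, not_forall, exists_prop] at this
    obtain ⟨I, hI, hn⟩ := this
    rw [FdLE, idLE_iff] at hn
    push Not at hn
    obtain ⟨N, hN⟩ := hn
    exact ⟨I, N, hI, hN⟩
  choose J N hJ hN using hcon'
  obtain ⟨n, hn⟩ := h (piMod fun k : ULift.{u} ℕ ↦ N k.down)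
  have := ext_of_hasResolution_flat hn
    (injective_pi (fun k : ULift.{u} ℕ ↦ J k.down) fun k ↦ hJ _) 0
  exact hN n ((this.retract_left (piRetract (fun k : ULift.{u} ℕ ↦ N k.down) ⟨n⟩)).retract_right
    (chRetract (piRetract (fun k : ULift.{u} ℕ ↦ J k.down) ⟨n⟩)))

end Reverse

/-! ### Modules over group algebras and diagonal actions -/

section GroupAlgebra

attribute [local instance] starRingOfComm

variable {A : Type u} [CommRing A] {G : Type u} [Group G]

/-- The anti-automorphism of the group algebra given by inversion in the group. -/
def invHom : MonoidAlgebra A G →ₐ[A] (MonoidAlgebra A G)ᵐᵒᵖ :=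
  MonoidAlgebra.lift A (MonoidAlgebra A G)ᵐᵒᵖ G
    { toFun g := .op (.single g⁻¹ 1)
      map_one' := by rw [inv_one]; rfl
      map_mul' g h := by
        rw [← MulOpposite.op_mul, MonoidAlgebra.single_mul_single, mul_inv_rev, one_mul] }

lemma invHom_single (g : G) (a : A) :
    invHom (.single g a) = .op (MonoidAlgebra.single g⁻¹ a) := by
  rw [invHom, MonoidAlgebra.lift_single]
  change MulOpposite.op (a • MonoidAlgebra.single g⁻¹ (1 : A)) = _
  rw [MonoidAlgebra.smul_single, smul_eq_mul, mul_one]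

/-- The involution of the group algebra given by inversion in the group; it identifies left and
right modules. -/
instance : StarRing (MonoidAlgebra A G) where
  star x := (invHom x).unop
  star_involutive x := by
    induction x using MonoidAlgebra.induction_linear with
    | zero => simp
    | add x y hx hy => simp [hx, hy]
    | single g a => simp [invHom_single]
  star_mul x y := by simp
  star_add x y := by simp

lemma star_single (g : G) (a : A) :
    star (MonoidAlgebra.single g a) = MonoidAlgebra.single g⁻¹ a := by
  change (invHom (.single g a)).unop = _
  rw [invHom_single]
  rfl

/-- Modules over a group algebra are modules over the coefficients. -/
instance moduleBase (X : ModuleCat.{u} (MonoidAlgebra A G)) : Module A X :=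
  Module.compHom X (algebraMap A (MonoidAlgebra A G))

/-- The underlying `A`-module of an `A[G]`-module. It is definitionally the value of
`resBase A G`. -/
abbrev base (X : ModuleCat.{u} (MonoidAlgebra A G)) : ModuleCat.{u} A := ModuleCat.of A X

lemma base_smul (X : ModuleCat.{u} (MonoidAlgebra A G)) (a : A) (x : X) :
    a • x = MonoidAlgebra.single (1 : G) a • x := rfl

/-- The action of `G` on an `A[G]`-module. -/
def act (X : ModuleCat.{u} (MonoidAlgebra A G)) : Representation A G X where
  toFun g :=
    { toFun x := MonoidAlgebra.single g (1 : A) • x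
      map_add' x y := smul_add _ x y
      map_smul' a x := by
        rw [base_smul, base_smul, ← mul_smul, RingHom.id_apply, ← mul_smul]
        simp }
  map_one' := by
    ext x
    exact one_smul (MonoidAlgebra A G) x
  map_mul' g h := by
    ext x
    refine Eq.trans ?_ (mul_smul _ _ x)
    simp

lemma act_apply (X : ModuleCat.{u} (MonoidAlgebra A G)) (g : G) (x : X) :
    act X g x = MonoidAlgebra.single g (1 : A) • x := rfl

lemma single_smul_eq (X : ModuleCat.{u} (MonoidAlgebra A G)) (g : G) (a : A) (x : X) :
    MonoidAlgebra.single g a • x = a • act X g x := by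
  rw [act_apply, base_smul, ← mul_smul]
  simp

/-- An `A`-linear map commuting with the action of `G` is `A[G]`-linear. -/
def homMk {X Y : ModuleCat.{u} (MonoidAlgebra A G)} (f : X →ₗ[A] Y)
    (hf : ∀ (g : G) (x : X), f (act X g x) = act Y g (f x)) : X ⟶ Y :=
  ModuleCat.ofHom
    { toFun := f
      map_add' := f.map_add
      map_smul' r x := by
        rw [RingHom.id_apply]
        induction r using MonoidAlgebra.induction_linear with
        | zero => rw [zero_smul, f.map_zero, zero_smul]
        | add r s hr hs => rw [add_smul, f.map_add, hr, hs, add_smul]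
        | single g a => rw [single_smul_eq, f.map_smul, hf, single_smul_eq] }

/-- The underlying `A`-linear map of an `A[G]`-linear map. -/
abbrev baseMap {X Y : ModuleCat.{u} (MonoidAlgebra A G)} (f : X ⟶ Y) : base X ⟶ base Y :=
  ModuleCat.ofHom ((resBase A G).map f).hom

lemma hom_act {X Y : ModuleCat.{u} (MonoidAlgebra A G)} (f : X ⟶ Y) (g : G) (x : X) :
    f.hom (act X g x) = act Y g (f.hom x) :=
  f.hom.map_smul (MonoidAlgebra.single g (1 : A)) x

lemma SES.base {X Y Z : ModuleCat.{u} (MonoidAlgebra A G)} {f : X ⟶ Y} {g : Y ⟶ Z}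
    (h : SES f g) : SES (baseMap f) (baseMap g) :=
  ⟨h.inj, h.exact, h.surj⟩

/-- The `A[G]`-module given by an `A`-linear representation. -/
def repMod {V : Type u} [AddCommGroup V] [Module A V] (ρ : Representation A G V) :
    ModuleCat.{u} (MonoidAlgebra A G) := ModuleCat.of _ ρ.asModule

/-- The identity map from the underlying module of a representation. -/
def repEquiv {V : Type u} [AddCommGroup V] [Module A V] (ρ : Representation A G V) : repMod ρ ≃ₗ[A] V where
  toFun x := x
  invFun x := x
  map_add' _ _ := rfl
  map_smul' a x := by
    change Representation.asAlgebraHom ρ (algebraMap A (MonoidAlgebra A G) a) x = a • (show V from x)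
    rw [AlgHom.commutes]
    rfl
  left_inv _ := rfl
  right_inv _ := rfl

lemma repEquiv_act {V : Type u} [AddCommGroup V] [Module A V] (ρ : Representation A G V) (g : G) (x : repMod ρ) :
    repEquiv ρ (act (repMod ρ) g x) = ρ g (repEquiv ρ x) := by
  change Representation.asAlgebraHom ρ (MonoidAlgebra.single g 1) x = _
  rw [Representation.asAlgebraHom_single, one_smul]
  rfl

open TensorProduct

/-- The tensor product over `A` of two `A[G]`-modules, with the diagonal action. -/
def diag (X Y : ModuleCat.{u} (MonoidAlgebra A G)) : ModuleCat.{u} (MonoidAlgebra A G) :=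
  repMod ((act X).tprod (act Y))

/-- The identity map from the underlying module of the diagonal tensor product. -/
def diagEquiv (X Y : ModuleCat.{u} (MonoidAlgebra A G)) :
    diag X Y ≃ₗ[A] X ⊗[A] Y :=
  repEquiv ((act X).tprod (act Y))

/-- The elementary tensor `x ⊗ y`. -/
def diagMk (X Y : ModuleCat.{u} (MonoidAlgebra A G)) :
    X →ₗ[A] Y →ₗ[A] diag X Y :=
  (TensorProduct.mk A X Y).compr₂ (diagEquiv X Y).symm.toLinearMap

lemma act_diagMk (X Y : ModuleCat.{u} (MonoidAlgebra A G)) (g : G) (x : X) (y : Y) :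
    act (diag X Y) g (diagMk X Y x y) = diagMk X Y (act X g x) (act Y g y) := by
  apply (diagEquiv X Y).injective
  refine (repEquiv_act _ _ _).trans ?_
  rfl

lemma diag_hom_ext {X Y Z : ModuleCat.{u} (MonoidAlgebra A G)} {f f' : diag X Y ⟶ Z}
    (h : ∀ (x : X) (y : Y), f.hom (diagMk X Y x y) = f'.hom (diagMk X Y x y)) : f = f' := by
  have : (baseMap f).hom ∘ₗ (diagEquiv X Y).symm.toLinearMap =
      (baseMap f').hom ∘ₗ (diagEquiv X Y).symm.toLinearMap :=
    TensorProduct.ext' h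
  ext t
  exact congr($this (diagEquiv X Y t))

/-- The map out of `diag X Y` given by an equivariant bilinear map. -/
def diagLift {X Y Z : ModuleCat.{u} (MonoidAlgebra A G)} (b : X →ₗ[A] Y →ₗ[A] Z)
    (hb : ∀ (g : G) (x : X) (y : Y), b (act X g x) (act Y g y) = act Z g (b x y)) :
    diag X Y ⟶ Z :=
  homMk (TensorProduct.lift b ∘ₗ (diagEquiv X Y).toLinearMap) fun g t ↦ by
    have : (TensorProduct.lift b ∘ₗ (diagEquiv X Y).toLinearMap) ∘ₗ act (diag X Y) g ∘ₗ
        (diagEquiv X Y).symm.toLinearMap = act Z g ∘ₗ TensorProduct.lift b := by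
      refine TensorProduct.ext' fun x y ↦ ?_
      have h1 := act_diagMk X Y g x y
      change TensorProduct.lift b (diagEquiv X Y (act (diag X Y) g (diagMk X Y x y))) = _
      rw [h1]
      exact hb g x y
    exact congr($this (diagEquiv X Y t))

/-- The diagonal tensor product of two maps. -/
def diagMap {X Y X' Y' : ModuleCat.{u} (MonoidAlgebra A G)} (f : X ⟶ X') (g : Y ⟶ Y') :
    diag X Y ⟶ diag X' Y' :=
  diagLift ((diagMk X' Y').compl₁₂ (baseMap f).hom (baseMap g).hom) fun c x y ↦ by
    change diagMk X' Y' (f.hom (act X c x)) (g.hom (act Y c y)) = _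
    rw [hom_act, hom_act]
    exact (act_diagMk X' Y' c _ _).symm

lemma diagEquiv_diagMap {X Y X' Y' : ModuleCat.{u} (MonoidAlgebra A G)} (f : X ⟶ X') (g : Y ⟶ Y')
    (t : diag X Y) : diagEquiv X' Y' ((diagMap f g).hom t) =
      TensorProduct.map (baseMap f).hom (baseMap g).hom (diagEquiv X Y t) := by
  have : (diagEquiv X' Y').toLinearMap ∘ₗ (baseMap (diagMap f g)).hom ∘ₗ
      (diagEquiv X Y).symm.toLinearMap = TensorProduct.map (baseMap f).hom (baseMap g).hom :=
    TensorProduct.ext' fun x y ↦ rfl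
  exact congr($this (diagEquiv X Y t))

end GroupAlgebra

/-! ### Dimensions of diagonal tensor products -/

section BaseChange

attribute [local instance] starRingOfComm

variable {A : Type u} [CommRing A] {G : Type u} [Group G]

/-- The free module on `B`, as a synonym preventing its module structure over the coefficients from
being confused with that of finitely supported functions. -/
def freeMod (A : Type u) [CommRing A] (G : Type u) [Group G] (B : Type u) :
    ModuleCat.{u} (MonoidAlgebra A G) := ModuleCat.of _ (B →₀ MonoidAlgebra A G)

/-- The underlying module of the free module on `B`. -/
def baseFinsupp (B : Type u) : freeMod A G B ≃ₗ[A] B →₀ MonoidAlgebra A G where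
  toFun x := x
  invFun x := x
  left_inv _ := rfl
  right_inv _ := rfl
  map_add' _ _ := rfl
  map_smul' a x := by
    refine Finsupp.ext fun b ↦ ?_
    change MonoidAlgebra.single (1 : G) a * (show B →₀ MonoidAlgebra A G from x) b =
      a • (show B →₀ MonoidAlgebra A G from x) b
    rw [Algebra.smul_def]
    rfl

instance free_freeMod (B : Type u) : Module.Free A (freeMod A G B) :=
  .of_equiv (baseFinsupp B).symm

instance projective_freeMod (B : Type u) : Projective (freeMod A G B) :=
  projective_finsupp B

/-- The underlying module of a retract. -/
def baseRetract {X Y : ModuleCat.{u} (MonoidAlgebra A G)} (r : Retract X Y) :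
    Retract (base X) (base Y) where
  i := baseMap r.i
  r := baseMap r.r
  retract := by
    ext x
    exact congr($(r.retract) x)

lemma exists_retract_finsupp {R : Type u} [Ring R] (P : ModuleCat.{u} R) [Projective P] :
    Nonempty (Retract P (freeCover P)) := by
  have := (ModuleCat.epi_iff_surjective _).2 (freeCoverMap_surjective P)
  exact ⟨⟨Projective.factorThru (𝟙 P) (freeCoverMap P), freeCoverMap P, by simp⟩⟩

lemma projective_base (P : ModuleCat.{u} (MonoidAlgebra A G)) [Projective P] :
    Projective (base P) := by
  obtain ⟨r⟩ := exists_retract_finsupp P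
  have : Projective (base (freeMod A G P)) :=
    (IsProjective.iff_projective (freeMod A G P)).1 inferInstance
  exact Projective.of_retract (Y := base (freeMod A G P)) (baseRetract r) this

/-- The character module, as a synonym preventing its module structure over the coefficients from
being confused with that of the character module of the underlying module. -/
def chOp (X : ModuleCat.{u} (MonoidAlgebra A G)) : ModuleCat.{u} (MonoidAlgebra A G) := ch X

/-- An element of the character module, as a map. -/
def chHom {X : ModuleCat.{u} (MonoidAlgebra A G)} (c : chOp X) : Ch X := c

lemma chOp_ext {X : ModuleCat.{u} (MonoidAlgebra A G)} {c d : chOp X}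
    (h : ∀ x, chHom c x = chHom d x) : c = d := Ch.ext (M := X) h

lemma chOp_smul (X : ModuleCat.{u} (MonoidAlgebra A G)) (a : A) (c : chOp X) (x : X) :
    chHom (a • c) x = chHom c (a • x) := by
  change chHom c (star (MonoidAlgebra.single (1 : G) a) • x) =
    chHom c (MonoidAlgebra.single (1 : G) a • x)
  rw [star_single, inv_one]

lemma act_chOp (X : ModuleCat.{u} (MonoidAlgebra A G)) (g : G) (c : chOp X) (x : X) :
    chHom (act (chOp X) g c) x = chHom c (act X g⁻¹ x) := by
  change chHom c (star (MonoidAlgebra.single g (1 : A)) • x) = _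
  rw [star_single]
  rfl

/-- Restriction to the coefficients commutes with character modules. -/
def baseCh (X : ModuleCat.{u} (MonoidAlgebra A G)) : base (chOp X) ≅ ch (base X) :=
  LinearEquiv.toModuleIso
    { toFun c := c
      invFun c := c
      left_inv _ := rfl
      right_inv _ := rfl
      map_add' _ _ := rfl
      map_smul' a c := Ch.ext (M := X) fun x ↦ chOp_smul X a c x }

lemma injective_base {I : ModuleCat.{u} (MonoidAlgebra A G)} (hI : Injective I) :
    Injective (base I) := by
  let f : I ⟶ chOp (freeMod A G (ch I)) := ev I ≫ chMap (freeCoverMap (ch I))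
  have hf : Function.Injective f.hom :=
    (chMap_injective _ (freeCoverMap_surjective _)).comp (ev_injective I)
  have := (ModuleCat.mono_iff_injective f).2 hf
  have r : Retract I (chOp (freeMod A G (ch I))) :=
    ⟨f, Injective.factorThru (𝟙 I) f, Injective.comp_factorThru _ _⟩
  have := projective_base (freeMod A G (ch I))
  have h1 : Injective (base (chOp (freeMod A G (ch I)))) :=
    Injective.of_retract (Retract.ofIso (baseCh _)) (injective_ch_of_projective _)
  exact Injective.of_retract (baseRetract r) h1

lemma exists_ses_projective {R : Type u} [Ring R] (X : ModuleCat.{u} R) :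
    ∃ (K P : ModuleCat.{u} R) (i : K ⟶ P) (p : P ⟶ X), Projective P ∧ SES i p :=
  ⟨_, _, _, _, inferInstance, ses_syz X⟩

lemma pdLE_base {X : ModuleCat.{u} (MonoidAlgebra A G)} {n : ℕ}
    (h : HasProjectiveDimensionLE X n) : HasProjectiveDimensionLE (base X) n := by
  induction n generalizing X with
  | zero =>
    have := pdLE_zero_iff.1 h
    exact pdLE_zero_iff.2 (projective_base X)
  | succ n ih =>
    obtain ⟨K, P, i, p, hP, e⟩ := exists_ses_projective X
    exact e.base.shortExact.hasProjectiveDimensionLT_X₃ (n + 1) (ih (e.pdLE₁ hP h))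
      (pdLE_mono (Nat.zero_le _) (pdLE_zero_iff.2 (projective_base P)))

lemma idLE_base {X : ModuleCat.{u} (MonoidAlgebra A G)} {n : ℕ}
    (h : HasInjectiveDimensionLE X n) : HasInjectiveDimensionLE (base X) n := by
  induction n generalizing X with
  | zero => exact idLE_zero_iff.2 (injective_base (idLE_zero_iff.1 h))
  | succ n ih =>
    exact (ses_cosyz X).base.idLE₁
      (ih ((ses_cosyz X).idLE₃' h (idLE_of_injective inferInstance _)))
      (idLE_of_injective (injective_base inferInstance) _)

lemma fdLE_base {X : ModuleCat.{u} (MonoidAlgebra A G)} {n : ℕ} (h : FdLE X n) :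
    FdLE (base X) n :=
  idLE_retract (Retract.ofIso (baseCh X).symm) (idLE_base (X := chOp X) h)

lemma module_flat_iff {M : ModuleCat.{u} A} : Module.Flat A M ↔ FdLE M 0 := by
  rw [Module.Flat.iff_characterModule_injective, Module.injective_iff_injective_object]
  have e : ch M ≅ ModuleCat.of A (CharacterModule M) := LinearEquiv.toModuleIso
    { toFun c := c
      invFun c := c
      left_inv _ := rfl
      right_inv _ := rfl
      map_add' _ _ := rfl
      map_smul' _ _ := rfl }
  exact (Injective.iso_iff e).symm.trans idLE_zero_iff.symm

end BaseChange

section Diagonal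

open TensorProduct

attribute [local instance] starRingOfComm

variable {A : Type u} [CommRing A] {G : Type u} [Group G]
  {X Y Z M : ModuleCat.{u} (MonoidAlgebra A G)} {f : X ⟶ Y} {g : Y ⟶ Z}

/-- Short exactness can be checked after bijective changes of the modules. -/
lemma ses_of_equiv {X' Y' Z' : ModuleCat.{u} A} {f' : X' ⟶ Y'} {g' : Y' ⟶ Z'}
    (a : X ≃ₗ[A] X') (b : Y ≃ₗ[A] Y') (c : Z ≃ₗ[A] Z') (h : SES f' g')
    (hf : ∀ x, b (f.hom x) = f'.hom (a x)) (hg : ∀ y, c (g.hom y) = g'.hom (b y)) : SES f g where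
  inj x x' hx := by
    apply a.injective
    apply h.inj
    rw [← hf, hx, hf]
  exact y := by
    rw [← c.map_eq_zero_iff, hg, h.exact]
    constructor
    · rintro ⟨x, hx⟩
      refine ⟨a.symm x, b.injective ?_⟩
      rw [hf, a.apply_symm_apply, hx]
    · rintro ⟨x, rfl⟩
      exact ⟨a x, (hf x).symm⟩
  surj z := by
    obtain ⟨y, hy⟩ := h.surj (c z)
    refine ⟨b.symm y, c.injective ?_⟩
    rw [hg, b.apply_symm_apply, hy]

lemma SES.diag_right (h : SES f g) (hM : Module.Flat A M) :
    SES (diagMap f (𝟙 M)) (diagMap g (𝟙 M)) := by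
  have e : SES (ModuleCat.ofHom ((baseMap f).hom.rTensor M))
      (ModuleCat.ofHom ((baseMap g).hom.rTensor M)) :=
    ⟨Module.Flat.rTensor_preserves_injective_linearMap (M := M) (baseMap f).hom h.inj,
      rTensor_exact M h.exact h.surj, LinearMap.rTensor_surjective M h.surj⟩
  exact ses_of_equiv (diagEquiv X M) (diagEquiv Y M) (diagEquiv Z M) e
    (diagEquiv_diagMap f (𝟙 M)) (diagEquiv_diagMap g (𝟙 M))

lemma SES.diag_left (h : SES f g) (hZ : Module.Flat A Z) :
    SES (diagMap (𝟙 M) f) (diagMap (𝟙 M) g) := by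
  have e : SES (ModuleCat.ofHom ((baseMap f).hom.lTensor M))
      (ModuleCat.ofHom ((baseMap g).hom.lTensor M)) :=
    ⟨LinearMap.lTensor_injective_of_exact_of_flat (baseMap g).hom h.surj (baseMap f).hom h.inj
      h.exact M, lTensor_exact M h.exact h.surj, LinearMap.lTensor_surjective M h.surj⟩
  exact ses_of_equiv (diagEquiv M X) (diagEquiv M Y) (diagEquiv M Z) e
    (diagEquiv_diagMap (𝟙 M) f) (diagEquiv_diagMap (𝟙 M) g)

variable (X Y) in
/-- The module of `A`-linear maps between two `A[G]`-modules, with `G` acting by conjugation. -/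
def conj : ModuleCat.{u} (MonoidAlgebra A G) :=
  repMod (V := X →ₗ[A] Y) (Representation.linHom (act X) (act Y))

/-- The identity map from the module of linear maps. -/
def conjEquiv (X Y : ModuleCat.{u} (MonoidAlgebra A G)) : conj X Y ≃ₗ[A] (X →ₗ[A] Y) :=
  repEquiv (V := X →ₗ[A] Y) _

lemma conjEquiv_act (c : G) (φ : conj X Y) (x : X) :
    conjEquiv X Y (act (conj X Y) c φ) x = act Y c (conjEquiv X Y φ (act X c⁻¹ x)) :=
  congr($(repEquiv_act (V := X →ₗ[A] Y) (Representation.linHom (act X) (act Y)) c φ) x)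

lemma act_act_inv (c : G) (x : X) : act X c (act X c⁻¹ x) = x :=
  Representation.self_inv_apply (act X) c x

lemma act_inv_act (c : G) (x : X) : act X c⁻¹ (act X c x) = x :=
  Representation.inv_self_apply (act X) c x

/-- The equivariant bilinear map given by a map `Y → Hom_A(X, Z)`. -/
def uncurry (ψ : Y ⟶ conj X Z) : diag X Y ⟶ Z :=
  diagLift ((conjEquiv X Z).toLinearMap ∘ₗ (baseMap ψ).hom).flip fun c x y ↦ by
    change conjEquiv X Z (ψ.hom (act Y c y)) (act X c x) = act Z c (conjEquiv X Z (ψ.hom y) x)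
    rw [hom_act, conjEquiv_act, act_inv_act]

/-- The map `Y → Hom_A(X, Z)` given by a map out of the tensor product. -/
def curry (φ : diag X Y ⟶ Z) : Y ⟶ conj X Z :=
  homMk ((conjEquiv X Z).symm.toLinearMap ∘ₗ ((diagMk X Y).compr₂ (baseMap φ).hom).flip)
    fun c y ↦ (conjEquiv X Z).injective <| LinearMap.ext fun x ↦ by
      rw [conjEquiv_act]
      change φ.hom (diagMk X Y x (act Y c y)) = act Z c (φ.hom (diagMk X Y (act X c⁻¹ x) y))
      rw [← hom_act, act_diagMk, act_act_inv]

/-- The map induced on modules of linear maps. -/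
def conjMap (X : ModuleCat.{u} (MonoidAlgebra A G)) (g : Y ⟶ Z) : conj X Y ⟶ conj X Z :=
  homMk ((conjEquiv X Z).symm.toLinearMap ∘ₗ LinearMap.compRight A (baseMap g).hom ∘ₗ
    (conjEquiv X Y).toLinearMap)
    fun c φ ↦ (conjEquiv X Z).injective <| LinearMap.ext fun x ↦ by
      rw [conjEquiv_act]
      change g.hom (conjEquiv X Y (act (conj X Y) c φ) x) =
        act Z c (g.hom (conjEquiv X Y φ (act X c⁻¹ x)))
      rw [conjEquiv_act, hom_act]

lemma projective_diag (hX : Projective (base X)) (hY : Projective Y) :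
    Projective (diag X Y) where
  factors {V W} φ e he := by
    have he' := (ModuleCat.epi_iff_surjective e).1 he
    have hc : Function.Surjective (conjMap X e).hom := by
      intro ψ
      have : Epi (baseMap e) := (ModuleCat.epi_iff_surjective _).2 he'
      let ψ' : base X ⟶ base W := ModuleCat.ofHom (conjEquiv X W ψ)
      refine ⟨(conjEquiv X V).symm (Projective.factorThru ψ' (baseMap e)).hom,
        (conjEquiv X W).injective ?_⟩
      ext x
      exact congr($(Projective.factorThru_comp ψ' (baseMap e)) x)
    have := (ModuleCat.epi_iff_surjective _).2 hc
    refine ⟨uncurry (Projective.factorThru (curry φ) (conjMap X e)), ?_⟩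
    refine diag_hom_ext fun x y ↦ ?_
    exact congr(conjEquiv X W ($(Projective.factorThru_comp (curry φ) (conjMap X e)) y) x)

/-- Exchanging the factors in `Hom(B, (X ⊗ Y)⁺) = Hom(X ⊗ B, Y⁺)`. -/
def shiftCh {B : ModuleCat.{u} (MonoidAlgebra A G)} (φ : B ⟶ chOp (diag X Y)) :
    diag X B ⟶ chOp Y :=
  diagLift
    (LinearMap.mk₂ A
      (fun (x : X) (b : B) ↦ (AddMonoidHom.comp (chHom (φ.hom b) : diag X Y →+ AddCircle (1 : ℚ))
        (diagMk X Y x).toAddMonoidHom : Ch Y))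
      (fun x x' b ↦ chOp_ext fun y ↦ by
        change chHom (φ.hom b) (diagMk X Y (x + x') y) = _
        rw [map_add, LinearMap.add_apply, map_add]
        rfl)
      (fun a x b ↦ chOp_ext fun y ↦ by
        refine Eq.trans ?_ (chOp_smul Y a _ y).symm
        change chHom (φ.hom b) (diagMk X Y (a • x) y) = chHom (φ.hom b) (diagMk X Y x (a • y))
        rw [map_smul, LinearMap.smul_apply, (diagMk X Y x).map_smul])
      (fun x b b' ↦ chOp_ext fun y ↦ by
        change chHom (φ.hom (b + b')) (diagMk X Y x y) = _
        rw [map_add]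
        rfl)
      (fun a x b ↦ chOp_ext fun y ↦ by
        refine Eq.trans ?_ (chOp_smul Y a _ y).symm
        change chHom (φ.hom (a • b)) (diagMk X Y x y) = chHom (φ.hom b) (diagMk X Y x (a • y))
        have h : φ.hom (a • b) = a • φ.hom b := (baseMap φ).hom.map_smul a b
        rw [h, map_smul, chOp_smul]))
    fun c x b ↦ chOp_ext fun y ↦ by
      rw [act_chOp]
      change chHom (φ.hom (act B c b)) (diagMk X Y (act X c x) y) =
        chHom (φ.hom b) (diagMk X Y x (act Y c⁻¹ y))
      rw [hom_act, act_chOp, act_diagMk, act_inv_act]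

/-- The map `Hom(X ⊗ B, Y⁺) → Hom(B, (X ⊗ Y)⁺)` in the opposite direction. -/
def swapDiag (B : ModuleCat.{u} (MonoidAlgebra A G)) (φ : diag X B ⟶ chOp Y) :
    B ⟶ chOp (diag X Y) :=
  swap (M := diag X Y) (N := B) (shiftCh (swap (M := diag X B) (N := Y) φ))

lemma chOp_diag_ext {c d : chOp (diag X Y)}
    (h : ∀ x y, chHom c (diagMk X Y x y) = chHom d (diagMk X Y x y)) : c = d := by
  refine chOp_ext fun t ↦ ?_
  obtain ⟨t, rfl⟩ := (diagEquiv X Y).symm.surjective t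
  induction t using TensorProduct.induction_on with
  | zero => rw [map_zero, map_zero, map_zero]
  | tmul x y => exact h x y
  | add t t' ht ht' => rw [map_add, map_add, map_add, ht, ht']

lemma injective_ch_diag (hX : Module.Flat A X) (hY : Injective (ch Y)) :
    Injective (ch (diag X Y)) where
  factors {V W} φ e he := by
    have he' := (ModuleCat.mono_iff_injective e).1 he
    have h : Function.Injective (diagMap (𝟙 X) e).hom := by
      intro t t' ht
      apply (diagEquiv X V).injective
      apply Module.Flat.lTensor_preserves_injective_linearMap (M := X) (baseMap e).hom he'
      have := congrArg (diagEquiv X W) ht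
      rw [diagEquiv_diagMap, diagEquiv_diagMap] at this
      exact this
    have := (ModuleCat.mono_iff_injective _).2 h
    have hY' : Injective (chOp Y) := hY
    refine ⟨swapDiag W (Injective.factorThru (shiftCh φ) (diagMap (𝟙 X) e)), ?_⟩
    refine ModuleCat.hom_ext (LinearMap.ext fun v ↦ ?_)
    refine chOp_diag_ext (X := X) (Y := Y) fun x y ↦ ?_
    exact congrArg (fun ψ : diag X V ⟶ chOp Y ↦ chHom (ψ.hom (diagMk X V x v)) y)
      (Injective.comp_factorThru (shiftCh φ) (diagMap (𝟙 X) e))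

lemma flat_of_projective {P : ModuleCat.{u} (MonoidAlgebra A G)} (hP : Projective P) :
    Module.Flat A P :=
  module_flat_iff.2 (.of_pdLE (pdLE_base (pdLE_zero_iff.2 hP)))

lemma pdLE_diag {s t : ℕ} (hM : Module.Flat A M) (hX : HasProjectiveDimensionLE (base X) s)
    (h : HasProjectiveDimensionLE M t) : HasProjectiveDimensionLE (diag X M) (s + t) := by
  induction t generalizing M with
  | zero =>
    have hM' := pdLE_zero_iff.1 h
    induction s generalizing X with
    | zero => exact pdLE_zero_iff.2 (projective_diag (pdLE_zero_iff.1 hX) hM')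
    | succ s ih =>
      obtain ⟨K, P, i, p, hP, e⟩ := exists_ses_projective X
      have h₂ := projective_base P
      exact (e.diag_right hM).shortExact.hasProjectiveDimensionLT_X₃ (s + 1)
        (ih (e.base.pdLE₁ h₂ hX))
        (pdLE_mono (Nat.zero_le _) (pdLE_zero_iff.2 (projective_diag h₂ hM')))
  | succ t ih =>
    obtain ⟨K, P, i, p, hP, e⟩ := exists_ses_projective M
    have h₂ := flat_of_projective hP
    have h₁ : Module.Flat A K :=
      module_flat_iff.2 (e.base.fdLE₁ (module_flat_iff.1 h₂) (module_flat_iff.1 hM))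
    have hP' : HasProjectiveDimensionLE P t := pdLE_mono (Nat.zero_le _) (pdLE_zero_iff.2 hP)
    exact (e.diag_left hM).shortExact.hasProjectiveDimensionLT_X₃ (s + t + 1)
      (ih h₁ (e.pdLE₁ hP h)) (pdLE_mono (Nat.le_succ _) (ih h₂ hP'))

lemma fdLE_diag {s t : ℕ} (hM : Module.Flat A M) (hX : FdLE (base X) s)
    (h : FdLE M t) : FdLE (diag X M) (s + t) := by
  induction t generalizing M with
  | zero =>
    have hM' := idLE_zero_iff.1 h
    induction s generalizing X with
    | zero => exact idLE_zero_iff.2 (injective_ch_diag (module_flat_iff.2 hX) hM')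
    | succ s ih =>
      obtain ⟨K, P, i, p, hP, e⟩ := exists_ses_projective X
      have h₂ := flat_of_projective hP
      have hK : FdLE (base K) s := e.base.ch.idLE₃' hX
        (FdLE.mono (Nat.zero_le _) (module_flat_iff.1 h₂))
      exact (e.diag_right hM).fdLE₃ (ih hK)
        (FdLE.mono (Nat.zero_le _) (idLE_zero_iff.2 (injective_ch_diag h₂ hM')))
  | succ t ih =>
    obtain ⟨K, P, i, p, hP, e⟩ := exists_ses_projective M
    have h₂ := flat_of_projective hP
    have h₁ : Module.Flat A K :=
      module_flat_iff.2 (e.base.fdLE₁ (module_flat_iff.1 h₂) (module_flat_iff.1 hM))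
    have hK : FdLE K t := e.ch.idLE₃' h (FdLE.of_projective P _)
    exact (e.diag_left hM).fdLE₃ (ih h₁ hK)
      (FdLE.mono (Nat.le_succ _) (ih h₂ (.of_projective P _)))

/-- The underlying module of the trivial module is `A`. -/
def trivEquiv (A : Type u) [CommRing A] (G : Type u) [Group G] : trivialModule A G ≃ₗ[A] A where
  toFun x := x
  invFun x := x
  left_inv _ := rfl
  right_inv _ := rfl
  map_add' _ _ := rfl
  map_smul' a x := by
    change MonoidAlgebra.lift A A G 1 (MonoidAlgebra.single 1 a) * (show A from x) = a * _
    simp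

lemma act_trivial (g : G) (x : trivialModule A G) : act (trivialModule A G) g x = x := by
  change MonoidAlgebra.lift A A G 1 (MonoidAlgebra.single g 1) * (show A from x) = _
  simp only [MonoidAlgebra.lift_single, MonoidHom.one_apply, one_smul]
  exact one_mul (show A from x)

/-- If the map `ι : A → N` is pure over `A`, then so is the map `X → X ⊗ N` obtained from it; in
particular an injective module is a summand of its tensor product with `N`. -/
lemma exists_retract_diag {N : ModuleCat.{u} (MonoidAlgebra A G)} (ι : trivialModule A G ⟶ N)
    (hX : Injective X) (hι : Function.Injective (LinearMap.lTensor X (baseMap ι).hom)) :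
    Nonempty (Retract X (diag X N)) := by
  let f : X ⟶ diag X N := homMk
    ((diagMk X N).flip (ι.hom ((trivEquiv A G).symm 1))) fun g x ↦ by
      change diagMk X N (act X g x) (ι.hom ((trivEquiv A G).symm 1)) =
        act (diag X N) g (diagMk X N x (ι.hom ((trivEquiv A G).symm 1)))
      rw [act_diagMk, ← hom_act, act_trivial]
  have hf : Function.Injective f.hom := by
    intro x x' h
    have h' := hι (a₁ := x ⊗ₜ (trivEquiv A G).symm 1) (a₂ := x' ⊗ₜ (trivEquiv A G).symm 1)
      (congrArg (diagEquiv X N) h)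
    have := congrArg (TensorProduct.rid A X ∘ LinearMap.lTensor X (trivEquiv A G).toLinearMap) h'
    simpa using this
  have := (ModuleCat.mono_iff_injective f).2 hf
  exact ⟨⟨f, Injective.factorThru (𝟙 X) f, Injective.comp_factorThru _ _⟩⟩

/-- An injective module is a summand of its tensor product with a characteristic module, which has
bounded projective dimension. -/
lemma exists_spliLE_of_mem {G : GrpCat.{u}} {s : ℕ} (hA : SpliLE A s) (hG : G ∈ XChar A) :
    ∃ n, SpliLE (MonoidAlgebra A G) n := by
  obtain ⟨M, ι, hfree, hpd, hmono, hsplit⟩ := hG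
  obtain ⟨t, ht⟩ := pd_lt_top_iff.1 hpd
  have hfree' : Module.Free A M := hfree
  refine ⟨s + t, fun I hI ↦ ?_⟩
  obtain ⟨r⟩ := exists_retract_diag (X := I) ι hI (by
    obtain ⟨⟨σ, hσ⟩⟩ := hsplit
    let σ' : M →ₗ[A] trivialModule A G := σ.hom
    have h : σ' ∘ₗ (baseMap ι).hom = LinearMap.id := by
      ext x
      exact congr($hσ x)
    have h' : LinearMap.lTensor I σ' ∘ₗ LinearMap.lTensor I (baseMap ι).hom = LinearMap.id := by
      rw [← LinearMap.lTensor_comp, h, LinearMap.lTensor_id]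
    exact Function.LeftInverse.injective (g := LinearMap.lTensor I σ') fun t ↦ congr($h' t))
  exact pdLE_retract r (pdLE_diag inferInstance (hA _ (injective_base hI)) ht)

/-- An injective module is a summand of its tensor product with a weak characteristic module, which
has bounded flat dimension. -/
lemma exists_sfliLE_of_mem {G : GrpCat.{u}} {s : ℕ} (hA : SfliLE A s) (hG : G ∈ XWChar A) :
    ∃ n, SfliLE (MonoidAlgebra A G) n := by
  obtain ⟨N, ι, hflat, hfd, hmono, hpure⟩ := hG
  obtain ⟨t, ht⟩ := fd_lt_top_iff.1 hfd
  have hflat' : Module.Flat A N := hflat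
  refine ⟨s + t, fun I hI ↦ ?_⟩
  obtain ⟨r⟩ := exists_retract_diag (X := I) ι hI (hpure (base I))
  exact (fdLE_diag hflat' (hA _ (injective_base hI)) ht).retract r

end Diagonal

/-! ### Characteristic modules from Gorenstein projective resolutions -/

section

variable {R : Type u} [Ring R]

lemma SpliLE.pdLE [StarRing R] {s : ℕ} (h : SpliLE R s) {X : ModuleCat.{u} R} {m : ℕ}
    (hX : HasProjectiveDimensionLE X m) : HasProjectiveDimensionLE X s := by
  induction m with
  | zero => exact pdLE_mono (Nat.zero_le _) hX
  | succ m ih =>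
    obtain hms | hms := Nat.lt_or_ge m s
    · exact pdLE_mono hms hX
    · refine ih (pdLE_iff.2 fun Z ↦ ?_)
      obtain ⟨K, P, i, p, hP, e⟩ := exists_ses_projective Z
      exact e.coext₃ (idLE_vanish (h.idLE_of_projective hP) X (by lia))
        (pdLE_vanish hX K (by lia))

end

section

attribute [local instance] starRingOfComm

variable {A : Type u} [CommRing A] {G : Type u} [Group G]

/-- A module with a right resolution by projective modules is projective over the coefficients as
soon as it has finite projective dimension over them: the projective dimensions of its cosyzygies
are finite, hence bounded. -/
lemma RightGP.projective_base {s : ℕ} (h : SpliLE A s) {W : ModuleCat.{u} (MonoidAlgebra A G)}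
    (hW : RightGP W) {m : ℕ} (hm : HasProjectiveDimensionLE (base W) m) :
    Projective (base W) := by
  have key (j : ℕ) : ∀ W : ModuleCat.{u} (MonoidAlgebra A G), RightGP W →
      (∃ m, HasProjectiveDimensionLE (base W) m) → HasProjectiveDimensionLE (base W) (s - j) := by
    induction j with
    | zero => exact fun W _ ⟨m, hm⟩ ↦ h.pdLE hm
    | succ j ih =>
      intro W hW ⟨m, hm⟩
      obtain hj | hj := Nat.lt_or_ge j s
      · obtain ⟨P, Z, f, g, hP, e, hZ⟩ := hW.exists_ses
        have hP' := TypePhi.projective_base P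
        have hZ' := ih Z hZ ⟨m + 1, e.base.shortExact.hasProjectiveDimensionLT_X₃ (m + 1) hm
          (pdLE_mono (Nat.zero_le _) (pdLE_zero_iff.2 hP'))⟩
        rw [show s - j = s - (j + 1) + 1 by lia] at hZ'
        exact e.base.pdLE₁ hP' hZ'
      · rw [show s - (j + 1) = s - j by lia]
        exact ih W hW ⟨m, hm⟩
  have := key s W hW ⟨m, hm⟩
  rw [Nat.sub_self] at this
  exact pdLE_zero_iff.1 this

instance projective_base_trivial : Projective (base (trivialModule A G)) :=
  (IsProjective.iff_projective _).1 (.of_equiv (trivEquiv A G).symm)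

/-- Adding a free `A[G]`-module makes a module free over `A`. -/
lemma exists_free_prod_freeMod (L : ModuleCat.{u} (MonoidAlgebra A G)) (hL : Projective (base L)) :
    ∃ S : Type u, Module.Free A (L × freeMod A G S) := by
  have : Module.Projective A L := (IsProjective.iff_projective (R := A) L).2 hL
  obtain ⟨S, hS⟩ := exists_free_prod (R := A) L
  refine ⟨S, ?_⟩
  let p : S × G → Prop := fun q ↦ q.2 = 1
  let e₀ : S ≃ {q // p q} :=
    ⟨fun s ↦ ⟨(s, 1), rfl⟩, fun q ↦ q.1.1, fun _ ↦ rfl, fun ⟨⟨_, _⟩, h⟩ ↦ by cases h; rfl⟩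
  classical
  let e₁ : S ⊕ {q // ¬ p q} ≃ S × G := (e₀.sumCongr (Equiv.refl _)).trans (Equiv.sumCompl p)
  let e : freeMod A G S ≃ₗ[A] (S →₀ A) × ({q // ¬ p q} →₀ A) :=
    (baseFinsupp S).trans <| (Finsupp.mapRange.linearEquiv (MonoidAlgebra.coeffLinearEquiv A)).trans
      <| (Finsupp.curryLinearEquiv A).symm.trans <|
      (Finsupp.domLCongr e₁.symm).trans (Finsupp.sumFinsuppLEquivProdFinsupp A)
  let e' : (L × freeMod A G S) ≃ₗ[A] (L × (S →₀ A)) × ({q // ¬ p q} →₀ A) :=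
    ((LinearEquiv.refl A L).prodCongr e).trans (LinearEquiv.prodAssoc A _ _ _).symm
  have : Module.Free A (L × (S →₀ A)) := hS
  exact .of_equiv e'.symm

/-- Embedding the trivial module in a module of finite projective dimension with Gorenstein projective
quotient gives a characteristic module, after adding a free module. -/
lemma mem_xChar_of_spliLE {G : GrpCat.{u}} {s n : ℕ} (hA : SpliLE A s)
    (hG : SpliLE (MonoidAlgebra A G) n) : G ∈ XChar A := by
  obtain ⟨L, W, f, g, e, hL, hW⟩ := exists_ses_of_hasResolution (hG.hasResolution (trivialModule A G))
  have hWb : Projective (base W) := by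
    refine hW.projective_base hA (m := n + 1) ?_
    exact e.base.shortExact.hasProjectiveDimensionLT_X₃ (n + 1)
      (pdLE_mono (Nat.zero_le _) (pdLE_zero_iff.2 inferInstance))
      (pdLE_mono (Nat.le_succ _) (pdLE_base hL))
  have hLb : Projective (base L) := pdLE_zero_iff.1
    (e.base.shortExact.hasProjectiveDimensionLT_X₂ 1 (pdLE_zero_iff.2 inferInstance)
      (pdLE_zero_iff.2 hWb))
  obtain ⟨S, hS⟩ := exists_free_prod_freeMod L hLb
  obtain ⟨σ, hσ⟩ : ∃ σ : base L ⟶ base (trivialModule A G), baseMap f ≫ σ = 𝟙 _ :=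
    e.base.extend (extVanish_of_projective _ _ 0) (𝟙 _)
  have e' := ses_prod L (freeMod A G S)
  refine ⟨prodMod L (freeMod A G S), f ≫ ModuleCat.ofHom (LinearMap.inl _ L (freeMod A G S)),
    hS, pd_lt_top_iff.2 ⟨n, ?_⟩, e'.inj.comp e.inj, ⟨⟨?_, ?_⟩⟩⟩
  · exact e'.shortExact.hasProjectiveDimensionLT_X₂ (n + 1) hL
      (pdLE_mono (Nat.zero_le _) (pdLE_zero_iff.2 (projective_freeMod S)))
  · exact ModuleCat.ofHom (Y := base (trivialModule A G)) (σ.hom ∘ₗ LinearMap.fst A L (freeMod A G S))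
  · ext x
    exact congr($hσ x)

end

/-! ### Groups of type `Φ` and bounded functions -/

section

variable {A : Type u} [CommRing A] {G : Type u} [Group G]

/-- Higman's criterion: a module over the group algebra of a finite group is projective if it is
projective over the coefficients and the identity is the trace of an `A`-linear endomorphism. -/
lemma projective_of_trace {K : Type u} [Group K] [Fintype K]
    (X : ModuleCat.{u} (MonoidAlgebra A K)) (hX : Projective (base X)) (θ : X →ₗ[A] X)
    (hθ : ∀ x : X, ∑ k : K, act X k (θ (act X k⁻¹ x)) = x) : Projective X where
  factors {V W} φ e he := by
    have : Epi (baseMap e) := (ModuleCat.epi_iff_surjective _).2 ((ModuleCat.epi_iff_surjective e).1 he)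
    let s := Projective.factorThru (baseMap φ) (baseMap e)
    have hs (x : X) : e.hom (s.hom x) = φ.hom x :=
      congr($(Projective.factorThru_comp (baseMap φ) (baseMap e)) x)
    let σ : X →ₗ[A] V := ∑ k : K, act V k ∘ₗ s.hom ∘ₗ θ ∘ₗ act X k⁻¹
    have hσ (x : X) : σ x = ∑ k : K, act V k (s.hom (θ (act X k⁻¹ x))) := by
      simp only [σ, LinearMap.sum_apply, LinearMap.comp_apply]
    refine ⟨homMk σ fun g x ↦ ?_, ?_⟩
    · rw [hσ, hσ, map_sum]
      refine (Equiv.sum_comp (Equiv.mulLeft g)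
        fun k ↦ act V k (s.hom (θ (act X k⁻¹ (act X g x))))).symm.trans ?_
      refine Finset.sum_congr rfl fun k _ ↦ ?_
      rw [Equiv.coe_mulLeft, mul_inv_rev, map_mul, map_mul, Module.End.mul_apply,
        Module.End.mul_apply, act_inv_act]
    · refine ModuleCat.hom_ext (LinearMap.ext fun x ↦ ?_)
      change e.hom (σ x) = φ.hom x
      rw [hσ, map_sum]
      conv_rhs => rw [← hθ x, map_sum]
      refine Finset.sum_congr rfl fun k _ ↦ ?_
      rw [hom_act, hom_act, hs]

/-- Translation of ultrafilters on a group. -/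
def translate (g : G) : C(Ultrafilter G, Ultrafilter G) where
  toFun U := U.map (g * ·)
  continuous_toFun := by
    rw [ultrafilterBasis_is_basis.continuous_iff]
    rintro _ ⟨s, rfl⟩
    exact ultrafilter_isOpen_basic ((g * ·) ⁻¹' s)

/-- The action of `G` on the locally constant functions on the space of ultrafilters on `G`, that
is, on the functions on `G` taking finitely many values. -/
def boundedRep (G : Type u) [Group G] : Representation ℤ G (LocallyConstant (Ultrafilter G) ℤ) where
  toFun g := LocallyConstant.comapₗ ℤ (translate g⁻¹)
  map_one' := by
    ext f U
    change f (U.map (1⁻¹ * ·)) = f U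
    simp
  map_mul' g h := by
    ext f U
    change f (U.map ((g * h)⁻¹ * ·)) = f ((U.map (g⁻¹ * ·)).map (h⁻¹ * ·))
    rw [Ultrafilter.map_map]
    congr 2
    ext x
    simp [mul_assoc]

open TensorProduct

variable (A G) in
/-- The bounded functions on `G` with values in `A`, that is, those taking finitely many values,
as `A ⊗ B` where `B` consists of the bounded functions with integral values. -/
def boundedMod : ModuleCat.{u} (MonoidAlgebra A G) :=
  repMod (A := A) (V := A ⊗[ℤ] LocallyConstant (Ultrafilter G) ℤ)
    { toFun g := (boundedRep G g).baseChange A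
      map_one' := by rw [map_one, LinearMap.baseChange_one]
      map_mul' g h := by rw [map_mul, LinearMap.baseChange_mul] }

variable (A G) in
/-- The identity map from the module of bounded functions. -/
def boundedEquiv : boundedMod A G ≃ₗ[A] A ⊗[ℤ] LocallyConstant (Ultrafilter G) ℤ :=
  repEquiv _

lemma boundedEquiv_act (g : G) (x : boundedMod A G) :
    boundedEquiv A G (act (boundedMod A G) g x) =
      (boundedRep G g).baseChange A (boundedEquiv A G x) := repEquiv_act _ _ _

/-- Nöbeling's theorem. -/
instance free_bounded (S : Type u) : Module.Free ℤ (LocallyConstant (Ultrafilter S) ℤ) :=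
  LocallyConstant.freeOfProfinite (Profinite.of (Ultrafilter S))

instance free_boundedMod : Module.Free A (boundedMod A G) := .of_equiv (boundedEquiv A G).symm

/-- Bounded functions form a characteristic module as soon as they have finite projective
dimension. -/
lemma mem_xChar_of_pd {G : GrpCat.{u}} (h : pd (MonoidAlgebra A G) (boundedMod A G) < ⊤) :
    G ∈ XChar A := by
  let i : trivialModule A G →ₗ[A] boundedMod A G := (boundedEquiv A G).symm.toLinearMap ∘ₗ
    (TensorProduct.AlgebraTensorModule.mk ℤ A A (LocallyConstant (Ultrafilter G) ℤ)).flip 1 ∘ₗ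
    (trivEquiv A G).toLinearMap
  let ι : trivialModule A G ⟶ boundedMod A G := homMk i fun g x ↦ by
    rw [act_trivial]
    apply (boundedEquiv A G).injective
    rw [boundedEquiv_act]
    change trivEquiv A G x ⊗ₜ 1 = trivEquiv A G x ⊗ₜ boundedRep G g 1
    rfl
  let σ : boundedMod A G →ₗ[A] trivialModule A G := (trivEquiv A G).symm.toLinearMap ∘ₗ
    (TensorProduct.AlgebraTensorModule.rid ℤ A A).toLinearMap ∘ₗ
    (LocallyConstant.evalₗ ℤ (pure 1 : Ultrafilter G)).baseChange A ∘ₗ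
    (boundedEquiv A G).toLinearMap
  have hσ (x : trivialModule A G) : σ (i x) = x := by
    apply (trivEquiv A G).injective
    change (1 : ℤ) • trivEquiv A G x = _
    rw [one_smul]
  refine ⟨boundedMod A G, ι, free_boundedMod, h, Function.LeftInverse.injective hσ,
    ⟨⟨ModuleCat.ofHom (Y := base (trivialModule A G)) σ, ?_⟩⟩⟩
  ext x
  exact hσ x

/-- The identity of the module of bounded functions is a trace from every finite subgroup `H`: multiply
by the characteristic function of a transversal, whose translates under `H` sum to `1`. -/
lemma exists_trace (H : Subgroup G) [Fintype H] :
    ∃ θ : boundedMod A G →ₗ[A] boundedMod A G, ∀ x : boundedMod A G,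
      ∑ h : H, act _ (h : G) (θ (act _ (h : G)⁻¹ x)) = x := by
  obtain ⟨T, hT, -⟩ := H.exists_isComplement_right 1
  have hT' (g : G) : ∃! h : H, (h : G)⁻¹ * g ∈ T :=
    Subgroup.isComplement_iff_existsUnique_inv_mul_mem.1 hT g
  let c : LocallyConstant (Ultrafilter G) ℤ :=
    LocallyConstant.charFn ℤ ⟨ultrafilter_isClosed_basic T, ultrafilter_isOpen_basic T⟩
  have hc : ∑ h : H, boundedRep G (h : G) c = 1 := by
    classical
    ext U
    obtain ⟨h, hh⟩ := (Ultrafilter.eventually_exists_iff (f := U)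
      (P := fun (h : H) g ↦ (h : G)⁻¹ * g ∈ T)).1 (.of_forall fun g ↦ (hT' g).exists)
    have hu (h' : H) : boundedRep G (h' : G) c U = if h' = h then 1 else 0 := by
      have h1 : boundedRep G (h' : G) c U =
        Set.indicator {V : Ultrafilter G | T ∈ V} 1 (U.map ((h' : G)⁻¹ * ·)) := rfl
      rw [h1, Set.indicator_apply]
      split_ifs with h2 h3 h3
      · rfl
      · obtain ⟨g, hg, hg'⟩ := (Filter.Eventually.and hh h2).exists
        exact absurd ((hT' g).unique hg' hg) h3
      · subst h3
        exact absurd hh h2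
      · rfl
    have hsum : (∑ h : H, boundedRep G (h : G) c) U = ∑ h : H, boundedRep G (h : G) c U :=
      map_sum (LocallyConstant.evalₗ ℤ U) _ _
    rw [hsum]
    simp [hu]
  have hmul (g : G) (f : LocallyConstant (Ultrafilter G) ℤ) :
      boundedRep G g (c * boundedRep G g⁻¹ f) = boundedRep G g c * f := by
    have h1 : boundedRep G g (c * boundedRep G g⁻¹ f) =
      boundedRep G g c * boundedRep G g (boundedRep G g⁻¹ f) := rfl
    rw [h1, Representation.self_inv_apply]
  refine ⟨(boundedEquiv A G).symm.toLinearMap ∘ₗ (LinearMap.mulLeft ℤ c).baseChange A ∘ₗ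
    (boundedEquiv A G).toLinearMap, fun x ↦ (boundedEquiv A G).injective ?_⟩
  rw [map_sum]
  have h2 (h : H) := boundedEquiv_act (h : G) ((boundedEquiv A G).symm
    ((LinearMap.mulLeft ℤ c).baseChange A (boundedEquiv A G (act _ (h : G)⁻¹ x))))
  refine (Finset.sum_congr rfl fun h _ ↦ h2 h).trans ?_
  simp only [LinearEquiv.apply_symm_apply, boundedEquiv_act]
  induction boundedEquiv A G x using TensorProduct.induction_on with
  | zero => simp
  | add s t hs ht =>
    simp only [map_add, Finset.sum_add_distrib]
    rw [hs, ht]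
  | tmul a f =>
    simp only [LinearMap.baseChange_tmul, LinearMap.mulLeft_apply, hmul]
    rw [← TensorProduct.tmul_sum, ← Finset.sum_mul, hc, one_mul]

lemma projective_of_finite [Finite G] : Projective (boundedMod A G) := by
  have := Fintype.ofFinite G
  have := Fintype.ofFinite (⊤ : Subgroup G)
  obtain ⟨θ, hθ⟩ := exists_trace (A := A) (⊤ : Subgroup G)
  refine projective_of_trace _ ((IsProjective.iff_projective (R := A) (boundedMod A G)).1
    inferInstance) θ fun x ↦ ?_
  exact (Equiv.sum_comp (Subgroup.topEquiv (G := G)).toEquiv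
    fun g ↦ act (boundedMod A G) g (θ (act (boundedMod A G) g⁻¹ x))).symm.trans (hθ x)

lemma mapDomainRingHom_single {H : Subgroup G} (h : H) (a : A) :
    MonoidAlgebra.mapDomainRingHom A H.subtype (.single h a) = .single (h : G) a := by
  simp

/-- Restriction to a subgroup does not change the underlying module. -/
def resEquiv (H : Subgroup G) (X : ModuleCat.{u} (MonoidAlgebra A G)) :
    (resSubgroup A G H).obj X ≃ₗ[A] X where
  toFun x := x
  invFun x := x
  left_inv _ := rfl
  right_inv _ := rfl
  map_add' _ _ := rfl
  map_smul' a x := by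
    change MonoidAlgebra.mapDomainRingHom A H.subtype (.single 1 a) • (show X from x) = _
    rw [mapDomainRingHom_single]
    rfl

lemma resEquiv_act (H : Subgroup G) (X : ModuleCat.{u} (MonoidAlgebra A G)) (h : H)
    (x : (resSubgroup A G H).obj X) :
    resEquiv H X (act _ h x) = act X (h : G) (resEquiv H X x) := by
  change MonoidAlgebra.mapDomainRingHom A H.subtype (.single h 1) • (show X from x) = _
  rw [mapDomainRingHom_single]
  rfl

lemma projective_res (H : Subgroup G) [Finite H] :
    Projective ((resSubgroup A G H).obj (boundedMod A G)) := by
  have := Fintype.ofFinite H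
  obtain ⟨θ, hθ⟩ := exists_trace (A := A) H
  let e := resEquiv H (boundedMod A G)
  have hfree : Module.Free A ((resSubgroup A G H).obj (boundedMod A G)) := .of_equiv e.symm
  refine projective_of_trace _ ((IsProjective.iff_projective (R := A) _).1 inferInstance)
    (e.symm.toLinearMap ∘ₗ θ ∘ₗ e.toLinearMap) fun x ↦ e.injective ?_
  rw [map_sum]
  refine Eq.trans (Finset.sum_congr rfl fun h _ ↦ ?_) (hθ (e x))
  refine (resEquiv_act H _ h _).trans ?_
  change act _ (h : G) (θ (e (act _ h⁻¹ x))) = _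
  rw [resEquiv_act]
  rfl

variable (A) in
lemma finiteGroups_subset : finiteGroups ⊆ XChar A := by
  intro G hG
  have : Finite G := hG
  exact mem_xChar_of_pd (pd_lt_top_iff.2 ⟨0, pdLE_zero_iff.2 projective_of_finite⟩)

variable (A) in
/-- The module of bounded functions is projective over finite subgroups, hence of finite projective
dimension over a group of type `Φ`. -/
lemma classicalTypePhi_subset : classicalTypePhi A ⊆ XChar A := by
  intro G hG
  refine mem_xChar_of_pd ((hG _).2 fun H hH ↦ ?_)
  have : Finite H := hH
  exact pd_lt_top_iff.2 ⟨0, pdLE_zero_iff.2 (projective_res H)⟩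

attribute [local instance] starRingOfComm in
variable (A) in
lemma xChar_subset : XChar A ⊆ XWChar A := by
  rintro G ⟨M, ι, hfree, hpd, hmono, ⟨⟨σ, hσ⟩⟩⟩
  obtain ⟨n, hn⟩ := pd_lt_top_iff.1 hpd
  refine ⟨M, ι, inferInstance, fd_lt_top_iff.2 ⟨n, .of_pdLE hn⟩, hmono, fun X ↦ ?_⟩
  have h : σ.hom ∘ₗ ((resBase A G).map ι).hom = LinearMap.id := by
    ext x
    exact congr($hσ x)
  have h' : LinearMap.lTensor X σ.hom ∘ₗ LinearMap.lTensor X ((resBase A G).map ι).hom =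
      LinearMap.id := by
    rw [← LinearMap.lTensor_comp, h, LinearMap.lTensor_id]
  exact Function.LeftInverse.injective (g := LinearMap.lTensor X σ.hom) fun t ↦ congr($h' t)

end

/-! ### Embeddings into modules of finite flat dimension -/

section Approximation

variable {R : Type u} [Ring R]

/-- A free module of countable rank. -/
abbrev freeCountable (R : Type u) [Ring R] : ModuleCat.{u} R := ModuleCat.of R (ULift.{u} ℕ →₀ R)

/-- Maps from a countably generated module to a free module factor through a free module of countable
rank. -/
lemma exists_factor_freeCountable {X : ModuleCat.{u} R} (q : freeCountable R ⟶ X)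
    (hq : Function.Surjective q.hom) {T : Type u} (v : X ⟶ ModuleCat.of R (T →₀ R)) :
    ∃ (i : X ⟶ freeCountable R) (r : freeCountable R ⟶ ModuleCat.of R (T →₀ R)), i ≫ r = v := by
  classical
  let f (k : ULift.{u} ℕ) : T →₀ R := v.hom (q.hom (Finsupp.single k 1))
  let S : Set T := ⋃ k, ((f k).support : Set T)
  have hS : S.Countable := Set.countable_iUnion fun k ↦ (f k).support.countable_toSet
  have : Countable S := hS.to_subtype
  obtain ⟨j, hj⟩ := exists_injective_nat S
  let m : ModuleCat.of R (T →₀ R) ⟶ freeCountable R := ModuleCat.ofHom (Finsupp.linearCombination R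
    fun t ↦ if h : t ∈ S then Finsupp.single ⟨j ⟨t, h⟩⟩ 1 else 0)
  let r : freeCountable R ⟶ ModuleCat.of R (T →₀ R) := ModuleCat.ofHom (Finsupp.linearCombination R
    fun k ↦ if h : ∃ s, j s = k.down then Finsupp.single h.choose.1 1 else 0)
  refine ⟨v ≫ m, r, ?_⟩
  have hr (t : T) (ht : t ∈ S) : r.hom (m.hom (Finsupp.single t 1)) = Finsupp.single t 1 := by
    have hex : ∃ s, j s = j ⟨t, ht⟩ := ⟨_, rfl⟩
    have hc : hex.choose = ⟨t, ht⟩ := hj hex.choose_spec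
    change Finsupp.linearCombination R _ (Finsupp.linearCombination R _ (Finsupp.single t 1)) = _
    rw [Finsupp.linearCombination_single, one_smul, dif_pos ht, Finsupp.linearCombination_single,
      one_smul]
    change (if h : ∃ s, j s = j ⟨t, ht⟩ then Finsupp.single h.choose.1 1 else 0) = _
    rw [dif_pos hex, hc]
  have hf (g : T →₀ R) (hg : (g.support : Set T) ⊆ S) : r.hom (m.hom g) = g := by
    conv_rhs => rw [← Finsupp.sum_single g]
    conv_lhs => rw [← Finsupp.sum_single g]
    rw [Finsupp.sum, map_sum, map_sum]
    refine Finset.sum_congr rfl fun t ht ↦ ?_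
    have h1 : (Finsupp.single t (g t) : T →₀ R) = g t • Finsupp.single t 1 := by simp
    rw [h1, map_smul, map_smul, hr t (hg ht)]
  have := (ModuleCat.epi_iff_surjective q).2 hq
  rw [← cancel_epi q]
  refine ModuleCat.hom_ext (Finsupp.lhom_ext' fun k ↦ LinearMap.ext_ring ?_)
  exact hf (f k) (Set.subset_iUnion (fun k ↦ ((f k).support : Set T)) k)

/-- Repeating equations does not affect solvability. -/
lemma Solvable.comp_surjective {M : Type u} [AddCommGroup M] [Module R M] {ι κ : Type*} {ρ : ι → M}
    {X : ModuleCat.{u} R} (h : Solvable ρ X) {f : κ → ι} (hf : Function.Surjective f) :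
    Solvable (fun k ↦ ρ (f k)) X := by
  intro a ha
  let g := Function.surjInv hf
  have hg (i : ι) : f (g i) = i := Function.surjInv_eq hf i
  obtain ⟨t, ht⟩ := h (a ∘ g) fun c hc ↦ by
    rw [← Finsupp.linearCombination_mapDomain]
    apply ha
    rw [Finsupp.linearCombination_mapDomain]
    exact (congrArg (fun σ ↦ Finsupp.linearCombination R σ c)
      (funext fun i ↦ congrArg ρ (hg i))).trans hc
  refine ⟨t, fun k ↦ (ht (f k)).trans ?_⟩
  have := ha (Finsupp.single (g (f k)) 1 - Finsupp.single k 1) (by simp [hg])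
  simpa [sub_eq_zero] using this

variable [StarRing R]

/-- Maps from `X` to modules of flat dimension at most `n` extend along `i`. -/
def Extends (n : ℕ) {X Y : ModuleCat.{u} R} (i : X ⟶ Y) : Prop :=
  ∀ Q : ModuleCat.{u} R, FdLE Q n → ∀ φ : X ⟶ Q, ∃ ψ : Y ⟶ Q, i ≫ ψ = φ

/-- `X` is left orthogonal to the modules of flat dimension at most `n`. -/
def LeftOrth (n : ℕ) (X : ModuleCat.{u} R) : Prop :=
  ∀ Q : ModuleCat.{u} R, FdLE Q n → ExtVanish X Q 1

variable {n : ℕ}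

/-- A countably generated module `X` which is orthogonal to the modules of finite flat dimension embeds
in a free module of countable rank, with quotient having the same property. Indeed, the product of an
injective hull of `X` and of copies of the free module indexed by all maps from `X` to it has
finite flat dimension, and so the map from `X` to it lifts to a free module; the lift involves only
countably many basis elements. -/
lemma SfliLE.exists_embedding (hR : SfliLE R n) {X : ModuleCat.{u} R} (q : freeCountable R ⟶ X)
    (hq : Function.Surjective q.hom) (hX : LeftOrth n X) :
    ∃ i : X ⟶ freeCountable R, Function.Injective i.hom ∧ Extends n i := by
  let Pi : ModuleCat.{u} R := piMod fun _ : X ⟶ freeCountable R ↦ freeCountable R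
  let T : ModuleCat.{u} R := prodMod Pi (Injective.under X)
  have hE : FdLE (Injective.under X) n := hR (Injective.under X) inferInstance
  have hPi : FdLE Pi n := hR.fdLE_pi fun _ ↦ .of_projective _ _
  have hT : FdLE T n := (ses_prod Pi (Injective.under X)).fdLE₂ hPi hE
  let c : X ⟶ T := ModuleCat.ofHom
    (LinearMap.prod (LinearMap.pi fun φ : X ⟶ freeCountable R ↦ φ.hom) (Injective.ι X).hom)
  have hlift (Q : ModuleCat.{u} R) (hQ : FdLE Q n) (φ : X ⟶ Q) :
      ∃ φ' : X ⟶ freeCover Q, φ' ≫ freeCoverMap Q = φ :=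
    (ses_syz Q).colift (hX _ ((ses_syz Q).fdLE₁ (.of_projective _ _) hQ)) φ
  obtain ⟨v, hv⟩ := hlift T hT c
  obtain ⟨i, r, hir⟩ := exists_factor_freeCountable q hq v
  have hext (φ : X ⟶ freeCountable R) : ∃ ψ : freeCountable R ⟶ freeCountable R, i ≫ ψ = φ := by
    refine ⟨r ≫ freeCoverMap T ≫ ModuleCat.ofHom (LinearMap.proj φ ∘ₗ LinearMap.fst R Pi _), ?_⟩
    rw [← Category.assoc, hir, ← Category.assoc, hv]
    rfl
  refine ⟨i, ?_, fun Q hQ φ ↦ ?_⟩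
  · rw [injective_iff_map_eq_zero]
    intro x hx
    have h1 : v.hom x = r.hom (i.hom x) := congr($hir x).symm
    have h2 : c.hom x = (freeCoverMap T).hom (v.hom x) := congr($hv x).symm
    rw [h1, hx, map_zero, map_zero] at h2
    exact injective_ι_injective X ((congrArg Prod.snd h2).trans (map_zero _).symm)
  · obtain ⟨φ', rfl⟩ := hlift Q hQ φ
    obtain ⟨i', r', rfl⟩ := exists_factor_freeCountable q hq φ'
    obtain ⟨ψ, rfl⟩ := hext i'
    exact ⟨ψ ≫ r' ≫ freeCoverMap Q, by simp⟩

variable (n) in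
/-- Maps from a submodule `V` of a free module of countable rank to `Y` extend to the free module,
provided that maps from `V` to the modules of flat dimension at most `n` do. -/
def RightOrth (Y : ModuleCat.{u} R) : Prop :=
  ∀ (V : ModuleCat.{u} R) (i : V ⟶ freeCountable R), Function.Injective i.hom → Extends n i →
    ∀ φ : V ⟶ Y, ∃ ψ : freeCountable R ⟶ Y, i ≫ ψ = φ

lemma SES.leftOrth {X Y Z : ModuleCat.{u} R} {f : X ⟶ Y} {g : Y ⟶ Z} (h : SES f g)
    [Projective Y] (hf : Extends n f) : LeftOrth n Z :=
  fun Q hQ ↦ h.ext_one (extVanish_of_projective _ _ _) (hf Q hQ)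

/-- A map to `Y` from a countably presented module as in `RightOrth` factors through a free module
by `SfliLE.exists_embedding`, and hence lifts to the free cover of `Y`. -/
lemma RightOrth.syz (hR : SfliLE R n) {Y : ModuleCat.{u} R} (hY : RightOrth n Y) :
    RightOrth n (syz Y) := by
  intro V i hi hext φ
  have e := ses_coker i hi
  have hX := e.leftOrth hext
  refine e.extend ((ses_syz Y).coext_one (hX _ (.of_projective _ _)) fun θ ↦ ?_) φ
  obtain ⟨i₂, hi₂, hext₂⟩ := hR.exists_embedding _ e.surj hX
  obtain ⟨θ', rfl⟩ := hY _ i₂ hi₂ hext₂ θ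
  have := (ModuleCat.epi_iff_surjective _).2 (freeCoverMap_surjective Y)
  exact ⟨i₂ ≫ Projective.factorThru θ' (freeCoverMap Y), by simp⟩

lemma torOrth_syz {N : ModuleCat.{u} R} : TorOrth n (TypePhi.syz^[n] N) := fun _ hY ↦
  ext_syz_of_ext (i := 0) (idLE_vanish hY N (by lia))

/-- Every finite subset of the kernel of a free cover of a `TorOrth` module lies in a countably
generated submodule, modulo which the free module is still `TorOrth`. -/
lemma SfliLE.exists_countable_syz (hR : SfliLE R n) {K : ModuleCat.{u} R} (hK : TorOrth n K)
    (s : Set (syz K)) (hs : s.Finite) :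
    ∃ ρ : ℕ → syz K, s ⊆ Set.range ρ ∧ ∀ Y : ModuleCat.{u} R, FdLE Y n →
      Solvable (fun k ↦ (ρ k : K →₀ R)) (ch Y) := by
  classical
  let d₁ : syz K → K →₀ R := Subtype.val
  let d₂ : syz (syz K) → syz K →₀ R := Subtype.val
  have hd₁ (x : syz K →₀ R) :
      Finsupp.linearCombination R d₁ x = ((freeCoverMap (syz K)).hom x : syz K).1 :=
    (Finsupp.apply_linearCombination R
      (LinearMap.ker (freeCoverMap K).hom).subtype (id : syz K → syz K) x).symm
  have hd (c : syz (syz K)) : Finsupp.linearCombination R d₁ (d₂ c) = 0 := by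
    rw [hd₁]
    exact congrArg Subtype.val (LinearMap.mem_ker.1 c.2)
  have hex (Y : ModuleCat.{u} R) (hY : FdLE Y n) (z : syz K →₀ Y) (hz : tens d₁ Y z = 0) :
      ∃ w, tens d₂ Y w = z := by
    refine tens_exact_of_exists_factor d₂ d₁ (fun φ hφ ↦ ?_) z hz
    obtain ⟨χ, hχ⟩ := (ses_syz (syz K)).desc (N := ch Y) (ModuleCat.ofHom φ) (by
      refine ModuleCat.hom_ext (LinearMap.ext fun c ↦ ?_)
      have := congr($hφ (Finsupp.single c 1))
      rw [LinearMap.comp_apply, Finsupp.linearCombination_single, one_smul] at this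
      exact this)
    obtain ⟨ψ, rfl⟩ := (ses_syz K).extend (hK Y hY) χ
    refine ⟨ψ.hom, LinearMap.ext fun x ↦ ?_⟩
    rw [LinearMap.comp_apply, hd₁]
    exact congr($hχ x)
  -- a countable set `N` of syzygies on which the presentation stays exact after tensoring
  choose v hv using fun t ↦ hR.exists_uniform d₂ d₁ ∅ ∅ t fun Y hY z _ hz ↦ by
    obtain ⟨w, rfl⟩ := hex Y hY z (Finsupp.ext fun c ↦ hz c (Set.notMem_empty c))
    exact ⟨w, fun _ _ ↦ rfl⟩
  obtain ⟨N, hsN, hN, hvN⟩ := exists_countable_closure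
    (fun t ↦ (v t).biUnion fun c ↦ (d₂ c).support) (hs.countable.union (Set.countable_singleton 0))
  have : Countable N := hN.to_subtype
  have : Nonempty N := ⟨⟨0, hsN (Or.inr rfl)⟩⟩
  have hNs (Y : ModuleCat.{u} R) (hY : FdLE Y n) : Solvable (fun b : N ↦ d₁ b) (ch Y) := by
    intro h hh
    let d₂' (c : syz (syz K)) : N →₀ R := if ((d₂ c).support : Set (syz K)) ⊆ N then
      (d₂ c).comapDomain (fun b : N ↦ (b : syz K)) Subtype.val_injective.injOn else 0
    obtain ⟨ψ, hψ⟩ := exists_factor_of_tens_exact (Y := Y) d₂' (fun b : N ↦ d₁ b)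
      (fun z hz ↦ by
        obtain ⟨w, hw, hwz⟩ := hv (inc N z).support Y hY (inc N z) subset_rfl fun c _ ↦ by
          refine Eq.trans ?_ (DFunLike.congr_fun hz c)
          rw [tens_apply, tens_apply, Finsupp.sum_mapDomain_index (by simp) (by simp)]
        refine ⟨w, Finsupp.ext fun b ↦ ?_⟩
        rw [← inc_apply z b.2, ← hwz b (Set.notMem_empty _), tens_apply, tens_apply]
        refine Finsupp.sum_congr fun c hc ↦ ?_
        have : ((d₂ c).support : Set (syz K)) ⊆ N := by
          refine Set.Subset.trans ?_ (hvN (inc N z).support fun b hb ↦ ?_)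
          · exact Finset.coe_subset.2 (Finset.subset_biUnion_of_mem (fun c ↦ (d₂ c).support)
              (hw hc))
          · by_contra hbN
            exact Finsupp.mem_support_iff.1 hb (inc_apply_of_notMem z hbN)
        simp only [d₂', if_pos this]
        rfl)
      (Finsupp.linearCombination R h) (by
        refine Finsupp.lhom_ext' fun c ↦ LinearMap.ext_ring ?_
        change Finsupp.linearCombination R h (Finsupp.linearCombination R d₂' (Finsupp.single c 1)) = 0
        rw [Finsupp.linearCombination_single, one_smul]
        by_cases hc : ((d₂ c).support : Set (syz K)) ⊆ N
        · refine hh _ ?_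
          rw [← Function.comp_def d₁, ← Finsupp.linearCombination_mapDomain, ← hd c]
          congr 1
          simp only [d₂', if_pos hc]
          exact Finsupp.mapDomain_comapDomain _ Subtype.val_injective _ (by simpa using hc)
        · simp only [d₂', if_neg hc, map_zero])
    refine ⟨ψ, fun b ↦ ?_⟩
    have := congr($hψ (Finsupp.single b 1))
    rw [LinearMap.comp_apply, Finsupp.linearCombination_single,
      Finsupp.linearCombination_single, one_smul, one_smul] at this
    exact this
  obtain ⟨f, hf⟩ := exists_surjective_nat N
  refine ⟨fun k ↦ f k, fun b hb ↦ ?_, fun Y hY ↦ (hNs Y hY).comp_surjective hf⟩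
  obtain ⟨k, hk⟩ := hf ⟨b, hsN (Or.inl hb)⟩
  exact ⟨k, congrArg Subtype.val hk⟩

/-- A `TorOrth` module is flat if its first syzygy is right orthogonal: the inclusion of the syzygy in
the free cover is pure, since every finite system of equations is solved within a pushout along an
embedding of a countably generated submodule in a free module. -/
lemma SfliLE.fdLE_zero (hR : SfliLE R n) {K : ModuleCat.{u} R} (hK : TorOrth n K)
    (hK' : RightOrth n (syz K)) : FdLE K 0 := by
  have hp : EqPure (ModuleCat.ofHom (LinearMap.ker (freeCoverMap K).hom).subtype) := by
    intro κ ι _ σ a t hta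
    obtain ⟨ρ, hρ, hsol⟩ := hR.exists_countable_syz hK (Set.range a) (Set.finite_range a)
    let ρ' : ℕ → K →₀ R := fun k ↦ ρ k
    let V : Submodule R (K →₀ R) := Submodule.span R (Set.range ρ')
    have hV : V ≤ LinearMap.ker (freeCoverMap K).hom := Submodule.span_le.2 (by
      rintro _ ⟨k, rfl⟩
      exact (ρ k).2)
    let i : ModuleCat.of R V ⟶ freeCover K := ModuleCat.ofHom V.subtype
    have e := ses_coker i Subtype.val_injective
    have hr : Submodule.span R (Set.range ρ') = LinearMap.range i.hom := V.range_subtype.symm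
    have hU : TorOrth n _ := fun Y hY ↦ ext_of_solvable e ρ' hr (hsol Y hY)
    have hVo : LeftOrth n (ModuleCat.of R V) := fun Q hQ ↦
      e.ext₁ (extVanish_of_projective _ _ _) (hR.ext_two e ρ' hr hU hQ)
    let q : freeCountable R ⟶ ModuleCat.of R V := ModuleCat.ofHom
      (Finsupp.linearCombination R fun k ↦ ⟨ρ' k.down, Submodule.subset_span ⟨_, rfl⟩⟩)
    have hq : Function.Surjective q.hom := by
      rintro ⟨x, hx⟩
      obtain ⟨c, rfl⟩ := Finsupp.mem_span_range_iff_exists_finsupp.1 hx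
      refine ⟨c.mapDomain ULift.up, Subtype.ext ?_⟩
      change V.subtype (Finsupp.linearCombination R _ _) = _
      rw [Finsupp.linearCombination_mapDomain, Finsupp.apply_linearCombination]
      rfl
    -- solve the system in the free module containing `V`, which is pure in the pushout, and map the
    -- solution to the syzygy
    obtain ⟨j, hj, hext⟩ := hR.exists_embedding q hq hVo
    obtain ⟨g, hg⟩ := hK' _ j hj hext (ModuleCat.ofHom (Submodule.inclusion hV))
    obtain ⟨L, f', g', ψ, e', hsq, -, -⟩ := e.pushout j
    have hpure := hR.eqPure e' (.of_projective _ _) hU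
    have ha (x : ι) : (a x : K →₀ R) ∈ V := by
      obtain ⟨k, hk⟩ := hρ ⟨x, rfl⟩
      rw [← hk]
      exact Submodule.subset_span ⟨k, rfl⟩
    obtain ⟨t', ht'⟩ := hpure κ ι σ (fun x ↦ j.hom ⟨a x, ha x⟩) (ψ.hom ∘ₗ t) fun x ↦ by
      refine (congrArg ψ.hom (hta x)).trans ?_
      exact congr($hsq ⟨a x, ha x⟩)
    refine ⟨g.hom ∘ₗ t', fun x ↦ ?_⟩
    refine (congrArg g.hom (ht' x)).trans ?_
    exact congr($hg ⟨a x, ha x⟩)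
  obtain ⟨σ, hσ⟩ := hp.dual_split
  have e := (ses_syz K).ch
  obtain ⟨r, hr⟩ := e.lift (𝟙 _ - chMap _ ≫ σ) (by
    rw [Preadditive.sub_comp, Category.assoc, hσ, Category.id_comp, Category.comp_id, sub_self])
  have := (ModuleCat.mono_iff_injective _).2 e.inj
  refine idLE_retract (Y := ch (freeCover K)) ⟨chMap (freeCoverMap K), r, ?_⟩
    (idLE_zero_iff.2 (injective_ch_of_projective _))
  rw [← cancel_mono (chMap (freeCoverMap K)), Category.assoc, hr, Preadditive.comp_sub,
    ← Category.assoc, e.comp_zero]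
  simp

end Approximation

/-! ### The small object argument -/

section SmallObject

open MorphismProperty

variable {R : Type u} [Ring R] [StarRing R] {n : ℕ}

variable (R n) in
/-- The inclusions of those submodules of a free module of countable rank from which maps
to the modules of flat dimension at most `n` extend. -/
def extendingMaps : MorphismProperty (ModuleCat.{u} R) :=
  ofHoms fun S : {S : Subobject (freeCountable R) // Extends n S.arrow} ↦ S.1.arrow

instance : IsSmall.{u} (extendingMaps R n) := by
  dsimp [extendingMaps]
  infer_instance

lemma mem_extendingMaps (S : Subobject (freeCountable R)) (hS : Extends n S.arrow) :
    extendingMaps R n S.arrow :=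
  ofHoms.mk (f := fun S : {S : Subobject (freeCountable R) // Extends n S.arrow} ↦ S.1.arrow) ⟨S, hS⟩

lemma extendingMaps_le : extendingMaps R n ≤ monomorphisms (ModuleCat.{u} R) := by
  rintro _ _ _ ⟨S⟩
  exact inferInstanceAs (Mono S.1.arrow)

instance : HasSmallObjectArgument.{u} (extendingMaps R n) := by
  obtain ⟨κ, hκ', hκ⟩ := HasCardinalLT.exists_regular_cardinal.{u} (Subobject (freeCountable R))
  have : Fact κ.IsRegular := ⟨hκ'⟩
  have : Nonempty κ.ord.ToType := by simpa using hκ'.ne_zero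
  have := WellFoundedLT.toOrderBot κ.ord.ToType
  exact ⟨κ, inferInstance, inferInstance,
    { preservesColimit {A B X Y} i hi f hf := by
        let hf' : (monomorphisms _).TransfiniteCompositionOfShape κ.ord.ToType f :=
          { toTransfiniteCompositionOfShape := hf.toTransfiniteCompositionOfShape
            map_mem j hj := by
              have := (hf.attachCells j hj).pushouts_coproducts
              simp only [ofHoms_homFamily] at this
              refine (?_ : _ ≤ monomorphisms _) _ this
              rw [pushouts_le_iff, coproducts_le_iff.{u}]
              exact extendingMaps_le (R := R) (n := n) }
        have (j j' : κ.ord.ToType) (φ : j ⟶ j') : Mono (hf'.F.map φ) := hf'.mem_map φ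
        apply IsGrothendieckAbelian.preservesColimit_coyoneda_obj_of_mono (Y := hf'.F) (κ := κ)
        obtain ⟨S⟩ := hi
        exact Subobject.hasCardinalLT_of_mono hκ S.1.arrow }⟩

lemma extends_of_mem {X Y : ModuleCat.{u} R} {i : X ⟶ Y} (hi : extendingMaps R n i) :
    Function.Injective i.hom ∧ Extends n i ∧ Projective Y := by
  obtain ⟨S⟩ := hi
  exact ⟨(ModuleCat.mono_iff_injective _).1 (inferInstanceAs (Mono S.1.arrow)), S.2,
    projective_finsupp _⟩

lemma rightOrth_of_rlp {N Z : ModuleCat.{u} R} {p : N ⟶ Z} (hp : (extendingMaps R n).rlp p)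
    (hZ : Limits.IsZero Z) : RightOrth n N := by
  intro V i hi hext φ
  have := (ModuleCat.mono_iff_injective i).2 hi
  let e := Subobject.underlyingIso i
  have he : e.hom ≫ i = (Subobject.mk i).arrow := Subobject.underlyingIso_hom_comp_eq_mk i
  have hS : extendingMaps R n (Subobject.mk i).arrow := mem_extendingMaps _ fun Q hQ φ ↦ by
    obtain ⟨ψ, hψ⟩ := hext Q hQ (e.inv ≫ φ)
    exact ⟨ψ, by rw [← he, Category.assoc, hψ, Iso.hom_inv_id_assoc]⟩
  have := hp _ hS
  have sq : CommSq (e.hom ≫ φ) (Subobject.mk i).arrow p 0 := ⟨hZ.eq_of_tgt _ _⟩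
  refine ⟨sq.lift, ?_⟩
  rw [← cancel_epi e.hom, ← Category.assoc, he, sq.fac_left]

/-- A surjection from an injective module with kernel of finite flat dimension has the right lifting
property. -/
lemma rlp_of_ses {Q E Q' : ModuleCat.{u} R} {j : Q ⟶ E} {π : E ⟶ Q'} (h : SES j π) [Injective E]
    (hQ : FdLE Q n) : (extendingMaps R n).rlp π := by
  intro V F i hi
  obtain ⟨hinj, hext, hF⟩ := extends_of_mem hi
  have := (ModuleCat.mono_iff_injective i).2 hinj
  refine ⟨fun {a b} sq ↦ ?_⟩
  obtain ⟨U, g, e⟩ : ∃ (U : ModuleCat.{u} R) (g : F ⟶ U), SES i g := ⟨_, _, ses_coker i hinj⟩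
  obtain ⟨w, hw⟩ := e.desc (b - Injective.factorThru a i ≫ π) (by
    rw [Preadditive.comp_sub, Injective.comp_factorThru_assoc, sq.w, sub_self])
  obtain ⟨w', rfl⟩ := h.colift (e.leftOrth hext Q hQ) w
  refine ⟨⟨⟨Injective.factorThru a i + g ≫ w', ?_, ?_⟩⟩⟩
  · rw [Preadditive.comp_add, Injective.comp_factorThru, ← Category.assoc, e.comp_zero,
      Limits.zero_comp, add_zero]
  · rw [Preadditive.add_comp, Category.assoc, hw, add_sub_cancel]

variable (n) in
/-- The small object argument embeds every module in a `RightOrth` module. The quotient `W` is left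
orthogonal: for an injective module `E` containing `Q`, a map `W → E / Q` lifts to a map to `E`
vanishing on `X`, since `E → E / Q` has the right lifting property. -/
lemma exists_ses_rightOrth (X : ModuleCat.{u} R) :
    ∃ (N W : ModuleCat.{u} R) (i : X ⟶ N) (g : N ⟶ W), SES i g ∧ RightOrth n N ∧ LeftOrth n W := by
  let D := factorizationData (extendingMaps R n).rlp.llp (extendingMaps R n).rlp
    (0 : X ⟶ ModuleCat.of R PUnit.{u + 1})
  have hzero : Limits.IsZero (ModuleCat.of R PUnit.{u + 1}) := ModuleCat.isZero_of_subsingleton _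
  have hinj : Function.Injective D.i.hom := by
    have hE : (extendingMaps R n).rlp
        (0 : Injective.under X ⟶ ModuleCat.of R PUnit.{u + 1}) := by
      intro V F i hi
      have := (ModuleCat.mono_iff_injective i).2 (extends_of_mem hi).1
      exact ⟨fun {a b} sq ↦ ⟨⟨⟨Injective.factorThru a i, Injective.comp_factorThru a i,
        hzero.eq_of_tgt _ _⟩⟩⟩⟩
    have := D.hi _ hE
    have sq : CommSq (Injective.ι X) D.i
      (0 : Injective.under X ⟶ ModuleCat.of R PUnit.{u + 1}) 0 := ⟨by simp⟩
    refine Function.Injective.of_comp (f := sq.lift.hom) ?_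
    have h := injective_ι_injective X
    rw [← sq.fac_left] at h
    exact h
  obtain ⟨W, g, e⟩ : ∃ (W : ModuleCat.{u} R) (g : D.Z ⟶ W), SES D.i g := ⟨_, _, ses_coker D.i hinj⟩
  refine ⟨D.Z, W, D.i, g, e, rightOrth_of_rlp D.hp hzero, fun Q hQ ↦ ?_⟩
  obtain ⟨E, Q', j, π, hE, eQ⟩ : ∃ (E Q' : ModuleCat.{u} R) (j : Q ⟶ E) (π : E ⟶ Q'),
      Injective E ∧ SES j π := ⟨_, _, _, _, inferInstance, ses_cosyz Q⟩
  refine eQ.coext_one (extVanish_of_injective _ _ 0) fun φ ↦ ?_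
  have := D.hi _ (rlp_of_ses eQ hQ)
  have sq : CommSq (0 : X ⟶ E) D.i π (g ≫ φ) := ⟨by
    rw [Limits.zero_comp, ← Category.assoc, e.comp_zero, Limits.zero_comp]⟩
  obtain ⟨ψ, hψ⟩ := e.desc sq.lift sq.fac_left
  have := (ModuleCat.epi_iff_surjective g).2 e.surj
  exact ⟨ψ, by rw [← cancel_epi g, ← Category.assoc, hψ, sq.fac_right]⟩

/-- All syzygies of a `RightOrth` module are `RightOrth`, and the `n`-th one is `TorOrth`, hence flat. -/
lemma SfliLE.fdLE_of_rightOrth (hR : SfliLE R n) {N : ModuleCat.{u} R} (hN : RightOrth n N) :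
    FdLE N n := by
  have h (m : ℕ) : RightOrth n (syz^[m] N) := by
    induction m with
    | zero => exact hN
    | succ m ih =>
      rw [Function.iterate_succ_apply']
      exact ih.syz hR
  have h' := h (n + 1)
  rw [Function.iterate_succ_apply'] at h'
  refine hasResolution_isFlat_iff.1 (hasResolution_of_syz (fun M ↦ ?_) ?_)
  · exact (isFlat_iff _).2 (injective_ch_of_projective _)
  · exact (isFlat_iff _).2 (idLE_zero_iff.1 (hR.fdLE_zero torOrth_syz h'))

/-- Over a ring with finite `sfli`, every module embeds in a module of finite flat dimension,
with quotient orthogonal to all such modules. -/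
theorem SfliLE.exists_ses (hR : SfliLE R n) (X : ModuleCat.{u} R) :
    ∃ (N W : ModuleCat.{u} R) (i : X ⟶ N) (g : N ⟶ W), SES i g ∧ FdLE N n ∧ LeftOrth n W := by
  obtain ⟨N, W, i, g, e, hN, hW⟩ := exists_ses_rightOrth n X
  exact ⟨N, W, i, g, e, hR.fdLE_of_rightOrth hN, hW⟩

end SmallObject

/-! ### Coinduced modules and weak characteristic modules -/

section Coinduction

attribute [local instance] starRingOfComm

variable {A : Type u} [CommRing A] {G : Type u} [Group G]

variable (G) in
/-- The module coinduced from the trivial group: `G` acts by right translation on the functions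
from `G` to `Y`. -/
def coind (Y : ModuleCat.{u} A) : ModuleCat.{u} (MonoidAlgebra A G) :=
  repMod (V := G → Y)
    { toFun g := LinearMap.funLeft A Y fun x ↦ x * g
      map_one' := by ext f x; simp [LinearMap.funLeft]
      map_mul' g h := by ext f x; simp [LinearMap.funLeft, mul_assoc] }

/-- The elements of the coinduced module as functions. -/
def coindEquiv (Y : ModuleCat.{u} A) : coind G Y ≃ₗ[A] (G → Y) := repEquiv _

lemma coindEquiv_act (Y : ModuleCat.{u} A) (g : G) (f : coind G Y) (x : G) :
    coindEquiv Y (act (coind G Y) g f) x = coindEquiv Y f (x * g) :=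
  congrFun (repEquiv_act _ g f) x

/-- Evaluation at the neutral element. -/
def coindEv (Y : ModuleCat.{u} A) : base (coind G Y) ⟶ Y :=
  ModuleCat.ofHom (LinearMap.proj 1 ∘ₗ (coindEquiv Y).toLinearMap)

/-- The map to the coinduced module given by an `A`-linear map. -/
def toCoind {X : ModuleCat.{u} (MonoidAlgebra A G)} {Y : ModuleCat.{u} A} (φ : base X ⟶ Y) :
    X ⟶ coind G Y :=
  homMk ((coindEquiv Y).symm.toLinearMap ∘ₗ LinearMap.pi fun g ↦ φ.hom ∘ₗ act X g) fun g x ↦ by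
    refine (coindEquiv Y).injective (funext fun h ↦ ?_)
    rw [coindEquiv_act]
    change φ.hom (act X h (act X g x)) = φ.hom (act X (h * g) x)
    rw [map_mul]
    rfl

lemma toCoind_comp_coindEv {X : ModuleCat.{u} (MonoidAlgebra A G)} {Y : ModuleCat.{u} A}
    (φ : base X ⟶ Y) : baseMap (toCoind φ) ≫ coindEv Y = φ := by
  ext x
  change φ.hom (act X 1 x) = φ.hom x
  rw [map_one]
  rfl

lemma coind_hom_ext {X : ModuleCat.{u} (MonoidAlgebra A G)} {Y : ModuleCat.{u} A}
    {f f' : X ⟶ coind G Y} (h : baseMap f ≫ coindEv Y = baseMap f' ≫ coindEv Y) : f = f' := by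
  ext x
  refine (coindEquiv Y).injective (funext fun g ↦ ?_)
  have h1 : coindEquiv Y (f.hom (act X g x)) 1 = coindEquiv Y (f'.hom (act X g x)) 1 :=
    congr($h (act X g x))
  rwa [hom_act, hom_act, coindEquiv_act, coindEquiv_act, one_mul] at h1

/-- If maps from `base X` extend along `f`, so do maps from `X` to coinduced modules, and
conversely. -/
lemma extend_coind_iff {X X' : ModuleCat.{u} (MonoidAlgebra A G)} {Y : ModuleCat.{u} A}
    (f : X ⟶ X') : (∀ φ : X ⟶ coind G Y, ∃ ψ : X' ⟶ coind G Y, f ≫ ψ = φ) ↔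
      ∀ φ : base X ⟶ Y, ∃ ψ : base X' ⟶ Y, baseMap f ≫ ψ = φ := by
  constructor
  · intro h φ
    obtain ⟨ψ, hψ⟩ := h (toCoind φ)
    refine ⟨baseMap ψ ≫ coindEv Y, ?_⟩
    rw [← toCoind_comp_coindEv φ, ← hψ]
    rfl
  · intro h φ
    obtain ⟨ψ, hψ⟩ := h (baseMap φ ≫ coindEv Y)
    refine ⟨toCoind ψ, coind_hom_ext ?_⟩
    rw [← hψ]
    change baseMap f ≫ baseMap (toCoind ψ) ≫ coindEv Y = _
    rw [toCoind_comp_coindEv]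

lemma injective_coind {I : ModuleCat.{u} A} (hI : Injective I) : Injective (coind G I) where
  factors φ f hf := by
    have hf' := (ModuleCat.mono_iff_injective f).1 hf
    have : Mono (baseMap f) := (ModuleCat.mono_iff_injective _).2 hf'
    exact (extend_coind_iff f).2 (fun φ ↦ hI.factors φ (baseMap f)) φ

/-- The map of coinduced modules given by composition. -/
def coindMap {Y Z : ModuleCat.{u} A} (f : Y ⟶ Z) : coind G Y ⟶ coind G Z :=
  toCoind (coindEv Y ≫ f)

lemma coindEquiv_coindMap {Y Z : ModuleCat.{u} A} (f : Y ⟶ Z) (c : coind G Y) (g : G) :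
    coindEquiv Z ((coindMap f).hom c) g = f.hom (coindEquiv Y c g) := by
  change f.hom (coindEquiv Y (act (coind G Y) g c) 1) = _
  rw [coindEquiv_act, one_mul]

lemma SES.coind {X Y Z : ModuleCat.{u} A} {f : X ⟶ Y} {g : Y ⟶ Z} (h : SES f g) :
    SES (coindMap (G := G) f) (coindMap g) where
  inj a b hab := (coindEquiv X).injective <| funext fun x ↦ h.inj <| by
    rw [← coindEquiv_coindMap, ← coindEquiv_coindMap, hab]
  exact b := by
    constructor
    · intro hb
      choose a ha using fun x ↦ (h.exact (coindEquiv Y b x)).1 (by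
        rw [← coindEquiv_coindMap, hb, map_zero]; rfl)
      refine ⟨(coindEquiv X).symm a, (coindEquiv Y).injective (funext fun x ↦ ?_)⟩
      rw [coindEquiv_coindMap, LinearEquiv.apply_symm_apply, ha]
    · rintro ⟨a, rfl⟩
      refine (coindEquiv Z).injective (funext fun x ↦ ?_)
      rw [coindEquiv_coindMap, coindEquiv_coindMap, h.exact.apply_apply_eq_zero, map_zero]
      rfl
  surj c := by
    choose b hb using fun x ↦ h.surj (coindEquiv Z c x)
    refine ⟨(coindEquiv Y).symm b, (coindEquiv Z).injective (funext fun x ↦ ?_)⟩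
    rw [coindEquiv_coindMap, LinearEquiv.apply_symm_apply, hb]

lemma idLE_coind {Y : ModuleCat.{u} A} {k : ℕ} (h : HasInjectiveDimensionLE Y k) :
    HasInjectiveDimensionLE (coind G Y) k := by
  induction k generalizing Y with
  | zero => exact idLE_zero_iff.2 (injective_coind (idLE_zero_iff.1 h))
  | succ k ih =>
    have e := ses_cosyz Y
    exact e.coind.idLE₁ (ih (e.idLE₃' h (idLE_of_injective inferInstance k)))
      (idLE_of_injective (injective_coind inferInstance) _)

variable {n : ℕ}

/-- By coinduction, orthogonality passes to the coefficients. -/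
lemma LeftOrth.base (hG : SfliLE (MonoidAlgebra A G) n) {W : ModuleCat.{u} (MonoidAlgebra A G)}
    (hW : LeftOrth n W) {Y : ModuleCat.{u} A} {k : ℕ} (hY : HasInjectiveDimensionLE Y k) :
    ExtVanish (base W) Y 1 := by
  obtain ⟨K, P, i, p, hP, e⟩ := exists_ses_projective W
  have := projective_base P
  exact e.base.ext_one (extVanish_of_projective _ _ 0) <|
    (extend_coind_iff i).1 (e.extend (hW _ (hG.fdLE_of_idLE (idLE_coind hY))))

/-- A module `M` of finite flat dimension which is orthogonal to the modules of finite injective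
dimension is flat: by symmetry the quotient of an injective hull of `M⁺` is orthogonal to `M⁺`, so that
the hull splits. -/
lemma SfliLE.fdLE_zero_of_ext {R : Type u} [Ring R] [StarRing R] {s k : ℕ} (hR : SfliLE R s)
    {M : ModuleCat.{u} R} (hM : FdLE M k)
    (h : ∀ Y : ModuleCat.{u} R, HasInjectiveDimensionLE Y s → ExtVanish M Y 1) : FdLE M 0 := by
  have e := ses_cosyz (ch M)
  have hC : FdLE (cosyz (ch M)) s :=
    hR.fdLE_of_idLE (e.idLE₃ hM (idLE_of_injective inferInstance k))
  obtain ⟨r, hr⟩ := e.extend (extVanish_ch_symm (h _ hC)) (𝟙 _)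
  exact idLE_zero_iff.2 (Injective.of_retract ⟨_, r, hr⟩ inferInstance)

/-- Embedding the trivial module in a module of finite flat dimension with quotient orthogonal to all
such modules gives a weak characteristic module, since the quotient is flat over `A`. -/
lemma mem_xWChar_of_sfliLE {G : GrpCat.{u}} {s : ℕ} (hA : SfliLE A s)
    (hG : SfliLE (MonoidAlgebra A G) n) : G ∈ XWChar A := by
  obtain ⟨N, W, ι, g, e, hN, hW⟩ := hG.exists_ses (trivialModule A G)
  have hA0 : FdLE (base (trivialModule A G)) 0 := .of_projective _ 0
  have hWn : FdLE (base W) (n + 1) :=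
    e.base.ch.idLE₁ (idLE_mono (Nat.zero_le n) hA0)
      (idLE_mono (Nat.le_succ n) (fdLE_base hN))
  have hW0 : FdLE (base W) 0 := hA.fdLE_zero_of_ext hWn fun Y hY ↦ hW.base hG hY
  have hflat : Module.Flat A W := module_flat_iff.2 hW0
  refine ⟨N, ι, module_flat_iff.2 (e.base.fdLE₂ hA0 hW0), fd_lt_top_iff.2 ⟨n, hN⟩, e.inj, fun X ↦ ?_⟩
  exact LinearMap.lTensor_injective_of_exact_of_flat (baseMap g).hom e.surj (baseMap ι).hom e.inj
    e.exact X

end Coinduction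

/-! ### Groups of type `Φ` with respect to Gorenstein dimensions -/

section

attribute [local instance] starRingOfComm

variable {A : Type u} [CommRing A]

/-- Over the groups in the class `𝒲`, all modules have finite dimension; conversely this property
characterizes the groups in `𝒲`. Hence a subclass of `𝒲` plays no role in the definition of
`typePhi`. -/
lemma typePhi_eq (dim : (R : Type u) → [Ring R] → ModuleCat.{u} R → WithBot ℕ∞)
    {𝒲 𝒳 : Set GrpCat.{u}}
    (h : ∀ G : GrpCat.{u}, G ∈ 𝒲 ↔ ∀ M : ModuleCat.{u} (MonoidAlgebra A G), dim _ M < ⊤)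
    (h𝒳 : 𝒳 ⊆ 𝒲) : typePhi A dim 𝒳 = 𝒲 := by
  ext G
  rw [h]
  exact forall_congr' fun M ↦
    ⟨fun hM ↦ hM.2 fun H hH ↦ (h _).1 (h𝒳 hH) _, fun hM ↦ ⟨fun _ H hH ↦ (h _).1 (h𝒳 hH) _,
      fun _ ↦ hM⟩⟩

lemma typePhi_Gpd_eq (hA : spli A < ⊤) {𝒳 : Set GrpCat.{u}} (h𝒳 : 𝒳 ⊆ XChar A) :
    typePhi A Gpd 𝒳 = XChar A := by
  obtain ⟨s, hs⟩ := spli_lt_top_iff.1 hA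
  refine typePhi_eq Gpd (fun G ↦ ⟨fun hG M ↦ ?_, fun hG ↦ ?_⟩) h𝒳
  · obtain ⟨n, hn⟩ := exists_spliLE_of_mem hs hG
    exact resolutionDim_lt_top_iff.2 ⟨n, hn.hasResolution M⟩
  · obtain ⟨n, hn⟩ := exists_spliLE_of_resolution fun M ↦ resolutionDim_lt_top_iff.1 (hG M)
    exact mem_xChar_of_spliLE hs hn

lemma typePhi_Gid_eq (hA : spli A < ⊤) {𝒳 : Set GrpCat.{u}} (h𝒳 : 𝒳 ⊆ XChar A) :
    typePhi A Gid 𝒳 = XChar A := by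
  obtain ⟨s, hs⟩ := spli_lt_top_iff.1 hA
  refine typePhi_eq Gid (fun G ↦ ⟨fun hG M ↦ ?_, fun hG ↦ ?_⟩) h𝒳
  · obtain ⟨n, hn⟩ := exists_spliLE_of_mem hs hG
    exact coresolutionDim_lt_top_iff.2 ⟨n, hn.hasCoresolution M⟩
  · obtain ⟨n, hn⟩ := exists_spliLE_of_coresolution fun M ↦ coresolutionDim_lt_top_iff.1 (hG M)
    exact mem_xChar_of_spliLE hs hn

lemma typePhi_Gfd_eq (hA : sfli A < ⊤) {𝒳 : Set GrpCat.{u}} (h𝒳 : 𝒳 ⊆ XWChar A) :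
    typePhi A Gfd 𝒳 = XWChar A := by
  obtain ⟨s, hs⟩ := exists_sfliLE_of_sfli_lt_top hA
  refine typePhi_eq Gfd (fun G ↦ ⟨fun hG M ↦ ?_, fun hG ↦ ?_⟩) h𝒳
  · obtain ⟨n, hn⟩ := exists_sfliLE_of_mem hs hG
    exact resolutionDim_lt_top_iff.2 ⟨n, hn.hasResolution M⟩
  · obtain ⟨n, hn⟩ := exists_sfliLE_of_resolution fun M ↦ resolutionDim_lt_top_iff.1 (hG M)
    exact mem_xWChar_of_sfliLE hs hn

end

end

end TypePhi

theorem corollary3p4 (A : Type u) [CommRing A] :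
    (TypePhi.spli A < ⊤ →
      (∀ 𝒳 : Set GrpCat.{u}, 𝒳 ⊆ TypePhi.XChar A →
        TypePhi.typePhi A TypePhi.Gpd 𝒳 = TypePhi.XChar A ∧
        TypePhi.typePhi A TypePhi.Gid 𝒳 = TypePhi.XChar A) ∧
      (∀ 𝒳 ∈ ({TypePhi.finiteGroups, TypePhi.classicalTypePhi A, TypePhi.XChar A} :
          Set (Set GrpCat.{u})),
        TypePhi.typePhi A TypePhi.Gpd 𝒳 = TypePhi.XChar A ∧
        TypePhi.typePhi A TypePhi.Gid 𝒳 = TypePhi.XChar A)) ∧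
    (TypePhi.sfli A < ⊤ →
      (∀ 𝒳 : Set GrpCat.{u}, 𝒳 ⊆ TypePhi.XWChar A →
        TypePhi.typePhi A TypePhi.Gfd 𝒳 = TypePhi.XWChar A) ∧
      (∀ 𝒳 ∈ ({TypePhi.finiteGroups, TypePhi.classicalTypePhi A, TypePhi.XChar A,
          TypePhi.XWChar A} : Set (Set GrpCat.{u})),
        TypePhi.typePhi A TypePhi.Gfd 𝒳 = TypePhi.XWChar A)) := by
  refine ⟨fun h ↦ ⟨fun 𝒳 h𝒳 ↦ ⟨TypePhi.typePhi_Gpd_eq h h𝒳, TypePhi.typePhi_Gid_eq h h𝒳⟩,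
    fun 𝒳 h𝒳 ↦ ?_⟩, fun h ↦ ⟨fun 𝒳 h𝒳 ↦ TypePhi.typePhi_Gfd_eq h h𝒳, fun 𝒳 h𝒳 ↦ ?_⟩⟩
  · have : 𝒳 ⊆ TypePhi.XChar A := by
      rcases h𝒳 with rfl | rfl | rfl
      exacts [TypePhi.finiteGroups_subset A, TypePhi.classicalTypePhi_subset A, subset_rfl]
    exact ⟨TypePhi.typePhi_Gpd_eq h this, TypePhi.typePhi_Gid_eq h this⟩
  · have hc := TypePhi.xChar_subset A
    refine TypePhi.typePhi_Gfd_eq h ?_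
    rcases h𝒳 with rfl | rfl | rfl | rfl
    exacts [(TypePhi.finiteGroups_subset A).trans hc, (TypePhi.classicalTypePhi_subset A).trans hc,
      hc, subset_rfl]
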